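/- Let $d\ge 2$ and $k\ge 1$ be integers, let $\Omega\subset\mathbb R^d$ be a polytope domain (a nonempty connected open set that is the interior of a finite union of convex polytopes), and let $\{\mathcal T_h\}_h$ be a shape regular family of finite conforming simplicial triangulations of $\overline\Omega$. For each $h$ and each $d$-simplex $K\in\mathcal T_h$ let $x_K$ be a point of the interior of $K$, and let $\mathcal T_h^r$ be the refinement of $\mathcal T_h$ in which each $K$ is replaced by the $d+1$ simplices spanned by $x_K$ and $d$ of the $d+1$ vertices of $K$. Assume that the family $\{\mathcal T_h^r\}_h$ is shape regular as well. (A family of meshes is shape regular if $h_K/\rho_K$ is bounded uniformly over all simplices $K$ of all its meshes, where $h_K$ is the diameter of $K$ and $\rho_K$ is the diameter of the largest ball contained in $K$.) For $\mathcal S=\mathcal T_h$ or $\mathcal S=\mathcal T_h^r$ and $m\ge 0$ let $$\mathring{\boldsymbol{\mathcal P}}{}^c_m(\mathcal S)=\{v\in [H^1_0(\Omega)]^d:\ v|_K\in[\mathcal P_m(K)]^d\ \ \forall K\in\mathcal S\},\qquad \mathring{\mathcal P}_m(\mathcal S)=\Big\{q\in L^2(\Omega):\ \int_\Omega q=0,\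 q|_K\in\mathcal P_m(K)\ \ \forall K\in\mathcal S\Big\},$$ where $\mathcal P_m(K)$ is the space of polynomials of degree at most $m$ on $K$. A family of pairs $V_h-M_h$ with $V_h\subset[H^1_0(\Omega)]^d$ and $M_h\subset\{q\in L^2(\Omega):\int_\Omega q=0\}$ is called inf-sup stable if there is a constant $\gamma>0$, independent of $h$, such that for all $h$ $$\gamma\ \le\ \inf_{0\ne q\in M_h}\ \sup_{0\ne v\in V_h}\ \frac{\int_\Omega q\,\operatorname{div}v}{\|v\|_{H^1(\Omega)}\,\|q\|_{L^2(\Omega)}}$$ (infimum and supremum being taken in $[-\infty,+\infty]$). Theorem. The pair $\mathring{\boldsymbol{\mathcal P}}{}^c_k(\mathcal T_h^r)-\mathring{\mathcal P}_{k-1}(\mathcal T_h^r)$ is inf-sup stable if and only if the pair $\mathring{\boldsymbol{\mathcal P}}{}^c_k(\mathcal T_h)-\mathring{\mathcal P}_0(\mathcal T_h)$ is inf-sup stable. -/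

import Mathlib

open MeasureTheory Set
open scoped ContDiff ENNReal

noncomputable section

namespace StokesFE

/-- The space `ℝ^d` with its Euclidean norm. -/
abbrev Pt (d : ℕ) := EuclideanSpace ℝ (Fin d)

/-- The Lebesgue space `L²(Ω)` of real functions (modulo equality almost everywhere). -/
abbrev L2 {d : ℕ} (Ω : Set (Pt d)) := Lp ℝ 2 (volume.restrict Ω)

/-! ### Sobolev spaces -/

/-- `φ ∈ C_c^∞(Ω)`. -/
def IsTestFunction {d : ℕ} (Ω : Set (Pt d)) (φ : Pt d → ℝ) : Prop :=
  ContDiff ℝ ∞ φ ∧ HasCompactSupport φ ∧ tsupport φ ⊆ Ω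

/-- The classical partial derivative `∂φ/∂x_i`. -/
def partialDeriv {d : ℕ} (i : Fin d) (φ : Pt d → ℝ) (x : Pt d) : ℝ :=
  fderiv ℝ φ x (EuclideanSpace.single i 1)

/-- `g` is a weak partial derivative `∂u/∂x_i` of `u` in `Ω`. -/
def IsWeakPartial {d : ℕ} (Ω : Set (Pt d)) (i : Fin d) (u g : L2 Ω) : Prop :=
  ∀ φ : Pt d → ℝ, IsTestFunction Ω φ →
    ∫ x in Ω, u x * partialDeriv i φ x = - ∫ x in Ω, g x * φ x

/-- Weak partial derivatives in an open set are unique. -/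
theorem IsWeakPartial.unique {d : ℕ} {Ω : Set (Pt d)} (hΩ : IsOpen Ω) {i : Fin d}
    {u g g' : L2 Ω} (h : IsWeakPartial Ω i u g) (h' : IsWeakPartial Ω i u g') : g = g' := by
  have hg : LocallyIntegrable (fun x => g x) (volume.restrict Ω) :=
    (Lp.memLp g).locallyIntegrable (by norm_num)
  have hg' : LocallyIntegrable (fun x => g' x) (volume.restrict Ω) :=
    (Lp.memLp g').locallyIntegrable (by norm_num)
  have key : ∀ᵐ x ∂(volume.restrict Ω), x ∈ Ω → g x - g' x = 0 := by
    refine hΩ.ae_eq_zero_of_integral_contDiff_smul_eq_zero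
      ((hg.sub hg').locallyIntegrableOn Ω) ?_
    intro φ hφ hc hs
    have i1 : Integrable (fun x => φ x • g x) (volume.restrict Ω) :=
      hg.integrable_smul_left_of_hasCompactSupport hφ.continuous hc
    have i2 : Integrable (fun x => φ x • g' x) (volume.restrict Ω) :=
      hg'.integrable_smul_left_of_hasCompactSupport hφ.continuous hc
    have e := (h φ ⟨hφ, hc, hs⟩).symm.trans (h' φ ⟨hφ, hc, hs⟩)
    simp only [smul_sub]
    rw [integral_sub i1 i2]
    simp only [smul_eq_mul, mul_comm (φ _)]
    linarith
  apply Lp.ext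
  filter_upwards [key, ae_restrict_mem hΩ.measurableSet] with x hx hxΩ
  exact sub_eq_zero.1 (hx hxΩ)

/-- `u ∈ H¹(Ω)`: all first weak partial derivatives exist in `L²(Ω)`. -/
def MemH1 {d : ℕ} (Ω : Set (Pt d)) (u : L2 Ω) : Prop :=
  ∀ i : Fin d, ∃ g : L2 Ω, IsWeakPartial Ω i u g

open Classical in
/-- The weak partial derivative `∂u/∂x_i ∈ L²(Ω)` of `u ∈ H¹(Ω)` (and `0` if there is none). -/
def weakPartial {d : ℕ} {Ω : Set (Pt d)} (i : Fin d) (u : L2 Ω) : L2 Ω :=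
  if h : ∃ g : L2 Ω, IsWeakPartial Ω i u g then h.choose else 0

/-- The norm of `H¹(Ω)`. -/
def h1Norm {d : ℕ} {Ω : Set (Pt d)} (u : L2 Ω) : ℝ :=
  √(‖u‖ ^ 2 + ∑ i : Fin d, ‖weakPartial i u‖ ^ 2)

/-- `u ∈ H¹₀(Ω)`: `u` lies in the closure of `C_c^∞(Ω)` in `H¹(Ω)`. -/
def MemH10 {d : ℕ} (Ω : Set (Pt d)) (u : L2 Ω) : Prop :=
  MemH1 Ω u ∧ ∀ ε : ℝ, 0 < ε → ∃ (φ : Pt d → ℝ) (w : L2 Ω), IsTestFunction Ω φ ∧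
    w =ᵐ[volume.restrict Ω] φ ∧ h1Norm (u - w) < ε

/-- The norm of `[H¹(Ω)]^d`. -/
def vecH1Norm {d : ℕ} {Ω : Set (Pt d)} (v : Fin d → L2 Ω) : ℝ :=
  √(∑ j : Fin d, h1Norm (v j) ^ 2)

/-- The divergence of a vector field in `[H¹(Ω)]^d`. -/
def wdiv {d : ℕ} {Ω : Set (Pt d)} (v : Fin d → L2 Ω) : L2 Ω :=
  ∑ i : Fin d, weakPartial i (v i)

/-! ### Meshes -/

/-- A polytope domain: a nonempty connected open set that is the interior of a finite union of
convex polytopes. -/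
def IsPolytopeDomain {d : ℕ} (Ω : Set (Pt d)) : Prop :=
  IsConnected Ω ∧ ∃ P : Set (Finset (Pt d)), P.Finite ∧
    Ω = interior (⋃ s ∈ P, convexHull ℝ (s : Set (Pt d)))

/-- A conforming simplicial triangulation of `Ω`: a finite geometric simplicial complex that
fills the closure of `Ω`. -/
structure IsTriangulation {d : ℕ} (𝒯 : Geometry.SimplicialComplex ℝ (Pt d))
    (Ω : Set (Pt d)) : Prop where
  finite : 𝒯.faces.Finite
  space_eq : 𝒯.space = closure Ω

/-- The elements of a triangulation, that is, its `d`-dimensional simplices. A simplex is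
represented by its set of `d + 1` vertices. -/
def cells {d : ℕ} (𝒯 : Geometry.SimplicialComplex ℝ (Pt d)) : Set (Finset (Pt d)) :=
  {K | K ∈ 𝒯.faces ∧ K.card = d + 1}

/-- The simplex (as a closed subset of `ℝ^d`) with the given vertices. -/
abbrev hull {d : ℕ} (K : Finset (Pt d)) : Set (Pt d) := convexHull ℝ (K : Set (Pt d))

open Classical in
/-- The elements of the refinement that splits every element `K` into the `d + 1` simplices
spanned by the point `x K` and `d` of the `d + 1` vertices of `K`. -/
def refinedCells {d : ℕ} (𝒯 : Geometry.SimplicialComplex ℝ (Pt d))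
    (x : Finset (Pt d) → Pt d) : Set (Finset (Pt d)) :=
  {T | ∃ K ∈ cells 𝒯, ∃ a ∈ K, T = insert (x K) (K.erase a)}

/-- The diameter of the largest ball inscribed in the simplex with vertex set `K`. -/
def inscribedDiam {d : ℕ} (K : Finset (Pt d)) : ℝ :=
  sSup {δ : ℝ | ∃ (c : Pt d) (r : ℝ), 0 ≤ r ∧ Metric.closedBall c r ⊆ hull K ∧ δ = 2 * r}

/-- A family of meshes (given by their elements) is shape regular: the ratios `h_K / ρ_K` of
diameter and inscribed diameter are bounded uniformly over all elements of all meshes. -/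
def ShapeRegular {d : ℕ} {ι : Type*} (S : ι → Set (Finset (Pt d))) : Prop :=
  ∃ C : ℝ, ∀ h, ∀ K ∈ S h, Metric.diam (hull K) / inscribedDiam K ≤ C

/-! ### Finite element spaces -/

/-- `q|_K` is a polynomial of degree at most `k`. -/
def IsPolyOn {d : ℕ} {Ω : Set (Pt d)} (k : ℕ) (K : Finset (Pt d)) (q : L2 Ω) : Prop :=
  ∃ p : MvPolynomial (Fin d) ℝ, p.totalDegree ≤ k ∧
    ∀ᵐ y ∂(volume.restrict Ω), y ∈ hull K → q y = MvPolynomial.eval (fun i => y i) p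

/-- The velocity space of fields `v ∈ [H¹₀(Ω)]^d` with `v|_K ∈ [P_k(K)]^d` for every `K ∈ S`. -/
def velocitySpace {d : ℕ} (Ω : Set (Pt d)) (k : ℕ) (S : Set (Finset (Pt d))) :
    Set (Fin d → L2 Ω) :=
  {v | ∀ j, MemH10 Ω (v j) ∧ ∀ K ∈ S, IsPolyOn k K (v j)}

/-- The pressure space of functions `q ∈ L²(Ω)` with zero mean and `q|_K ∈ P_k(K)` for every
`K ∈ S`. -/
def pressureSpace {d : ℕ} (Ω : Set (Pt d)) (k : ℕ) (S : Set (Finset (Pt d))) : Set (L2 Ω) :=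
  {q | (∫ y in Ω, q y) = 0 ∧ ∀ K ∈ S, IsPolyOn k K q}

/-- A family of pairs `V h - M h` of a velocity and a pressure space is inf-sup stable: some
constant `γ > 0`, the same for all members of the family, bounds the inf-sup constants from
below. Infimum and supremum are taken in the extended reals. -/
def InfSupStable {d : ℕ} {Ω : Set (Pt d)} {ι : Type*} (V : ι → Set (Fin d → L2 Ω))
    (M : ι → Set (L2 Ω)) : Prop :=
  ∃ γ : ℝ, 0 < γ ∧ ∀ h, (γ : EReal) ≤ ⨅ q ∈ M h \ {0}, ⨆ v ∈ V h \ {0},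
    (((∫ y in Ω, q y * wdiv v y) / (vecH1Norm v * ‖q‖) : ℝ) : EReal)

end StokesFE

end

/-!
Stability of a pair means that for every pressure `q` there is a velocity `v` in the finite element
space with `β * ‖q‖ ^ 2 ≤ ⟪q, div v⟫` and `‖v‖_{H¹} ≤ ‖q‖` (`infSupStable_iff`). The two pairs are
compared by adding and removing *bubbles*: fields in the velocity space of the refined mesh which
vanish on the boundary of every simplex of the unrefined mesh.

**Split simplices.** On a simplex of the triangulation let `μ a` be the affine function equal to `1`
at the splitting point and to `0` on the facet opposite the vertex `a`. The part of the simplex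
opposite the vertex `a` is the set `0 ≤ μ a ≤ μ e` for all `e`. Hence a family of polynomials, one
for each part, is continuous if the members `a` and `b` agree where `μ a = μ b`, and it is a bubble
if the member `a` also vanishes where `μ a = 0`. Shape regularity of the triangulations and of
their refinements gives every part a ball of radius `σ * h`, where `h` is the diameter of the
simplex (`exists_forall_regular`). In coordinates scaled by `h` this bounds the `μ a`
(`SplitCell.Regular.polyBound_mu`) and bounds the coefficients of a polynomial by its `L²` norm, so
that all constants below depend on `σ`, the dimension, the degree and the diameter of `Ω` only.

**Refined pair from unrefined pair** (`exists_refined_stable`). Write `q = q₀ + q₁`, where `q₀`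
consists of the means of `q` on the unrefined simplices. The assumed stability provides a velocity
`v₀` for `q₀`. The rest `q₁` is the divergence of a bubble `v₁` whose norm is controlled by that of
`q₁` (`exists_wdiv_eq`), so a combination of `v₀` and `v₁` is a velocity for `q`. The bubble comes
from an algebraic fact on a single split simplex (`SplitSimplex.exists_div_eq`). Any family
`q a` of polynomials of degree `m ≥ 1` can be written `∇(μ a) · w + μ a * t a` with one polynomial
field `w` of degree `m` and polynomials `t a` of degree `m - 1`. The divergence of
`μ a ^ (s + 1) * w / (s + 1)` is `μ a ^ s * ∇(μ a) · w` up to a multiple of `μ a ^ (s + 1)`, so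
induction on the degree, for all `s`, leaves a constant multiple of `μ a ^ m`. It vanishes since
both `q₁` and the divergence of a bubble have zero mean on the simplex.

**Unrefined pair from refined pair** (`exists_coarse_stable`). Let `v` be a velocity of the refined
space. Its pieces agree on the common facets of the parts, since a function in `H¹` does not jump
(`eq_of_memH1_of_two_sided`, `IsSplitMesh.sev_eq_of_memH1`). The boundary values on a simplex
are interpolated by one polynomial of the same degree (`SplitSimplex.exists_interpolant`), built by
inclusion-exclusion over the faces. The difference of `v` and the interpolant is a bubble; its
derivatives have zero mean on every simplex, so that removing it does not change the pairing of
`div v` with piecewise constants, and its norm is controlled by that of `v`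
(`exists_bubble_correction`).

**Bubbles in `H¹₀`.** A bubble is a compactly supported Lipschitz function vanishing outside `Ω`.
Soft thresholding makes its support a compact subset of `Ω`, and mollification then shows that it
belongs to `H¹₀(Ω)` (`memH10_of_lipschitz`). Weak derivatives of functions which are
smooth on an open set are the classical ones there (`IsWeakPartial.ae_eq_partialDeriv`), which
computes the divergence part by part.
-/


namespace StokesFE

/-! ### Weak derivatives and the `H¹` norm -/

section Sobolev

variable {d : ℕ} {Ω : Set (Pt d)}

theorem integral_mul_eq_inner (q w : L2 Ω) : ∫ y in Ω, q y * w y = inner ℝ q w := by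
  rw [L2.inner_def]
  refine integral_congr_ae (Filter.Eventually.of_forall fun x => ?_)
  simp [mul_comm]

theorem integrable_mul_of_hasCompactSupport (u : L2 Ω) {ψ : Pt d → ℝ} (hψ : Continuous ψ)
    (hc : HasCompactSupport ψ) : Integrable (fun x => u x * ψ x) (volume.restrict Ω) := by
  have hu : LocallyIntegrable (fun x => u x) (volume.restrict Ω) :=
    (Lp.memLp u).locallyIntegrable (by norm_num)
  simpa [mul_comm] using hu.integrable_smul_left_of_hasCompactSupport hψ hc

theorem IsTestFunction.continuous_partialDeriv {φ : Pt d → ℝ} (hφ : IsTestFunction Ω φ)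
    (i : Fin d) : Continuous (partialDeriv i φ) :=
  (hφ.1.continuous_fderiv (by simp)).clm_apply continuous_const

theorem IsTestFunction.hasCompactSupport_partialDeriv {φ : Pt d → ℝ} (hφ : IsTestFunction Ω φ)
    (i : Fin d) : HasCompactSupport (partialDeriv i φ) :=
  hφ.2.1.fderiv_apply (𝕜 := ℝ) _

theorem IsWeakPartial.add {i : Fin d} {u w g g' : L2 Ω} (hu : IsWeakPartial Ω i u g)
    (hw : IsWeakPartial Ω i w g') : IsWeakPartial Ω i (u + w) (g + g') := by
  intro φ hφ
  have h1 := hφ.continuous_partialDeriv i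
  have h2 := hφ.hasCompactSupport_partialDeriv i
  have e1 : ∫ x in Ω, (u + w : L2 Ω) x * partialDeriv i φ x =
      (∫ x in Ω, u x * partialDeriv i φ x) + ∫ x in Ω, w x * partialDeriv i φ x := by
    rw [← integral_add (integrable_mul_of_hasCompactSupport u h1 h2)
      (integrable_mul_of_hasCompactSupport w h1 h2)]
    refine integral_congr_ae ?_
    filter_upwards [Lp.coeFn_add u w] with x hx
    rw [hx, Pi.add_apply, add_mul]
  have e2 : ∫ x in Ω, (g + g' : L2 Ω) x * φ x =
      (∫ x in Ω, g x * φ x) + ∫ x in Ω, g' x * φ x := by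
    rw [← integral_add (integrable_mul_of_hasCompactSupport g hφ.1.continuous hφ.2.1)
      (integrable_mul_of_hasCompactSupport g' hφ.1.continuous hφ.2.1)]
    refine integral_congr_ae ?_
    filter_upwards [Lp.coeFn_add g g'] with x hx
    rw [hx, Pi.add_apply, add_mul]
  rw [e1, e2, hu φ hφ, hw φ hφ, neg_add]

theorem IsWeakPartial.smul {i : Fin d} {u g : L2 Ω} (hu : IsWeakPartial Ω i u g) (c : ℝ) :
    IsWeakPartial Ω i (c • u) (c • g) := by
  intro φ hφ
  have e : ∀ (w : L2 Ω) (ψ : Pt d → ℝ),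
      ∫ x in Ω, (c • w : L2 Ω) x * ψ x = c * ∫ x in Ω, w x * ψ x := by
    intro w ψ
    rw [← integral_const_mul]
    refine integral_congr_ae ?_
    filter_upwards [Lp.coeFn_smul c w] with x hx
    rw [hx, Pi.smul_apply, smul_eq_mul, mul_assoc]
  rw [e, e, hu φ hφ, mul_neg]

theorem isWeakPartial_weakPartial {u : L2 Ω} (hu : MemH1 Ω u) (i : Fin d) :
    IsWeakPartial Ω i u (weakPartial i u) := by
  unfold weakPartial
  rw [dif_pos (hu i)]
  exact (hu i).choose_spec

theorem IsWeakPartial.weakPartial_eq (hΩ : IsOpen Ω) {i : Fin d} {u g : L2 Ω}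
    (h : IsWeakPartial Ω i u g) : weakPartial i u = g := by
  have hex : ∃ g : L2 Ω, IsWeakPartial Ω i u g := ⟨g, h⟩
  unfold weakPartial
  rw [dif_pos hex]
  exact hex.choose_spec.unique hΩ h

theorem MemH1.add {u w : L2 Ω} (hu : MemH1 Ω u) (hw : MemH1 Ω w) : MemH1 Ω (u + w) :=
  fun i => ⟨_, (isWeakPartial_weakPartial hu i).add (isWeakPartial_weakPartial hw i)⟩

theorem MemH1.smul {u : L2 Ω} (hu : MemH1 Ω u) (c : ℝ) : MemH1 Ω (c • u) :=
  fun i => ⟨_, (isWeakPartial_weakPartial hu i).smul c⟩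

theorem MemH1.sub {u w : L2 Ω} (hu : MemH1 Ω u) (hw : MemH1 Ω w) : MemH1 Ω (u - w) := by
  simpa [sub_eq_add_neg] using hu.add (hw.smul (-1))

theorem weakPartial_add (hΩ : IsOpen Ω) {u w : L2 Ω} (hu : MemH1 Ω u) (hw : MemH1 Ω w)
    (i : Fin d) : weakPartial i (u + w) = weakPartial i u + weakPartial i w :=
  ((isWeakPartial_weakPartial hu i).add (isWeakPartial_weakPartial hw i)).weakPartial_eq hΩ

theorem weakPartial_smul (hΩ : IsOpen Ω) {u : L2 Ω} (hu : MemH1 Ω u) (c : ℝ)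
    (i : Fin d) : weakPartial i (c • u) = c • weakPartial i u :=
  ((isWeakPartial_weakPartial hu i).smul c).weakPartial_eq hΩ

theorem weakPartial_sub (hΩ : IsOpen Ω) {u w : L2 Ω} (hu : MemH1 Ω u) (hw : MemH1 Ω w)
    (i : Fin d) : weakPartial i (u - w) = weakPartial i u - weakPartial i w := by
  have := weakPartial_add hΩ hu (hw.smul (-1)) i
  rw [weakPartial_smul hΩ hw] at this
  simpa [sub_eq_add_neg] using this

theorem h1Norm_nonneg (u : L2 Ω) : 0 ≤ h1Norm u := Real.sqrt_nonneg _

theorem h1Norm_sq (u : L2 Ω) : h1Norm u ^ 2 = ‖u‖ ^ 2 + ∑ i : Fin d, ‖weakPartial i u‖ ^ 2 :=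
  Real.sq_sqrt (by positivity)

theorem vecH1Norm_nonneg (v : Fin d → L2 Ω) : 0 ≤ vecH1Norm v := Real.sqrt_nonneg _

theorem vecH1Norm_sq (v : Fin d → L2 Ω) : vecH1Norm v ^ 2 = ∑ j : Fin d, h1Norm (v j) ^ 2 :=
  Real.sq_sqrt (by positivity)

theorem norm_add_sq_le_two {E : Type*} [SeminormedAddCommGroup E] (a b : E) :
    ‖a + b‖ ^ 2 ≤ 2 * ‖a‖ ^ 2 + 2 * ‖b‖ ^ 2 := by
  nlinarith [norm_add_le a b, norm_nonneg (a + b), sq_nonneg (‖a‖ - ‖b‖)]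

theorem h1Norm_add_sq_le (hΩ : IsOpen Ω) {u w : L2 Ω} (hu : MemH1 Ω u) (hw : MemH1 Ω w) :
    h1Norm (u + w) ^ 2 ≤ 2 * h1Norm u ^ 2 + 2 * h1Norm w ^ 2 := by
  have h2 : ∑ i : Fin d, ‖weakPartial i (u + w)‖ ^ 2 ≤
      2 * ∑ i : Fin d, ‖weakPartial i u‖ ^ 2 + 2 * ∑ i : Fin d, ‖weakPartial i w‖ ^ 2 := by
    rw [Finset.mul_sum, Finset.mul_sum, ← Finset.sum_add_distrib]
    refine Finset.sum_le_sum fun i _ => ?_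
    rw [weakPartial_add hΩ hu hw]
    exact norm_add_sq_le_two _ _
  rw [h1Norm_sq, h1Norm_sq, h1Norm_sq]
  linarith [norm_add_sq_le_two u w]

theorem h1Norm_smul_sq (hΩ : IsOpen Ω) {u : L2 Ω} (hu : MemH1 Ω u) (c : ℝ) :
    h1Norm (c • u) ^ 2 = c ^ 2 * h1Norm u ^ 2 := by
  rw [h1Norm_sq, h1Norm_sq, mul_add, Finset.mul_sum]
  simp only [weakPartial_smul hΩ hu, norm_smul, mul_pow, Real.norm_eq_abs, sq_abs]

theorem vecH1Norm_add_sq_le (hΩ : IsOpen Ω) {v w : Fin d → L2 Ω} (hv : ∀ j, MemH1 Ω (v j))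
    (hw : ∀ j, MemH1 Ω (w j)) :
    vecH1Norm (v + w) ^ 2 ≤ 2 * vecH1Norm v ^ 2 + 2 * vecH1Norm w ^ 2 := by
  simp only [vecH1Norm_sq, Finset.mul_sum, ← Finset.sum_add_distrib]
  exact Finset.sum_le_sum fun j _ => h1Norm_add_sq_le hΩ (hv j) (hw j)

theorem vecH1Norm_smul (hΩ : IsOpen Ω) {v : Fin d → L2 Ω} (hv : ∀ j, MemH1 Ω (v j)) (c : ℝ) :
    vecH1Norm (c • v) = |c| * vecH1Norm v := by
  have : vecH1Norm (c • v) ^ 2 = (|c| * vecH1Norm v) ^ 2 := by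
    rw [mul_pow, vecH1Norm_sq, vecH1Norm_sq, Finset.mul_sum, sq_abs]
    exact Finset.sum_congr rfl fun j _ => h1Norm_smul_sq hΩ (hv j) c
  exact (pow_left_inj₀ (vecH1Norm_nonneg _)
    (mul_nonneg (abs_nonneg _) (vecH1Norm_nonneg _)) two_ne_zero).1 this

theorem vecH1Norm_pos {v : Fin d → L2 Ω} (hv : v ≠ 0) : 0 < vecH1Norm v := by
  obtain ⟨j, hj⟩ := Function.ne_iff.1 hv
  have hj' : v j ≠ 0 := hj
  have h0 : 0 < ‖v j‖ ^ 2 := pow_pos (norm_pos_iff.2 hj') 2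
  have h1 := h1Norm_sq (v j)
  have h1' : 0 ≤ ∑ i : Fin d, ‖weakPartial i (v j)‖ ^ 2 :=
    Finset.sum_nonneg fun _ _ => sq_nonneg _
  have h2 : h1Norm (v j) ^ 2 ≤ vecH1Norm v ^ 2 := by
    rw [vecH1Norm_sq]
    exact Finset.single_le_sum (f := fun j => h1Norm (v j) ^ 2) (fun _ _ => sq_nonneg _)
      (Finset.mem_univ j)
  refine lt_of_le_of_ne (vecH1Norm_nonneg v) fun h => ?_
  rw [← h] at h2
  linarith

theorem wdiv_add (hΩ : IsOpen Ω) {v w : Fin d → L2 Ω} (hv : ∀ j, MemH1 Ω (v j))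
    (hw : ∀ j, MemH1 Ω (w j)) : wdiv (v + w) = wdiv v + wdiv w := by
  unfold wdiv
  rw [← Finset.sum_add_distrib]
  exact Finset.sum_congr rfl fun i _ => weakPartial_add hΩ (hv i) (hw i) i

theorem wdiv_smul (hΩ : IsOpen Ω) {v : Fin d → L2 Ω} (hv : ∀ j, MemH1 Ω (v j)) (c : ℝ) :
    wdiv (c • v) = c • wdiv v := by
  unfold wdiv
  rw [Finset.smul_sum]
  exact Finset.sum_congr rfl fun i _ => weakPartial_smul hΩ (hv i) c i

theorem norm_wdiv_sq_le (v : Fin d → L2 Ω) : ‖wdiv v‖ ^ 2 ≤ d * vecH1Norm v ^ 2 := by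
  have h1 : ‖wdiv v‖ ≤ ∑ i : Fin d, ‖weakPartial i (v i)‖ := norm_sum_le _ _
  have h2 : (∑ i : Fin d, ‖weakPartial i (v i)‖) ^ 2 ≤
      d * ∑ i : Fin d, ‖weakPartial i (v i)‖ ^ 2 := by
    simpa using sq_sum_le_card_mul_sum_sq (s := Finset.univ)
      (f := fun i : Fin d => ‖weakPartial i (v i)‖)
  have h3 : ∑ i : Fin d, ‖weakPartial i (v i)‖ ^ 2 ≤ vecH1Norm v ^ 2 := by
    rw [vecH1Norm_sq]
    refine Finset.sum_le_sum fun i _ => ?_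
    rw [h1Norm_sq]
    have := Finset.single_le_sum (f := fun j => ‖weakPartial j (v i)‖ ^ 2)
      (fun _ _ => sq_nonneg _) (Finset.mem_univ i)
    linarith [sq_nonneg ‖v i‖]
  have h4 : ‖wdiv v‖ ^ 2 ≤ (∑ i : Fin d, ‖weakPartial i (v i)‖) ^ 2 :=
    pow_le_pow_left₀ (norm_nonneg _) h1 2
  have h5 : (0 : ℝ) ≤ d := Nat.cast_nonneg d
  nlinarith

/-! ### Reformulation of inf-sup stability -/

/-- Inf-sup stability in terms of almost maximizing velocities, normalized so that their norm is
at most that of the pressure. -/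
theorem infSupStable_iff (hΩ : IsOpen Ω) {ι : Type*} {V : ι → Set (Fin d → L2 Ω)}
    {M : ι → Set (L2 Ω)} (hV0 : ∀ h, 0 ∈ V h) (hVs : ∀ h, ∀ v ∈ V h, ∀ c : ℝ, c • v ∈ V h)
    (hV1 : ∀ h, ∀ v ∈ V h, ∀ j, MemH1 Ω (v j)) :
    InfSupStable V M ↔ ∃ β : ℝ, 0 < β ∧ ∀ h, ∀ q ∈ M h, ∃ v ∈ V h,
      β * ‖q‖ ^ 2 ≤ inner ℝ q (wdiv v) ∧ vecH1Norm v ≤ ‖q‖ := by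
  unfold InfSupStable
  simp only [integral_mul_eq_inner]
  constructor
  · rintro ⟨γ, hγ, H⟩
    refine ⟨γ / 2, by positivity, fun h q hq => ?_⟩
    by_cases hq0 : q = 0
    · refine ⟨0, hV0 h, by simp [hq0], ?_⟩
      have := vecH1Norm_smul hΩ (hV1 h 0 (hV0 h)) 0
      rw [zero_smul, abs_zero, zero_mul] at this
      rw [this]
      exact norm_nonneg _
    have h1 : (γ : EReal) ≤ ⨆ v ∈ V h \ {0},
        ((inner ℝ q (wdiv v) / (vecH1Norm v * ‖q‖) : ℝ) : EReal) :=
      (H h).trans (iInf₂_le q ⟨hq, hq0⟩)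
    have h2 : ((γ / 2 : ℝ) : EReal) < γ := EReal.coe_lt_coe_iff.2 (by linarith)
    obtain ⟨v, hv⟩ := lt_iSup_iff.1 (h2.trans_le h1)
    obtain ⟨hvV, hv⟩ := lt_iSup_iff.1 hv
    have hv' := EReal.coe_lt_coe_iff.1 hv
    have hvp := vecH1Norm_pos hvV.2
    have hqp : 0 < ‖q‖ := norm_pos_iff.2 hq0
    rw [lt_div_iff₀ (by positivity)] at hv'
    refine ⟨(‖q‖ / vecH1Norm v) • v, hVs h v hvV.1 _, ?_, ?_⟩
    · rw [wdiv_smul hΩ (hV1 h v hvV.1), inner_smul_right]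
      calc γ / 2 * ‖q‖ ^ 2 = ‖q‖ / vecH1Norm v * (γ / 2 * (vecH1Norm v * ‖q‖)) := by
            field_simp
        _ ≤ _ := by gcongr
    · rw [vecH1Norm_smul hΩ (hV1 h v hvV.1), abs_of_pos (by positivity),
        div_mul_cancel₀ _ hvp.ne']
  · rintro ⟨β, hβ, H⟩
    refine ⟨β, hβ, fun h => le_iInf₂ fun q hq => ?_⟩
    obtain ⟨v, hvV, hv, hvn⟩ := H h q hq.1
    have hqp : 0 < ‖q‖ := norm_pos_iff.2 hq.2
    have hv0 : v ≠ 0 := by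
      rintro rfl
      have h0 := wdiv_smul hΩ (hV1 h 0 (hV0 h)) 0
      rw [zero_smul, zero_smul] at h0
      rw [h0, inner_zero_right] at hv
      have : 0 < β * ‖q‖ ^ 2 := by positivity
      linarith
    refine le_iSup₂_of_le v ⟨hvV, hv0⟩ (EReal.coe_le_coe_iff.2 ?_)
    have hvp := vecH1Norm_pos hv0
    rw [le_div_iff₀ (by positivity)]
    calc β * (vecH1Norm v * ‖q‖) ≤ β * (‖q‖ * ‖q‖) := by gcongr
      _ ≤ _ := by rw [← sq]; exact hv

end Sobolev

/-! ### Lipschitz functions in `H¹₀` -/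

section Lipschitz

open Filter Topology
open scoped Convolution NNReal

variable {d : ℕ} {Ω : Set (Pt d)}

/-- The `i`-th coordinate vector of `ℝ^d`. -/
noncomputable abbrev stdVec {d : ℕ} (i : Fin d) : Pt d := EuclideanSpace.single i 1

theorem norm_toLp_sq {f : Pt d → ℝ} (hf : MemLp f 2 (volume.restrict Ω)) :
    ‖hf.toLp f‖ ^ 2 = ∫ x in Ω, f x ^ 2 := by
  rw [← real_inner_self_eq_norm_sq, ← integral_mul_eq_inner]
  refine integral_congr_ae ?_
  filter_upwards [hf.coeFn_toLp] with x hx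
  rw [hx, sq]

theorem norm_sq_eq_integral (q : L2 Ω) : ‖q‖ ^ 2 = ∫ x in Ω, q x ^ 2 := by
  rw [← real_inner_self_eq_norm_sq, ← integral_mul_eq_inner]
  simp only [sq]

theorem isFiniteMeasure_restrict_of_isBounded (hb : Bornology.IsBounded Ω) :
    IsFiniteMeasure (volume.restrict Ω) :=
  ⟨by rw [Measure.restrict_apply_univ]; exact hb.measure_lt_top⟩

theorem tendsto_norm_toLp_sub [IsFiniteMeasure (volume.restrict Ω)] {F : ℕ → Pt d → ℝ}
    {f : Pt d → ℝ} (hF : ∀ n, MemLp (F n) 2 (volume.restrict Ω))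
    (hf : MemLp f 2 (volume.restrict Ω)) {B : ℝ}
    (hB : ∀ n, ∀ᵐ x ∂(volume.restrict Ω), |f x - F n x| ≤ B)
    (hlim : ∀ᵐ x ∂(volume.restrict Ω), Tendsto (fun n => F n x) atTop (𝓝 (f x))) :
    Tendsto (fun n => ‖hf.toLp f - (hF n).toLp (F n)‖ ^ 2) atTop (𝓝 0) := by
  have h1 : ∀ n, ‖hf.toLp f - (hF n).toLp (F n)‖ ^ 2 = ∫ x in Ω, (f x - F n x) ^ 2 := by
    intro n
    rw [← MemLp.toLp_sub, norm_toLp_sq]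
    rfl
  simp only [h1]
  have h2 : (0 : ℝ) = ∫ x in Ω, (0 : ℝ) := by simp
  rw [h2]
  refine tendsto_integral_of_dominated_convergence (fun _ => B ^ 2) ?_ (integrable_const _) ?_ ?_
  · intro n
    exact ((hf.sub (hF n)).aestronglyMeasurable).pow 2
  · intro n
    filter_upwards [hB n] with x hx
    rw [Real.norm_eq_abs, abs_pow]
    exact pow_le_pow_left₀ (abs_nonneg _) hx 2
  · filter_upwards [hlim] with x hx
    have : Tendsto (fun n => (f x - F n x) ^ 2) atTop (𝓝 ((f x - f x) ^ 2)) :=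
      (tendsto_const_nhds.sub hx).pow 2
    simpa using this

theorem memLp_two_lineDeriv [IsFiniteMeasure (volume.restrict Ω)] {C : ℝ≥0}
    {z : Pt d → ℝ} (hz : LipschitzWith C z) (v : Pt d) :
    MemLp (fun x => lineDeriv ℝ z x v) 2 (volume.restrict Ω) :=
  ((hz.memLp_lineDeriv (μ := volume) v).restrict Ω).mono_exponent le_top

theorem IsTestFunction.lineDeriv_eq {φ : Pt d → ℝ} (hφ : IsTestFunction Ω φ) (i : Fin d)
    (x : Pt d) : lineDeriv ℝ φ x (stdVec i) = partialDeriv i φ x :=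
  ((hφ.1.differentiable (by simp)) x).lineDeriv_eq_fderiv

theorem IsTestFunction.eq_zero {φ : Pt d → ℝ} (hφ : IsTestFunction Ω φ) {x : Pt d}
    (hx : x ∉ Ω) : φ x = 0 :=
  image_eq_zero_of_notMem_tsupport fun h => hx (hφ.2.2 h)

theorem IsTestFunction.partialDeriv_eq_zero {φ : Pt d → ℝ} (hφ : IsTestFunction Ω φ) {x : Pt d}
    (hx : x ∉ Ω) (i : Fin d) : partialDeriv i φ x = 0 := by
  have : x ∉ tsupport (fderiv ℝ φ) := fun h => hx (hφ.2.2 (tsupport_fderiv_subset ℝ h))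
  rw [partialDeriv, image_eq_zero_of_notMem_tsupport this]
  rfl

/-- Integration by parts for a Lipschitz function. -/
theorem setIntegral_mul_partialDeriv_of_lipschitz {C : ℝ≥0}
    {z : Pt d → ℝ} (hz : LipschitzWith C z) {φ : Pt d → ℝ} (hφ : IsTestFunction Ω φ) (i : Fin d) :
    ∫ x in Ω, z x * partialDeriv i φ x = - ∫ x in Ω, lineDeriv ℝ z x (stdVec i) * φ x := by
  obtain ⟨D, hD⟩ := ContDiff.lipschitzWith_of_hasCompactSupport hφ.2.1 hφ.1 (by simp)
  rw [setIntegral_eq_integral_of_forall_compl_eq_zero, setIntegral_eq_integral_of_forall_compl_eq_zero,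
    hz.integral_lineDeriv_mul_eq hD hφ.2.1, ← integral_neg]
  · refine integral_congr_ae (Eventually.of_forall fun x => ?_)
    simp only [lineDeriv_neg, hφ.lineDeriv_eq]
    ring
  · intro x hx
    rw [hφ.eq_zero hx, mul_zero]
  · intro x hx
    rw [hφ.partialDeriv_eq_zero hx, mul_zero]

theorem isWeakPartial_of_lipschitz {C : ℝ≥0}
    {z g : Pt d → ℝ} (hz : LipschitzWith C z) (i : Fin d) (hz2 : MemLp z 2 (volume.restrict Ω))
    (hg2 : MemLp g 2 (volume.restrict Ω))
    (hg : g =ᵐ[volume.restrict Ω] fun x => lineDeriv ℝ z x (stdVec i)) :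
    IsWeakPartial Ω i (hz2.toLp z) (hg2.toLp g) := by
  intro φ hφ
  have h1 : ∫ x in Ω, hz2.toLp z x * partialDeriv i φ x = ∫ x in Ω, z x * partialDeriv i φ x := by
    refine integral_congr_ae ?_
    filter_upwards [hz2.coeFn_toLp] with x hx
    rw [hx]
  have h2 : ∫ x in Ω, hg2.toLp g x * φ x = ∫ x in Ω, lineDeriv ℝ z x (stdVec i) * φ x := by
    refine integral_congr_ae ?_
    filter_upwards [hg2.coeFn_toLp, hg] with x hx hx'
    rw [hx, hx']
  rw [h1, h2, setIntegral_mul_partialDeriv_of_lipschitz hz hφ]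

theorem IsTestFunction.add {φ ψ : Pt d → ℝ} (hφ : IsTestFunction Ω φ) (hψ : IsTestFunction Ω ψ) :
    IsTestFunction Ω (φ + ψ) :=
  ⟨hφ.1.add hψ.1, hφ.2.1.add hψ.2.1,
    (tsupport_add φ ψ).trans (union_subset hφ.2.2 hψ.2.2)⟩

theorem IsTestFunction.smul {φ : Pt d → ℝ} (hφ : IsTestFunction Ω φ) (c : ℝ) :
    IsTestFunction Ω (c • φ) :=
  ⟨contDiff_const.smul hφ.1, hφ.2.1.smul_left (f := fun _ => c),
    (tsupport_smul_subset_right (fun _ => c) φ).trans hφ.2.2⟩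

theorem IsTestFunction.memH1 {φ : Pt d → ℝ} [IsFiniteMeasure (volume.restrict Ω)]
    (hφ : IsTestFunction Ω φ) {w : L2 Ω}
    (hw : w =ᵐ[volume.restrict Ω] φ) : MemH1 Ω w := by
  obtain ⟨D, hD⟩ := ContDiff.lipschitzWith_of_hasCompactSupport hφ.2.1 hφ.1 (by simp)
  intro i
  have hm : MemLp φ 2 (volume.restrict Ω) := (memLp_congr_ae hw).1 (Lp.memLp w)
  have : w = hm.toLp φ := Lp.ext (hw.trans hm.coeFn_toLp.symm)
  rw [this]
  exact ⟨_, isWeakPartial_of_lipschitz hD i hm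
    (memLp_two_lineDeriv hD (stdVec i)) (ae_eq_refl _)⟩

theorem lt_of_sq_lt {a b : ℝ} (hb : 0 < b) (h : a ^ 2 < b ^ 2) : a < b :=
  lt_of_pow_lt_pow_left₀ 2 hb.le h

theorem MemH10.add [IsFiniteMeasure (volume.restrict Ω)] (hΩ : IsOpen Ω) {u v : L2 Ω}
    (hu : MemH10 Ω u) (hv : MemH10 Ω v) : MemH10 Ω (u + v) := by
  refine ⟨hu.1.add hv.1, fun ε hε => ?_⟩
  obtain ⟨φ, w, hφ, hw, h1⟩ := hu.2 (ε / 2) (by positivity)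
  obtain ⟨ψ, w', hψ, hw', h2⟩ := hv.2 (ε / 2) (by positivity)
  refine ⟨φ + ψ, w + w', hφ.add hψ, (Lp.coeFn_add w w').trans (hw.add hw'), ?_⟩
  have e : u + v - (w + w') = (u - w) + (v - w') := by abel
  rw [e]
  have h3 := h1Norm_add_sq_le hΩ (hu.1.sub (hφ.memH1 hw)) (hv.1.sub (hψ.memH1 hw'))
  have h4 : h1Norm (u - w) ^ 2 < (ε / 2) ^ 2 := pow_lt_pow_left₀ h1 (h1Norm_nonneg _) two_ne_zero
  have h5 : h1Norm (v - w') ^ 2 < (ε / 2) ^ 2 := pow_lt_pow_left₀ h2 (h1Norm_nonneg _) two_ne_zero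
  exact lt_of_sq_lt hε (by linarith)

theorem MemH10.smul [IsFiniteMeasure (volume.restrict Ω)] (hΩ : IsOpen Ω) {u : L2 Ω}
    (hu : MemH10 Ω u) (c : ℝ) : MemH10 Ω (c • u) := by
  refine ⟨hu.1.smul c, fun ε hε => ?_⟩
  obtain ⟨φ, w, hφ, hw, h1⟩ := hu.2 (ε / (|c| + 1)) (by positivity)
  refine ⟨c • φ, c • w, hφ.smul c, (Lp.coeFn_smul c w).trans (hw.const_smul c), ?_⟩
  have h2 := h1Norm_smul_sq hΩ (hu.1.sub (hφ.memH1 hw)) c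
  rw [← smul_sub]
  rw [lt_div_iff₀ (by positivity)] at h1
  refine lt_of_sq_lt hε (h2.trans_lt ?_)
  rw [← sq_abs c, ← mul_pow]
  refine pow_lt_pow_left₀ (lt_of_le_of_lt ?_ h1)
    (mul_nonneg (abs_nonneg _) (h1Norm_nonneg _)) two_ne_zero
  nlinarith [h1Norm_nonneg (u - w), abs_nonneg c]

theorem MemH10.of_forall_exists [IsFiniteMeasure (volume.restrict Ω)] (hΩ : IsOpen Ω) {u : L2 Ω}
    (hu : MemH1 Ω u) (h : ∀ ε : ℝ, 0 < ε → ∃ w, MemH10 Ω w ∧ h1Norm (u - w) ^ 2 < ε) :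
    MemH10 Ω u := by
  refine ⟨hu, fun ε hε => ?_⟩
  obtain ⟨w, hw, h1⟩ := h ((ε / 2) ^ 2) (by positivity)
  obtain ⟨φ, w', hφ, hw', h2⟩ := hw.2 (ε / 2) (by positivity)
  refine ⟨φ, w', hφ, hw', ?_⟩
  have e : u - w' = (u - w) + (w - w') := by abel
  rw [e]
  have h3 := h1Norm_add_sq_le hΩ (hu.sub hw.1) (hw.1.sub (hφ.memH1 hw'))
  have h5 : h1Norm (w - w') ^ 2 < (ε / 2) ^ 2 := pow_lt_pow_left₀ h2 (h1Norm_nonneg _) two_ne_zero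
  exact lt_of_sq_lt hε (by linarith)

/-- Convergence in `H¹` from bounded pointwise convergence of functions and gradients. -/
theorem tendsto_h1Norm_sub_sq [IsFiniteMeasure (volume.restrict Ω)] (hΩ : IsOpen Ω)
    {F : ℕ → Pt d → ℝ} {f : Pt d → ℝ} {G : Fin d → ℕ → Pt d → ℝ} {g : Fin d → Pt d → ℝ}
    (hF : ∀ n, MemLp (F n) 2 (volume.restrict Ω)) (hf : MemLp f 2 (volume.restrict Ω))
    (hG : ∀ i n, MemLp (G i n) 2 (volume.restrict Ω))
    (hg : ∀ i, MemLp (g i) 2 (volume.restrict Ω))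
    (hFG : ∀ i n, IsWeakPartial Ω i ((hF n).toLp (F n)) ((hG i n).toLp (G i n)))
    (hfg : ∀ i, IsWeakPartial Ω i (hf.toLp f) ((hg i).toLp (g i))) {B : ℝ}
    (hB : ∀ n, ∀ᵐ x ∂(volume.restrict Ω), |f x - F n x| ≤ B)
    (hlim : ∀ᵐ x ∂(volume.restrict Ω), Tendsto (fun n => F n x) atTop (𝓝 (f x)))
    (hB' : ∀ i n, ∀ᵐ x ∂(volume.restrict Ω), |g i x - G i n x| ≤ B)
    (hlim' : ∀ i, ∀ᵐ x ∂(volume.restrict Ω), Tendsto (fun n => G i n x) atTop (𝓝 (g i x))) :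
    Tendsto (fun n => h1Norm (hf.toLp f - (hF n).toLp (F n)) ^ 2) atTop (𝓝 0) := by
  have h1 : ∀ n, h1Norm (hf.toLp f - (hF n).toLp (F n)) ^ 2 =
      ‖hf.toLp f - (hF n).toLp (F n)‖ ^ 2 +
        ∑ i, ‖(hg i).toLp (g i) - (hG i n).toLp (G i n)‖ ^ 2 := by
    intro n
    rw [h1Norm_sq]
    congr 1
    refine Finset.sum_congr rfl fun i _ => ?_
    rw [weakPartial_sub hΩ (fun i => ⟨_, hfg i⟩) (fun i => ⟨_, hFG i n⟩),
      (hfg i).weakPartial_eq hΩ, (hFG i n).weakPartial_eq hΩ]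
  simp only [h1]
  have h2 : (0 : ℝ) = 0 + ∑ i : Fin d, (0 : ℝ) := by simp
  rw [h2]
  exact (tendsto_norm_toLp_sub hF hf hB hlim).add
    (tendsto_finsetSum _ fun i _ => tendsto_norm_toLp_sub (hG i) (hg i) (hB' i) (hlim' i))

/-- The partial derivative of a mollified Lipschitz function is the mollification of its
derivative. -/
theorem partialDeriv_mollify {C : ℝ≥0} {z : Pt d → ℝ} (hz : LipschitzWith C z)
    (φ : ContDiffBump (0 : Pt d)) (i : Fin d) (x : Pt d) :
    partialDeriv i (φ.normed volume ⋆[ContinuousLinearMap.lsmul ℝ ℝ, volume] z) x =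
      (φ.normed volume ⋆[ContinuousLinearMap.lsmul ℝ ℝ, volume]
        fun y => lineDeriv ℝ z y (stdVec i)) x := by
  have hs : ContDiff ℝ 1 (φ.normed (volume : Measure (Pt d))) := φ.contDiff_normed
  have hc : HasCompactSupport (φ.normed (volume : Measure (Pt d))) := φ.hasCompactSupport_normed
  obtain ⟨D, hD⟩ := ContDiff.lipschitzWith_of_hasCompactSupport hc hs (by simp)
  have hd := hc.hasFDerivAt_convolution_left (ContinuousLinearMap.lsmul ℝ ℝ) hs
    (hz.continuous.locallyIntegrable (μ := volume)) x
  have hzx : LipschitzWith C fun t => z (x - t) := by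
    refine LipschitzWith.of_dist_le_mul fun s t => ?_
    have := hz.dist_le_mul (x - s) (x - t)
    rwa [dist_sub_left] at this
  have key := hzx.integral_lineDeriv_mul_eq (μ := volume) hD hc (stdVec i)
  have hl : ∀ t, lineDeriv ℝ (fun t => z (x - t)) t (stdVec i) =
      - lineDeriv ℝ z (x - t) (stdVec i) := by
    intro t
    rw [← lineDeriv_neg]
    unfold lineDeriv
    congr 1
    ext s
    have e : x - (t + s • stdVec i) = x - t + s • -stdVec i := by
      rw [smul_neg]
      abel
    beta_reduce
    rw [e]
  rw [partialDeriv, hd.fderiv, convolution_def, ContinuousLinearMap.integral_apply]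
  · rw [convolution_def]
    have e1 : ∫ t, lineDeriv ℝ (fun t => z (x - t)) t (stdVec i) * φ.normed volume t =
        - ∫ t, (ContinuousLinearMap.lsmul ℝ ℝ) (φ.normed volume t)
          (lineDeriv ℝ z (x - t) (stdVec i)) := by
      rw [← integral_neg]
      refine integral_congr_ae (Eventually.of_forall fun t => ?_)
      simp only [hl, ContinuousLinearMap.lsmul_apply, smul_eq_mul]
      ring
    have e2 : ∫ t, lineDeriv ℝ (φ.normed volume) t (-stdVec i) * z (x - t) =
        - ∫ t, ((ContinuousLinearMap.precompL (Pt d) (ContinuousLinearMap.lsmul ℝ ℝ))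
          (fderiv ℝ (φ.normed volume) t) (z (x - t))) (EuclideanSpace.single i 1) := by
      rw [← integral_neg]
      refine integral_congr_ae (Eventually.of_forall fun t => ?_)
      simp only [ContinuousLinearMap.precompL_apply, ContinuousLinearMap.lsmul_apply, smul_eq_mul,
        ((hs.differentiable (by simp)) t).lineDeriv_eq_fderiv, map_neg]
      ring
    rw [e1, e2] at key
    exact (neg_injective key).symm
  · have hc' := hc.fderiv ℝ
    exact (hc'.convolutionExists_left _ (hs.continuous_fderiv (by simp))
      (hz.continuous.locallyIntegrable (μ := volume)) x)

/-- A Lipschitz function with compact support in `Ω` can be mollified, hence is in `H¹₀(Ω)`. -/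
theorem memH10_of_tsupport_subset [IsFiniteMeasure (volume.restrict Ω)]
    (hΩ : IsOpen Ω) {C : ℝ≥0} {z : Pt d → ℝ} (hz : LipschitzWith C z)
    (hc : HasCompactSupport z) (hs : tsupport z ⊆ Ω) (hm : MemLp z 2 (volume.restrict Ω)) :
    MemH10 Ω (hm.toLp z) := by
  have hg2 : ∀ i : Fin d, MemLp (fun x => lineDeriv ℝ z x (stdVec i)) 2 (volume.restrict Ω) :=
    fun i => memLp_two_lineDeriv hz (stdVec i)
  have hw : ∀ i : Fin d, IsWeakPartial Ω i (hm.toLp z) ((hg2 i).toLp _) :=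
    fun i => isWeakPartial_of_lipschitz hz i hm (hg2 i) (ae_eq_refl _)
  obtain ⟨δ, hδ, hδΩ⟩ := hc.exists_cthickening_subset_open hΩ hs
  let φ : ℕ → ContDiffBump (0 : Pt d) := fun n =>
    { rIn := δ / (2 * (n + 1)), rOut := δ / (n + 1), rIn_pos := by positivity
      rIn_lt_rOut := by
        apply div_lt_div_of_pos_left hδ (by positivity)
        have : (0 : ℝ) < n + 1 := by positivity
        linarith }
  have hr0 : Tendsto (fun n => (φ n).rOut) atTop (𝓝 0) := by
    have := (tendsto_one_div_add_atTop_nhds_zero_nat (𝕜 := ℝ)).const_mul δ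
    simpa [φ, div_eq_mul_inv] using this
  have hr1 : ∀ᶠ n in atTop, (φ n).rOut ≤ 2 * (φ n).rIn := by
    refine Eventually.of_forall fun n => le_of_eq ?_
    simp only [φ]
    field_simp
  let f : ℕ → Pt d → ℝ := fun n =>
    (φ n).normed volume ⋆[ContinuousLinearMap.lsmul ℝ ℝ, volume] z
  have hrle : ∀ n, (φ n).rOut ≤ δ := fun n =>
    div_le_self hδ.le (by have : (0 : ℝ) ≤ n := Nat.cast_nonneg n
                          linarith)
  have hsupp : ∀ n, tsupport (f n) ⊆ Metric.cthickening δ (tsupport z) := by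
    intro n
    refine closure_minimal ?_ Metric.isClosed_cthickening
    refine (support_convolution_subset _).trans ?_
    rintro _ ⟨a, ha, b, hb, rfl⟩
    rw [(φ n).support_normed_eq] at ha
    refine Metric.mem_cthickening_of_dist_le _ b _ _ (subset_tsupport _ hb) ?_
    have : ‖a‖ < (φ n).rOut := by simpa using ha
    simpa [dist_eq_norm] using this.le.trans (hrle n)
  have htest : ∀ n, IsTestFunction Ω (f n) := by
    intro n
    refine ⟨?_, ?_, (hsupp n).trans hδΩ⟩
    · exact (φ n).hasCompactSupport_normed.contDiff_convolution_left _ (φ n).contDiff_normed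
        (hz.continuous.locallyIntegrable)
    · exact IsCompact.of_isClosed_subset hc.isCompact.cthickening (isClosed_tsupport _) (hsupp n)
  have hfc : ∀ n, HasCompactSupport (f n) := fun n => (htest n).2.1
  have hF : ∀ n, MemLp (f n) 2 (volume.restrict Ω) := fun n =>
    ((htest n).1.continuous.memLp_of_hasCompactSupport (hfc n)).restrict Ω
  have hG : ∀ (i : Fin d) (n : ℕ), MemLp (partialDeriv i (f n)) 2 (volume.restrict Ω) :=
    fun i n => (((htest n).continuous_partialDeriv i).memLp_of_hasCompactSupport
      ((htest n).hasCompactSupport_partialDeriv i)).restrict Ω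
  obtain ⟨B, hB⟩ := hc.exists_bound_of_continuous hz.continuous
  have hlip : ∀ n, ∃ D, LipschitzWith D (f n) := fun n =>
    ContDiff.lipschitzWith_of_hasCompactSupport (hfc n) (htest n).1 (by simp)
  have hconv : Tendsto (fun n => h1Norm (hm.toLp z - (hF n).toLp (f n)) ^ 2) atTop (𝓝 0) := by
    refine tendsto_h1Norm_sub_sq hΩ hF hm hG hg2 ?_ hw (B := max (2 * B) (2 * C)) ?_ ?_ ?_ ?_
    · intro i n
      obtain ⟨D, hD⟩ := hlip n
      refine isWeakPartial_of_lipschitz hD i (hF n) (hG i n) ?_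
      exact Eventually.of_forall fun x => ((htest n).lineDeriv_eq i x).symm
    · refine fun n => Eventually.of_forall fun x => ?_
      rw [abs_sub_comm, ← Real.dist_eq]
      refine ContDiffBump.dist_normed_convolution_le hz.continuous.aestronglyMeasurable
        fun y _ => ?_
      rw [dist_eq_norm]
      have := norm_sub_le (z y) (z x)
      have h1 := hB x
      have h2 := hB y
      exact le_max_of_le_left (by linarith)
    · refine Eventually.of_forall fun x => ?_
      exact ContDiffBump.convolution_tendsto_right_of_continuous hr0 hz.continuous x
    · refine fun i n => Eventually.of_forall fun x => ?_
      rw [partialDeriv_mollify hz, abs_sub_comm, ← Real.dist_eq]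
      refine ContDiffBump.dist_normed_convolution_le
        (hz.memLp_lineDeriv (μ := volume) (stdVec i)).aestronglyMeasurable fun y _ => ?_
      rw [dist_eq_norm]
      have hb : ∀ y, ‖lineDeriv ℝ z y (stdVec i)‖ ≤ C := fun y => by
        simpa using norm_lineDeriv_le_of_lipschitz ℝ hz (x₀ := y) (v := stdVec i)
      have := norm_sub_le (lineDeriv ℝ z y (stdVec i)) (lineDeriv ℝ z x (stdVec i))
      have h1 := hb x
      have h2 := hb y
      exact le_max_of_le_right (by linarith)
    · intro i
      refine ae_restrict_of_ae ?_
      filter_upwards [ContDiffBump.ae_convolution_tendsto_right_of_locallyIntegrable hr0 hr1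
        (hz.locallyIntegrable_lineDeriv (μ := volume) (stdVec i))] with x hx
      refine hx.congr fun n => ?_
      rw [← partialDeriv_mollify hz]
  refine ⟨fun i => ⟨_, hw i⟩, fun ε hε => ?_⟩
  obtain ⟨n, hn⟩ := (hconv.eventually_lt_const (u := ε ^ 2) (by positivity)).exists
  exact ⟨f n, (hF n).toLp (f n), htest n, (hF n).coeFn_toLp, lt_of_sq_lt hε hn⟩

/-- A compactly supported Lipschitz function vanishing outside `Ω` belongs to `H¹₀(Ω)`.
It is the limit in `H¹` of its soft thresholds `z - max (-ε) (min z ε)`, whose supports are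
compact subsets of `Ω`. -/
theorem memH10_of_lipschitz [IsFiniteMeasure (volume.restrict Ω)]
    (hΩ : IsOpen Ω) {C : ℝ≥0} {z : Pt d → ℝ} (hz : LipschitzWith C z)
    (hc : HasCompactSupport z) (hs : ∀ x ∉ Ω, z x = 0) (hm : MemLp z 2 (volume.restrict Ω)) :
    MemH10 Ω (hm.toLp z) := by
  classical
  let ε : ℕ → ℝ := fun n => 1 / ((n : ℝ) + 1)
  have hε : ∀ n, 0 < ε n := fun n => by positivity
  have hε0 : Tendsto ε atTop (𝓝 0) := tendsto_one_div_add_atTop_nhds_zero_nat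
  let f : ℕ → Pt d → ℝ := fun n x => z x - max (-ε n) (min (z x) (ε n))
  have hfz : ∀ n x, |z x| ≤ ε n → f n x = 0 := by
    intro n x hx
    have := abs_le.1 hx
    simp only [f, min_eq_left this.2, max_eq_right this.1, sub_self]
  have hf1 : ∀ n x, |z x - f n x| ≤ ε n := by
    intro n x
    have : z x - f n x = max (-ε n) (min (z x) (ε n)) := by simp only [f]; ring
    rw [this, abs_le]
    exact ⟨le_max_left _ _, max_le (by linarith [hε n]) (min_le_right _ _)⟩
  have hlip : ∀ n, LipschitzWith (C + C) (f n) := fun n =>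
    hz.sub ((hz.min_const (ε n)).const_max (-ε n))
  have hsub : ∀ n, tsupport (f n) ⊆ {x | ε n ≤ |z x|} := by
    intro n
    refine closure_minimal ?_ (isClosed_le continuous_const hz.continuous.abs)
    intro x hx
    by_contra h
    exact hx (hfz n x (not_le.1 h).le)
  have hsub' : ∀ n, ∀ x ∈ tsupport (f n), z x ≠ 0 := by
    intro n x hx h0
    have := hsub n hx
    rw [mem_ofPred_eq, h0, abs_zero] at this
    linarith [hε n]
  have hsΩ : ∀ n, tsupport (f n) ⊆ Ω := by
    intro n x hx
    by_contra h
    exact hsub' n x hx (hs x h)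
  have hfc : ∀ n, HasCompactSupport (f n) := fun n =>
    hc.isCompact.of_isClosed_subset (isClosed_tsupport _)
      fun x hx => subset_tsupport _ (hsub' n x hx)
  have hF : ∀ n, MemLp (f n) 2 (volume.restrict Ω) := fun n =>
    ((hlip n).continuous.memLp_of_hasCompactSupport (hfc n)).restrict Ω
  have hG : ∀ (i : Fin d) (n : ℕ),
      MemLp (fun x => lineDeriv ℝ (f n) x (stdVec i)) 2 (volume.restrict Ω) :=
    fun i n => memLp_two_lineDeriv (hlip n) (stdVec i)
  -- the limit of the gradients; it vanishes wherever `z` does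
  let g : Fin d → Pt d → ℝ := fun i => {x | z x ≠ 0}.indicator fun x => lineDeriv ℝ z x (stdVec i)
  have hms : MeasurableSet {x | z x ≠ 0} := (isOpen_ne_fun hz.continuous continuous_const).measurableSet
  have hg : ∀ i, MemLp (g i) 2 (volume.restrict Ω) := fun i =>
    (memLp_two_lineDeriv hz (stdVec i)).indicator hms
  have hbd : ∀ (i : Fin d) (n : ℕ) (x : Pt d), ‖lineDeriv ℝ (f n) x (stdVec i)‖ ≤ C + C :=
    fun i n x => by
      simpa using norm_lineDeriv_le_of_lipschitz ℝ (hlip n) (x₀ := x) (v := stdVec i)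
  have hbz : ∀ (i : Fin d) (x : Pt d), ‖g i x‖ ≤ C := by
    intro i x
    refine (norm_indicator_le_norm_self _ x).trans ?_
    simpa using norm_lineDeriv_le_of_lipschitz ℝ hz (x₀ := x) (v := stdVec i)
  have hlimG : ∀ (i : Fin d) (x : Pt d),
      Tendsto (fun n => lineDeriv ℝ (f n) x (stdVec i)) atTop (𝓝 (g i x)) := by
    intro i x
    by_cases hx : z x = 0
    · have h0 : ∀ n, lineDeriv ℝ (f n) x (stdVec i) = g i x := by
        intro n
        have h1 : f n =ᶠ[𝓝 x] fun _ => 0 := by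
          have h2 : ∀ᶠ y in 𝓝 x, |z y| < ε n :=
            hz.continuous.abs.continuousAt.eventually_lt_const (by simpa [hx] using hε n)
          filter_upwards [h2] with y hy using hfz n y hy.le
        rw [h1.lineDeriv_eq]
        simp [g, hx, lineDeriv]
      simp only [h0]
      exact tendsto_const_nhds
    · have hpos : 0 < |z x| := abs_pos.2 hx
      refine tendsto_const_nhds.congr' ?_
      filter_upwards [hε0.eventually_lt_const hpos] with n hn
      have hgx : g i x = lineDeriv ℝ z x (stdVec i) := by
        simp only [g]
        rw [indicator_of_mem (show x ∈ {x | z x ≠ 0} from hx)]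
      rw [hgx]
      rcases lt_or_gt_of_ne hx with hneg | hpos'
      · have h2 : ∀ᶠ y in 𝓝 x, z y < -ε n :=
          hz.continuous.continuousAt.eventually_lt_const (by rw [abs_of_neg hneg] at hn; linarith)
        have h1 : f n =ᶠ[𝓝 x] fun y => z y + ε n := by
          filter_upwards [h2] with y hy
          simp only [f]
          rw [min_eq_left (by linarith [hε n]), max_eq_left hy.le]
          ring
        rw [h1.lineDeriv_eq]
        unfold lineDeriv
        rw [deriv_add_const]
      · have h2 : ∀ᶠ y in 𝓝 x, ε n < z y :=
          hz.continuous.continuousAt.eventually_const_lt (by rwa [abs_of_pos hpos'] at hn)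
        have h1 : f n =ᶠ[𝓝 x] fun y => z y - ε n := by
          filter_upwards [h2] with y hy
          simp only [f]
          rw [min_eq_right hy.le, max_eq_right (by linarith [hε n])]
        rw [h1.lineDeriv_eq]
        unfold lineDeriv
        rw [deriv_sub_const]
  have hlimF : ∀ x, Tendsto (fun n => f n x) atTop (𝓝 (z x)) := by
    intro x
    rw [tendsto_iff_dist_tendsto_zero]
    refine squeeze_zero (fun _ => dist_nonneg) (fun n => ?_) hε0
    rw [dist_comm, Real.dist_eq]
    exact hf1 n x
  have hweak : ∀ (i : Fin d) (n : ℕ), IsWeakPartial Ω i ((hF n).toLp (f n)) ((hG i n).toLp _) :=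
    fun i n => isWeakPartial_of_lipschitz (hlip n) i (hF n) (hG i n) (ae_eq_refl _)
  have hε1 : ∀ n, ε n ≤ 1 := fun n => by
    have : (0 : ℝ) ≤ n := Nat.cast_nonneg n
    exact (div_le_one (by positivity)).2 (by linarith)
  have hw : ∀ i : Fin d, IsWeakPartial Ω i (hm.toLp z) ((hg i).toLp (g i)) := by
    intro i φ hφ
    have e1 : ∫ x in Ω, hm.toLp z x * partialDeriv i φ x =
        ∫ x in Ω, z x * partialDeriv i φ x := by
      refine integral_congr_ae ?_
      filter_upwards [hm.coeFn_toLp] with x hx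
      rw [hx]
    have e2 : ∫ x in Ω, (hg i).toLp (g i) x * φ x = ∫ x in Ω, g i x * φ x := by
      refine integral_congr_ae ?_
      filter_upwards [(hg i).coeFn_toLp] with x hx
      rw [hx]
    rw [e1, e2]
    have t1 : Tendsto (fun n => ∫ x in Ω, f n x * partialDeriv i φ x) atTop
        (𝓝 (∫ x in Ω, z x * partialDeriv i φ x)) := by
      obtain ⟨B, hB⟩ := hc.exists_bound_of_continuous hz.continuous
      refine tendsto_integral_of_dominated_convergence (fun x => (B + 1) * ‖partialDeriv i φ x‖)
        (fun n => (hF n).aestronglyMeasurable.mul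
          (hφ.continuous_partialDeriv i).aestronglyMeasurable) ?_ ?_ ?_
      · exact (((hφ.continuous_partialDeriv i).integrable_of_hasCompactSupport
          (hφ.hasCompactSupport_partialDeriv i)).norm.const_mul _).restrict
      · refine fun n => Eventually.of_forall fun x => ?_
        rw [norm_mul]
        gcongr
        have h1 := hf1 n x
        have h2 := hB x
        have h3 := hε1 n
        rw [Real.norm_eq_abs] at h2 ⊢
        have h4 : f n x = z x - (z x - f n x) := by ring
        rw [h4]
        exact (abs_sub _ _).trans (by linarith)
      · exact Eventually.of_forall fun x => (hlimF x).mul tendsto_const_nhds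
    have t2 : Tendsto (fun n => - ∫ x in Ω, lineDeriv ℝ (f n) x (stdVec i) * φ x) atTop
        (𝓝 (- ∫ x in Ω, g i x * φ x)) := by
      refine (tendsto_integral_of_dominated_convergence (fun x => (C + C) * ‖φ x‖)
        (fun n => (hG i n).aestronglyMeasurable.mul
          hφ.1.continuous.aestronglyMeasurable) ?_ ?_ ?_).neg
      · exact ((hφ.1.continuous.integrable_of_hasCompactSupport hφ.2.1).norm.const_mul _).restrict
      · refine fun n => Eventually.of_forall fun x => ?_
        rw [Pi.mul_apply, norm_mul]
        gcongr
        exact hbd i n x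
      · exact Eventually.of_forall fun x => (hlimG i x).mul tendsto_const_nhds
    refine tendsto_nhds_unique t1 (t2.congr fun n => ?_)
    rw [setIntegral_mul_partialDeriv_of_lipschitz (hlip n) hφ]
  have hconv : Tendsto (fun n => h1Norm (hm.toLp z - (hF n).toLp (f n)) ^ 2) atTop (𝓝 0) := by
    refine tendsto_h1Norm_sub_sq hΩ hF hm hG hg hweak hw (B := max 1 (3 * C)) ?_
      (Eventually.of_forall hlimF) ?_ (fun i => Eventually.of_forall (hlimG i))
    · exact fun n => Eventually.of_forall fun x =>
        le_max_of_le_left ((hf1 n x).trans (hε1 n))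
    · refine fun i n => Eventually.of_forall fun x => le_max_of_le_right ?_
      have h1 := norm_sub_le (g i x) (lineDeriv ℝ (f n) x (stdVec i))
      have h2 := hbd i n x
      have h3 := hbz i x
      rw [← Real.norm_eq_abs]
      linarith
  refine MemH10.of_forall_exists hΩ (fun i => ⟨_, hw i⟩) fun η hη => ?_
  obtain ⟨n, hn⟩ := (hconv.eventually_lt_const hη).exists
  exact ⟨_, memH10_of_tsupport_subset hΩ (hlip n) (hfc n) (hsΩ n) (hF n), hn⟩

/-- The derivatives of a compactly supported Lipschitz function have mean zero. -/
theorem integral_lineDeriv_eq_zero {C : ℝ≥0} {z : Pt d → ℝ} (hz : LipschitzWith C z)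
    (hc : HasCompactSupport z) (v : Pt d) : ∫ x, lineDeriv ℝ z x v = 0 := by
  have h := (LipschitzWith.const (1 : ℝ)).integral_lineDeriv_mul_eq (μ := (volume : Measure (Pt d)))
    hz hc (-v)
  simpa [lineDeriv] using h.symm

end Lipschitz

/-! ### Piecewise smooth functions in `H¹` -/

section PiecewiseSmooth

open Filter Topology

variable {d : ℕ} {Ω : Set (Pt d)}

theorem continuous_partialDeriv {f : Pt d → ℝ} (hf : ContDiff ℝ ∞ f) (i : Fin d) :
    Continuous (partialDeriv i f) :=
  (hf.continuous_fderiv (by simp)).clm_apply continuous_const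

theorem partialDeriv_mul {f g : Pt d → ℝ} (hf : ContDiff ℝ ∞ f) (hg : ContDiff ℝ ∞ g) (i : Fin d)
    (x : Pt d) : partialDeriv i (fun y => f y * g y) x =
      f x * partialDeriv i g x + partialDeriv i f x * g x := by
  unfold partialDeriv
  rw [fderiv_fun_mul ((hf.differentiable (by simp)) x) ((hg.differentiable (by simp)) x)]
  simp [mul_comm]

theorem integral_mul_partialDeriv {f : Pt d → ℝ} (hf : ContDiff ℝ ∞ f) {φ : Pt d → ℝ}
    (hφ : IsTestFunction Ω φ) (i : Fin d) :
    ∫ x, f x * partialDeriv i φ x = - ∫ x, partialDeriv i f x * φ x := by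
  refine integral_mul_fderiv_eq_neg_fderiv_mul_of_integrable ?_ ?_ ?_
    (fun x _ => hf.differentiable (by simp) x) (fun x _ => hφ.1.differentiable (by simp) x)
  · exact ((continuous_partialDeriv hf i).mul hφ.1.continuous).integrable_of_hasCompactSupport
      hφ.2.1.mul_left
  · exact (hf.continuous.mul (hφ.continuous_partialDeriv i)).integrable_of_hasCompactSupport
      (hφ.hasCompactSupport_partialDeriv i).mul_left
  · exact (hf.continuous.mul hφ.1.continuous).integrable_of_hasCompactSupport
      hφ.2.1.mul_left

theorem IsTestFunction.mono {U : Set (Pt d)} (hU : U ⊆ Ω) {φ : Pt d → ℝ}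
    (hφ : IsTestFunction U φ) : IsTestFunction Ω φ :=
  ⟨hφ.1, hφ.2.1, hφ.2.2.trans hU⟩

/-- Weak derivatives are local: where a function is smooth, they are classical derivatives. -/
theorem IsWeakPartial.ae_eq_partialDeriv {U : Set (Pt d)} (hU : IsOpen U) (hUΩ : U ⊆ Ω) {i : Fin d}
    {v g : L2 Ω} (h : IsWeakPartial Ω i v g) {f : Pt d → ℝ} (hf : ContDiff ℝ ∞ f)
    (hv : ∀ᵐ x ∂(volume.restrict Ω), x ∈ U → v x = f x) :
    ∀ᵐ x ∂(volume.restrict Ω), x ∈ U → g x = partialDeriv i f x := by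
  have hg : LocallyIntegrable (fun x => g x) (volume.restrict Ω) :=
    (Lp.memLp g).locallyIntegrable (by norm_num)
  have hf' : LocallyIntegrable (partialDeriv i f) (volume.restrict Ω) :=
    (continuous_partialDeriv hf i).locallyIntegrable
  have key : ∀ᵐ x ∂(volume.restrict Ω), x ∈ U → g x - partialDeriv i f x = 0 := by
    refine hU.ae_eq_zero_of_integral_contDiff_smul_eq_zero
      ((hg.sub hf').locallyIntegrableOn U) ?_
    intro ψ hψ hc hs
    have hψU : IsTestFunction U ψ := ⟨hψ, hc, hs⟩
    have hψΩ : IsTestFunction Ω ψ := hψU.mono hUΩ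
    have i1 : Integrable (fun x => ψ x • g x) (volume.restrict Ω) :=
      hg.integrable_smul_left_of_hasCompactSupport hψ.continuous hc
    have i2 : Integrable (fun x => ψ x • partialDeriv i f x) (volume.restrict Ω) :=
      hf'.integrable_smul_left_of_hasCompactSupport hψ.continuous hc
    simp only [smul_sub]
    rw [integral_sub i1 i2]
    have e1 : ∫ x in Ω, v x * partialDeriv i ψ x = ∫ x in Ω, f x * partialDeriv i ψ x := by
      refine integral_congr_ae ?_
      filter_upwards [hv] with x hx
      by_cases hxU : x ∈ U
      · rw [hx hxU]
      · rw [hψU.partialDeriv_eq_zero hxU, mul_zero, mul_zero]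
    have e2 : ∫ x in Ω, f x * partialDeriv i ψ x = ∫ x, f x * partialDeriv i ψ x :=
      setIntegral_eq_integral_of_forall_compl_eq_zero fun x hx => by
        rw [hψΩ.partialDeriv_eq_zero hx, mul_zero]
    have e3 : ∫ x in Ω, partialDeriv i f x * ψ x = ∫ x, partialDeriv i f x * ψ x :=
      setIntegral_eq_integral_of_forall_compl_eq_zero fun x hx => by
        rw [hψΩ.eq_zero hx, mul_zero]
    have e4 := h ψ hψΩ
    rw [e1, e2, integral_mul_partialDeriv hf hψΩ, neg_inj, ← e3] at e4
    simp only [smul_eq_mul, mul_comm (ψ _)]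
    rw [e4, sub_self]
  filter_upwards [key] with x hx hxU using sub_eq_zero.1 (hx hxU)

theorem contDiff_halfSpaceBump (x₀ : Pt d) (ρ : ℝ) :
    ContDiff ℝ ∞ fun x : Pt d => Real.smoothTransition (1 - ‖x - x₀‖ ^ 2 / ρ ^ 2) :=
  Real.smoothTransition.contDiff.comp
    (contDiff_const.sub (((contDiff_id.sub contDiff_const).norm_sq ℝ).div_const _))

theorem isTestFunction_halfSpaceBump (x₀ : Pt d) {ρ : ℝ} (hρ : 0 < ρ)
    (hball : Metric.closedBall x₀ ρ ⊆ Ω) :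
    IsTestFunction Ω fun x : Pt d => Real.smoothTransition (1 - ‖x - x₀‖ ^ 2 / ρ ^ 2) := by
  have hs : tsupport (fun x : Pt d => Real.smoothTransition (1 - ‖x - x₀‖ ^ 2 / ρ ^ 2)) ⊆
      Metric.closedBall x₀ ρ := by
    refine closure_minimal (fun x hx => ?_) Metric.isClosed_closedBall
    by_contra h
    refine hx (Real.smoothTransition.zero_of_nonpos ?_)
    rw [Metric.mem_closedBall, dist_eq_norm, not_le] at h
    have : 1 ≤ ‖x - x₀‖ ^ 2 / ρ ^ 2 := by
      rw [le_div_iff₀ (by positivity), one_mul]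
      exact pow_le_pow_left₀ hρ.le h.le 2
    linarith
  exact ⟨contDiff_halfSpaceBump x₀ ρ,
    (isCompact_closedBall x₀ ρ).of_isClosed_subset (isClosed_tsupport _) hs, hs.trans hball⟩

/-- The indicator of a half space is not weakly constant across its boundary: a radial bump centred
on the boundary has a nonzero integral of its normal derivative over the half space. -/
theorem setIntegral_fderiv_halfSpaceBump_ne_zero (x₀ : Pt d) {n : Pt d} (hn : n ≠ 0) {ρ : ℝ}
    (hρ : 0 < ρ) :
    ∫ x in {x | 0 < inner ℝ n (x - x₀)}, fderiv ℝ
      (fun x : Pt d => Real.smoothTransition (1 - ‖x - x₀‖ ^ 2 / ρ ^ 2)) x n ≠ 0 := by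
  set s := Real.smoothTransition with hs
  have hsd : Differentiable ℝ s :=
    (Real.smoothTransition.contDiff (n := 1)).differentiable (by simp)
  have hsc : Continuous (deriv s) :=
    (Real.smoothTransition.contDiff (n := 1)).continuous_deriv (by simp)
  have hs0 : ∀ t, 0 ≤ deriv s t := fun t => Real.smoothTransition.monotone.deriv_nonneg
  let q : Pt d → ℝ := fun x => 1 - ‖x - x₀‖ ^ 2 / ρ ^ 2
  have hqc : Continuous q := by fun_prop
  have hq : ∀ x, HasFDerivAt q (-((2 / ρ ^ 2) • (innerSL ℝ (x - x₀)))) x := by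
    intro x
    have h1 := ((hasFDerivAt_id (𝕜 := ℝ) x).sub_const x₀).norm_sq
    have h2 := (h1.mul_const ((ρ ^ 2)⁻¹)).const_sub 1
    convert! h2 using 1
    ext v
    simp
    ring
  have hfd : ∀ x, fderiv ℝ (fun x : Pt d => s (1 - ‖x - x₀‖ ^ 2 / ρ ^ 2)) x n =
      - (deriv s (q x) * (2 / ρ ^ 2 * inner ℝ n (x - x₀))) := by
    intro x
    have h1 := (hsd (q x)).hasDerivAt.comp_hasFDerivAt x (hq x)
    have h2 : fderiv ℝ (fun x : Pt d => s (1 - ‖x - x₀‖ ^ 2 / ρ ^ 2)) x = _ := h1.fderiv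
    rw [h2, real_inner_comm (x - x₀) n]
    simp only [smul_apply, neg_apply, innerSL_apply_apply,
      smul_eq_mul]
    ring
  let F : Pt d → ℝ := fun x => deriv s (q x) * (2 / ρ ^ 2 * max (inner ℝ n (x - x₀)) 0)
  have hFc : Continuous F := by
    have : Continuous fun x : Pt d => (inner ℝ n (x - x₀) : ℝ) := by fun_prop
    exact (hsc.comp hqc).mul (continuous_const.mul (this.max continuous_const))
  have hF0 : 0 ≤ F := fun x =>
    mul_nonneg (hs0 _) (mul_nonneg (by positivity) (le_max_right _ _))
  have hms : MeasurableSet {x : Pt d | 0 < inner ℝ n (x - x₀)} := by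
    have : Continuous fun x : Pt d => (inner ℝ n (x - x₀) : ℝ) := by fun_prop
    exact (isOpen_lt continuous_const this).measurableSet
  have hint : ∫ x in {x | 0 < inner ℝ n (x - x₀)},
      fderiv ℝ (fun x : Pt d => s (1 - ‖x - x₀‖ ^ 2 / ρ ^ 2)) x n = - ∫ x, F x := by
    rw [← integral_indicator hms, ← integral_neg]
    refine integral_congr_ae (Eventually.of_forall fun x => ?_)
    by_cases hx : 0 < inner ℝ n (x - x₀)
    · beta_reduce
      rw [indicator_of_mem (show x ∈ {x | 0 < inner ℝ n (x - x₀)} from hx), hfd]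
      simp only [F, max_eq_left hx.le]
    · beta_reduce
      rw [indicator_of_notMem (show x ∉ {x | 0 < inner ℝ n (x - x₀)} from hx)]
      simp only [F, max_eq_right (not_lt.1 hx), mul_zero, neg_zero]
  have hFsupp : HasCompactSupport F := by
    refine HasCompactSupport.intro (isCompact_closedBall x₀ ρ) fun x hx => ?_
    rw [Metric.mem_closedBall, dist_eq_norm, not_le] at hx
    have h1 : q x < 0 := by
      have : 1 < ‖x - x₀‖ ^ 2 / ρ ^ 2 := by
        rw [lt_div_iff₀ (by positivity), one_mul]
        exact pow_lt_pow_left₀ hx hρ.le two_ne_zero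
      simp only [q]
      linarith
    have h2 : s =ᶠ[𝓝 (q x)] fun _ => 0 := by
      filter_upwards [gt_mem_nhds h1] with t ht
      exact Real.smoothTransition.zero_of_nonpos (le_of_lt ht)
    simp only [F]
    rw [h2.deriv_eq]
    simp
  obtain ⟨c, hc, hc1⟩ := exists_deriv_eq_slope s zero_lt_one hsd.continuous.continuousOn
    hsd.differentiableOn
  rw [hs, Real.smoothTransition.one, Real.smoothTransition.zero, ← hs] at hc1
  have hn' : 0 < ‖n‖ := norm_pos_iff.2 hn
  let t : ℝ := ρ * √(1 - c) / ‖n‖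
  have hct : 0 < 1 - c := by linarith [hc.2]
  have ht : 0 < t := by positivity
  have hqx : q (x₀ + t • n) = c := by
    simp only [q, add_sub_cancel_left, norm_smul, Real.norm_eq_abs, abs_of_pos ht, t]
    rw [div_mul_cancel₀ _ hn'.ne', mul_pow, Real.sq_sqrt hct.le]
    field_simp
    ring
  have hFx : F (x₀ + t • n) ≠ 0 := by
    simp only [F]
    rw [hqx, hc1]
    have : 0 < inner ℝ n (x₀ + t • n - x₀) := by
      rw [add_sub_cancel_left, inner_smul_right, real_inner_self_eq_norm_sq]
      positivity
    rw [max_eq_left this.le]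
    have h2 : (0 : ℝ) < 2 / ρ ^ 2 := by positivity
    exact mul_ne_zero (by norm_num) (mul_ne_zero h2.ne' this.ne')
  rw [hint]
  exact neg_ne_zero.2
    (hFc.integral_pos_of_hasCompactSupport_nonneg_nonzero hFsupp hF0 hFx).ne'

theorem ae_inner_ne_zero (x₀ : Pt d) {n : Pt d} (hn : n ≠ 0) :
    ∀ᵐ x ∂(volume : Measure (Pt d)), inner ℝ n (x - x₀) ≠ 0 := by
  let A : AffineSubspace ℝ (Pt d) := AffineSubspace.mk' x₀ (LinearMap.ker (innerSL ℝ n).toLinearMap)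
  have hA : ∀ x, x ∈ A ↔ inner ℝ n (x - x₀) = 0 := fun x => by
    rw [AffineSubspace.mem_mk']
    simp
  have htop : A ≠ ⊤ := by
    intro h
    have : x₀ + n ∈ A := h ▸ AffineSubspace.mem_top ℝ _ _
    rw [hA, add_sub_cancel_left, inner_self_eq_zero] at this
    exact hn this
  have h0 := Measure.addHaar_affineSubspace volume A htop
  rw [ae_iff]
  convert h0 using 2
  ext x
  simp [hA]

theorem sum_mul_partialDeriv (f : Pt d → ℝ) (x n : Pt d) :
    ∑ i, n i * partialDeriv i f x = fderiv ℝ f x n := by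
  have : n = ∑ i, n i • stdVec i := by
    ext j
    simp [Finset.sum_apply, Pi.single_apply]
  conv_rhs => rw [this]
  simp [partialDeriv, map_sum]

/-- A function in `H¹` which is smooth on both sides of a hyperplane does not jump across it. -/
theorem eq_of_memH1_of_two_sided {v : L2 Ω} (hv : MemH1 Ω v) {f f' : Pt d → ℝ}
    (hf : ContDiff ℝ ∞ f) (hf' : ContDiff ℝ ∞ f') {x₀ n : Pt d} (hn : n ≠ 0) {ρ : ℝ} (hρ : 0 < ρ)
    (hball : Metric.ball x₀ ρ ⊆ Ω)
    (h1 : ∀ᵐ y ∂(volume.restrict Ω), y ∈ Metric.ball x₀ ρ → 0 < inner ℝ n (y - x₀) → v y = f y)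
    (h2 : ∀ᵐ y ∂(volume.restrict Ω), y ∈ Metric.ball x₀ ρ → inner ℝ n (y - x₀) < 0 → v y = f' y) :
    f x₀ = f' x₀ := by
  by_contra hne
  let r : Pt d → ℝ := fun x => f x - f' x
  have hr : ContDiff ℝ ∞ r := hf.sub hf'
  have hr0 : r x₀ ≠ 0 := sub_ne_zero.2 hne
  obtain ⟨δ, hδ, hδr⟩ := Metric.eventually_nhds_iff_ball.1
    (hr.continuous.continuousAt.eventually_ne hr0)
  let σ : ℝ := min ρ δ / 2
  have hσ : 0 < σ := by positivity
  have hσρ : Metric.closedBall x₀ σ ⊆ Metric.ball x₀ ρ :=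
    Metric.closedBall_subset_ball (by
      have := min_le_left ρ δ
      simp only [σ]
      linarith)
  have hσδ : Metric.closedBall x₀ σ ⊆ Metric.ball x₀ δ :=
    Metric.closedBall_subset_ball (by
      have := min_le_right ρ δ
      simp only [σ]
      linarith)
  let ψ : Pt d → ℝ := fun x : Pt d => Real.smoothTransition (1 - ‖x - x₀‖ ^ 2 / σ ^ 2)
  have hψB : IsTestFunction (Metric.ball x₀ ρ ∩ Metric.ball x₀ δ) ψ :=
    isTestFunction_halfSpaceBump x₀ hσ (subset_inter hσρ hσδ)
  let φ : Pt d → ℝ := fun x => ψ x / r x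
  have hφsupp : tsupport φ ⊆ tsupport ψ :=
    closure_mono fun x hx h0 => hx (by simp only [φ, h0, zero_div])
  have hφ : IsTestFunction (Metric.ball x₀ ρ) φ := by
    refine ⟨contDiff_iff_contDiffAt.2 fun x => ?_, ?_, hφsupp.trans (hψB.2.2.trans inter_subset_left)⟩
    · by_cases hx : x ∈ tsupport ψ
      · exact hψB.1.contDiffAt.div hr.contDiffAt (hδr x (hψB.2.2 hx).2)
      · have : φ =ᶠ[𝓝 x] fun _ => 0 := by
          filter_upwards [(isClosed_tsupport ψ).isOpen_compl.mem_nhds hx] with y hy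
          simp only [φ, image_eq_zero_of_notMem_tsupport hy, zero_div]
        exact contDiffAt_const.congr_of_eventuallyEq this
    · exact hψB.2.1.isCompact.of_isClosed_subset (isClosed_tsupport _) hφsupp
  have hφΩ : IsTestFunction Ω φ := hφ.mono hball
  have hrφ : (fun x => r x * φ x) = ψ := by
    ext x
    by_cases hx : r x = 0
    · have : x ∉ tsupport ψ := fun h => hδr x (hψB.2.2 h).2 hx
      simp only [hx, zero_mul, image_eq_zero_of_notMem_tsupport this]
    · simp only [φ]
      field_simp
  let H : Set (Pt d) := {x | 0 < inner ℝ n (x - x₀)}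
  have hcont : Continuous fun x : Pt d => (inner ℝ n (x - x₀) : ℝ) := by fun_prop
  have hHo : IsOpen H := isOpen_lt continuous_const hcont
  have hHo' : IsOpen {x : Pt d | inner ℝ n (x - x₀) < 0} := isOpen_lt hcont continuous_const
  have hae : ∀ᵐ y ∂(volume.restrict Ω), inner ℝ n (y - x₀) ≠ 0 :=
    ae_restrict_of_ae (ae_inner_ne_zero x₀ hn)
  -- the product rule and integration by parts turn the weak derivative identity into this one
  have key : ∀ i, ∫ x in H, partialDeriv i ψ x = 0 := by
    intro i
    have hw := isWeakPartial_weakPartial hv i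
    have g1 := hw.ae_eq_partialDeriv (Metric.isOpen_ball.inter hHo)
      (inter_subset_left.trans hball) hf (by
        filter_upwards [h1] with x hx hxU using hx hxU.1 hxU.2)
    have g2 := hw.ae_eq_partialDeriv (Metric.isOpen_ball.inter hHo')
      (inter_subset_left.trans hball) hf' (by
        filter_upwards [h2] with x hx hxU using hx hxU.1 hxU.2)
    have e0 := hw φ hφΩ
    have e1 : ∫ x in Ω, v x * partialDeriv i φ x =
        ∫ x in Ω, (f' x * partialDeriv i φ x + H.indicator (fun x => r x * partialDeriv i φ x) x) := by
      refine integral_congr_ae ?_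
      filter_upwards [h1, h2, hae] with x hx1 hx2 hx0
      by_cases hxB : x ∈ Metric.ball x₀ ρ
      · rcases lt_or_gt_of_ne hx0 with hlt | hgt
        · rw [indicator_of_notMem (show x ∉ H from not_lt.2 hlt.le), hx2 hxB hlt, add_zero]
        · rw [indicator_of_mem (show x ∈ H from hgt), hx1 hxB hgt]
          simp only [r]
          ring
      · by_cases hxH : x ∈ H <;> simp [hxH, hφ.partialDeriv_eq_zero hxB i]
    have e2 : ∫ x in Ω, weakPartial i v x * φ x =
        ∫ x in Ω, (partialDeriv i f' x * φ x + H.indicator (fun x => partialDeriv i r x * φ x) x) := by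
      refine integral_congr_ae ?_
      filter_upwards [g1, g2, hae] with x hx1 hx2 hx0
      by_cases hxB : x ∈ Metric.ball x₀ ρ
      · rcases lt_or_gt_of_ne hx0 with hlt | hgt
        · rw [indicator_of_notMem (show x ∉ H from not_lt.2 hlt.le), hx2 ⟨hxB, hlt⟩, add_zero]
        · rw [indicator_of_mem (show x ∈ H from hgt), hx1 ⟨hxB, hgt⟩]
          have : partialDeriv i r x = partialDeriv i f x - partialDeriv i f' x := by
            unfold partialDeriv
            rw [fderiv_fun_sub (hf.differentiable (by simp) x) (hf'.differentiable (by simp) x)]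
            rfl
          rw [this]
          ring
      · by_cases hxH : x ∈ H <;> simp [hxH, hφ.eq_zero hxB]
    have ii : ∀ {a b : Pt d → ℝ}, Continuous a → Continuous b → HasCompactSupport b →
        Integrable (fun x => a x * b x) (volume.restrict Ω) := fun ha hb hc =>
      ((ha.mul hb).integrable_of_hasCompactSupport hc.mul_left).restrict
    have c1 := hφΩ.continuous_partialDeriv i
    have c2 := hφΩ.hasCompactSupport_partialDeriv i
    rw [e1, e2, integral_add (ii hf'.continuous c1 c2)
        ((ii hr.continuous c1 c2).indicator hHo.measurableSet),
      integral_add (ii (continuous_partialDeriv hf' i) hφΩ.1.continuous hφΩ.2.1)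
        ((ii (continuous_partialDeriv hr i) hφΩ.1.continuous hφΩ.2.1).indicator hHo.measurableSet)]
      at e0
    have e3 : ∫ x in Ω, f' x * partialDeriv i φ x = - ∫ x in Ω, partialDeriv i f' x * φ x := by
      rw [setIntegral_eq_integral_of_forall_compl_eq_zero fun x hx => by
          rw [hφΩ.partialDeriv_eq_zero hx, mul_zero],
        setIntegral_eq_integral_of_forall_compl_eq_zero fun x hx => by
          rw [hφΩ.eq_zero hx, mul_zero], integral_mul_partialDeriv hf' hφΩ]
    have e4 : (∫ x in Ω, H.indicator (fun x => r x * partialDeriv i φ x) x) +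
        (∫ x in Ω, H.indicator (fun x => partialDeriv i r x * φ x) x) = 0 := by linarith
    rw [← integral_add ((ii hr.continuous c1 c2).indicator hHo.measurableSet)
      ((ii (continuous_partialDeriv hr i) hφΩ.1.continuous hφΩ.2.1).indicator hHo.measurableSet)]
      at e4
    rw [← e4, ← integral_indicator hHo.measurableSet]
    rw [setIntegral_eq_integral_of_forall_compl_eq_zero]
    · refine integral_congr_ae (Eventually.of_forall fun x => ?_)
      have hp := partialDeriv_mul hr hφ.1 i x
      rw [hrφ] at hp
      by_cases hxH : x ∈ H <;> simp [hxH, hp]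
    · intro x hx
      by_cases hxH : x ∈ H <;>
        simp [hxH, hφΩ.eq_zero hx, hφΩ.partialDeriv_eq_zero hx i]
  refine setIntegral_fderiv_halfSpaceBump_ne_zero x₀ hn hσ ?_
  have : ∫ x in H, fderiv ℝ ψ x n = ∑ i, n i * ∫ x in H, partialDeriv i ψ x := by
    simp only [← sum_mul_partialDeriv, ← integral_const_mul]
    rw [integral_finsetSum]
    intro i _
    exact (((hψB.continuous_partialDeriv i).integrable_of_hasCompactSupport
      (hψB.hasCompactSupport_partialDeriv i)).const_mul _).restrict
  calc _ = ∫ x in H, fderiv ℝ ψ x n := rfl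
    _ = 0 := by rw [this]; simp [key]

end PiecewiseSmooth

/-! ### Polynomials with bounded coefficients -/

section Polynomials

open MvPolynomial

variable {d : ℕ}

/-- The sum of the absolute values of the coefficients of a polynomial. -/
noncomputable def coefNorm (p : MvPolynomial (Fin d) ℝ) : ℝ := ∑ s ∈ p.support, |coeff s p|

/-- The polynomial has total degree at most `m` and its coefficients have absolute sum at most
`A`. -/
structure PolyBound (m : ℕ) (A : ℝ) (p : MvPolynomial (Fin d) ℝ) : Prop where
  deg : p.totalDegree ≤ m
  norm : coefNorm p ≤ A

/-- The value of a polynomial at a point of `ℝ^d`. -/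
noncomputable def pev (p : MvPolynomial (Fin d) ℝ) (y : Pt d) : ℝ := eval (fun i => y i) p

theorem coefNorm_nonneg (p : MvPolynomial (Fin d) ℝ) : 0 ≤ coefNorm p :=
  Finset.sum_nonneg fun _ _ => abs_nonneg _

theorem coefNorm_eq_sum {p : MvPolynomial (Fin d) ℝ} {F : Finset (Fin d →₀ ℕ)}
    (h : p.support ⊆ F) : coefNorm p = ∑ s ∈ F, |coeff s p| :=
  Finset.sum_subset h fun s _ hs => by rw [notMem_support_iff.1 hs, abs_zero]

theorem coefNorm_add_le (p q : MvPolynomial (Fin d) ℝ) :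
    coefNorm (p + q) ≤ coefNorm p + coefNorm q := by
  classical
  rw [coefNorm_eq_sum (support_add (p := p) (q := q)),
    coefNorm_eq_sum (Finset.subset_union_left (s₁ := p.support) (s₂ := q.support)),
    coefNorm_eq_sum (Finset.subset_union_right (s₁ := p.support) (s₂ := q.support)),
    ← Finset.sum_add_distrib]
  exact Finset.sum_le_sum fun s _ => by rw [coeff_add]; exact abs_add_le _ _

theorem coefNorm_zero : coefNorm (0 : MvPolynomial (Fin d) ℝ) = 0 := by simp [coefNorm]

theorem coefNorm_sum_le {κ : Type*} (F : Finset κ) (f : κ → MvPolynomial (Fin d) ℝ) :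
    coefNorm (∑ a ∈ F, f a) ≤ ∑ a ∈ F, coefNorm (f a) :=
  Finset.le_sum_of_subadditive _ coefNorm_zero.le coefNorm_add_le _ _

theorem coefNorm_monomial (s : Fin d →₀ ℕ) (a : ℝ) : coefNorm (monomial s a) = |a| := by
  classical
  rw [coefNorm_eq_sum (F := {s}) (support_monomial_subset)]
  simp

theorem coefNorm_mul_le (p q : MvPolynomial (Fin d) ℝ) :
    coefNorm (p * q) ≤ coefNorm p * coefNorm q := by
  have h1 : p * q = ∑ s ∈ p.support, ∑ t ∈ q.support,
      monomial (s + t) (coeff s p * coeff t q) := by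
    conv_lhs => rw [as_sum p, as_sum q]
    rw [Finset.sum_mul_sum]
    simp only [monomial_mul]
  rw [h1]
  refine (coefNorm_sum_le _ _).trans ?_
  simp only [coefNorm, Finset.sum_mul_sum]
  refine Finset.sum_le_sum fun s _ => (coefNorm_sum_le _ _).trans (le_of_eq ?_)
  simp only [coefNorm_monomial, abs_mul]

theorem coefNorm_C (a : ℝ) : coefNorm (C a : MvPolynomial (Fin d) ℝ) = |a| := coefNorm_monomial _ _

theorem coefNorm_X (i : Fin d) : coefNorm (X i : MvPolynomial (Fin d) ℝ) = 1 := by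
  rw [X, coefNorm_monomial, abs_one]

theorem abs_pev_le {p : MvPolynomial (Fin d) ℝ} {y : Pt d} (hy : ‖y‖ ≤ 1) :
    |pev p y| ≤ coefNorm p := by
  rw [pev, eval_eq, coefNorm]
  refine (Finset.abs_sum_le_sum_abs _ _).trans (Finset.sum_le_sum fun s _ => ?_)
  rw [abs_mul]
  refine mul_le_of_le_one_right (abs_nonneg _) ?_
  rw [Finset.abs_prod]
  refine Finset.prod_le_one (fun _ _ => abs_nonneg _) fun i _ => ?_
  rw [abs_pow]
  exact pow_le_one₀ (abs_nonneg _) ((Real.norm_eq_abs _ ▸ PiLp.norm_apply_le y i).trans hy)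

namespace PolyBound

variable {m n : ℕ} {A B : ℝ} {p q : MvPolynomial (Fin d) ℝ}

theorem nonneg (h : PolyBound m A p) : 0 ≤ A := (coefNorm_nonneg p).trans h.norm

theorem mono (h : PolyBound m A p) (hm : m ≤ n) (hA : A ≤ B) : PolyBound n B p :=
  ⟨h.deg.trans hm, h.norm.trans hA⟩

theorem add (hp : PolyBound m A p) (hq : PolyBound m B q) : PolyBound m (A + B) (p + q) :=
  ⟨(totalDegree_add _ _).trans (max_le hp.deg hq.deg),
    (coefNorm_add_le _ _).trans (add_le_add hp.norm hq.norm)⟩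

theorem mul (hp : PolyBound m A p) (hq : PolyBound n B q) : PolyBound (m + n) (A * B) (p * q) :=
  ⟨(totalDegree_mul _ _).trans (add_le_add hp.deg hq.deg),
    (coefNorm_mul_le _ _).trans (mul_le_mul hp.norm hq.norm (coefNorm_nonneg _) hp.nonneg)⟩

theorem const {a : ℝ} (h : |a| ≤ A) : PolyBound 0 A (C a : MvPolynomial (Fin d) ℝ) :=
  ⟨(totalDegree_C a).le, (coefNorm_C a).trans_le h⟩

theorem X (i : Fin d) : PolyBound 1 1 (MvPolynomial.X i : MvPolynomial (Fin d) ℝ) :=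
  ⟨(totalDegree_X i).le, (coefNorm_X i).le⟩

theorem const_mul (hp : PolyBound m A p) {a : ℝ} (h : |a| ≤ B) : PolyBound m (B * A) (C a * p) := by
  simpa using (const (d := d) h).mul hp

theorem sub (hp : PolyBound m A p) (hq : PolyBound m B q) : PolyBound m (A + B) (p - q) := by
  have h := hp.add (hq.const_mul (a := -1) (B := 1) (by simp))
  have e : p + C (-1) * q = p - q := by
    rw [C_neg, C_1]
    ring
  rwa [e, one_mul] at h

theorem sum {κ : Type*} {F : Finset κ} {f : κ → MvPolynomial (Fin d) ℝ}
    (h : ∀ a ∈ F, PolyBound m A (f a)) : PolyBound m (F.card * A) (∑ a ∈ F, f a) :=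
  ⟨totalDegree_finsetSum_le fun a ha => (h a ha).deg,
    (coefNorm_sum_le _ _).trans (by
      simpa using Finset.sum_le_sum fun a ha => (h a ha).norm)⟩

theorem pow (hp : PolyBound m A p) (k : ℕ) : PolyBound (k * m) (A ^ k) (p ^ k) := by
  induction k with
  | zero =>
    rw [pow_zero, pow_zero, zero_mul, ← C_1]
    exact const (by simp)
  | succ k ih =>
    rw [pow_succ, pow_succ, Nat.succ_mul]
    exact ih.mul hp

theorem prod {κ : Type*} {F : Finset κ} {f : κ → MvPolynomial (Fin d) ℝ} {m : κ → ℕ} {A : κ → ℝ}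
    (h : ∀ a ∈ F, PolyBound (m a) (A a) (f a)) :
    PolyBound (∑ a ∈ F, m a) (∏ a ∈ F, A a) (∏ a ∈ F, f a) := by
  classical
  induction F using Finset.induction_on with
  | empty =>
    rw [Finset.sum_empty, Finset.prod_empty, Finset.prod_empty, ← C_1]
    exact const (by simp)
  | insert a F ha ih =>
    rw [Finset.sum_insert ha, Finset.prod_insert ha, Finset.prod_insert ha]
    exact (h a (Finset.mem_insert_self _ _)).mul
      (ih fun b hb => h b (Finset.mem_insert_of_mem hb))

theorem pderiv (hp : PolyBound (m + 1) A p) (i : Fin d) :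
    PolyBound m ((m + 1) * A) (MvPolynomial.pderiv i p) := by
  have hs : ∀ s ∈ p.support, s i ≤ m + 1 := fun s hs =>
    (monomial_le_degreeOf i hs).trans ((degreeOf_le_totalDegree p i).trans hp.deg)
  have h1 : MvPolynomial.pderiv i p =
      ∑ s ∈ p.support, monomial (s - Finsupp.single i 1) (coeff s p * s i) := by
    conv_lhs => rw [as_sum p]
    rw [map_sum]
    simp only [pderiv_monomial]
  rw [h1]
  constructor
  · refine totalDegree_finsetSum_le fun s hs' => ?_
    by_cases h0 : s i = 0
    · simp [h0]
    refine (totalDegree_monomial_le _ _).trans ?_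
    have h2 := (le_totalDegree hs').trans hp.deg
    have h3 : Finsupp.single i 1 ≤ s := by
      rw [Finsupp.single_le_iff]
      omega
    have h4 : s = (s - Finsupp.single i 1) + Finsupp.single i 1 := (tsub_add_cancel_of_le h3).symm
    rw [h4, Finsupp.sum_add_index' (by simp) (by simp)] at h2
    simp only [Finsupp.sum_single_index] at h2
    simpa [Function.id_def] using h2
  · refine (coefNorm_sum_le _ _).trans ?_
    have : (0 : ℝ) ≤ m + 1 := by positivity
    refine le_trans ?_ (mul_le_mul_of_nonneg_left hp.norm this)
    rw [coefNorm, Finset.mul_sum]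
    refine Finset.sum_le_sum fun s hs' => ?_
    rw [coefNorm_monomial, abs_mul, mul_comm, Nat.abs_cast]
    have : (s i : ℝ) ≤ m + 1 := by exact_mod_cast hs s hs'
    gcongr

end PolyBound

/-- The substitution of `Y` in the homogenization of degree `k` of `p`, with `σ` for the
homogenizing variable; that is, `σ ^ k * p (Y / σ)`. -/
noncomputable def homSubst (k : ℕ) (σ : MvPolynomial (Fin d) ℝ)
    (Y : Fin d → MvPolynomial (Fin d) ℝ) (p : MvPolynomial (Fin d) ℝ) : MvPolynomial (Fin d) ℝ :=
  ∑ s ∈ p.support, C (coeff s p) * (σ ^ (k - ∑ i, s i) * ∏ i, Y i ^ s i)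

theorem sum_le_of_mem_support {p : MvPolynomial (Fin d) ℝ} {k : ℕ} (hp : p.totalDegree ≤ k)
    {s : Fin d →₀ ℕ} (hs : s ∈ p.support) : ∑ i, s i ≤ k := by
  have := (le_totalDegree hs).trans hp
  rwa [Finsupp.sum_fintype _ _ (fun _ => rfl)] at this

theorem PolyBound.homSubst {k : ℕ} {M A : ℝ} {p : MvPolynomial (Fin d) ℝ} (hp : PolyBound k M p)
    (hA : 1 ≤ A) {σ : MvPolynomial (Fin d) ℝ} {Y : Fin d → MvPolynomial (Fin d) ℝ}
    (hσ : PolyBound 1 A σ) (hY : ∀ i, PolyBound 1 A (Y i)) :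
    PolyBound k (M * A ^ k) (homSubst k σ Y p) := by
  have h1 : ∀ s ∈ p.support, PolyBound k (A ^ k) (σ ^ (k - ∑ i, s i) * ∏ i, Y i ^ s i) := by
    intro s hs
    have hk := sum_le_of_mem_support hp.deg hs
    have h2 := (hσ.pow (k - ∑ i, s i)).mul
      (PolyBound.prod (F := Finset.univ) fun i _ => (hY i).pow (s i))
    refine h2.mono ?_ (le_of_eq ?_)
    · simp only [mul_one]
      omega
    · rw [Finset.prod_pow_eq_pow_sum, ← pow_add]
      congr 1
      omega
  refine ⟨totalDegree_finsetSum_le fun s hs => ?_, ?_⟩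
  · exact ((PolyBound.const le_rfl).mul (h1 s hs)).deg.trans (by simp)
  · refine (coefNorm_sum_le _ _).trans ?_
    refine le_trans ?_ (mul_le_mul_of_nonneg_right hp.norm (by positivity))
    rw [coefNorm, Finset.sum_mul]
    exact Finset.sum_le_sum fun s hs => ((PolyBound.const le_rfl).mul (h1 s hs)).norm

theorem pev_homSubst (k : ℕ) (σ : MvPolynomial (Fin d) ℝ)
    (Y : Fin d → MvPolynomial (Fin d) ℝ) (p : MvPolynomial (Fin d) ℝ) (y : Pt d) :
    pev (homSubst k σ Y p) y =
      ∑ s ∈ p.support, coeff s p * (pev σ y ^ (k - ∑ i, s i) * ∏ i, pev (Y i) y ^ s i) := by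
  simp [pev, homSubst]

theorem pev_homSubst_of_eq {k : ℕ} {σ : MvPolynomial (Fin d) ℝ}
    {Y : Fin d → MvPolynomial (Fin d) ℝ} {p : MvPolynomial (Fin d) ℝ} (hp : p.totalDegree ≤ k)
    {y z : Pt d} (h : ∀ i, pev (Y i) y = pev σ y * z i) :
    pev (homSubst k σ Y p) y = pev σ y ^ k * pev p z := by
  rw [pev_homSubst, show pev p z = _ from eval_eq' _ p, Finset.mul_sum]
  refine Finset.sum_congr rfl fun s hs => ?_
  have hk := sum_le_of_mem_support hp hs
  simp only [h, mul_pow, Finset.prod_mul_distrib]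
  rw [Finset.prod_pow_eq_pow_sum]
  have : pev σ y ^ k = pev σ y ^ (k - ∑ i, s i) * pev σ y ^ (∑ i, s i) := by
    rw [← pow_add]
    congr 1
    omega
  rw [this]
  ring

@[simp] theorem pev_add (p q : MvPolynomial (Fin d) ℝ) (y : Pt d) :
    pev (p + q) y = pev p y + pev q y := by simp [pev]

@[simp] theorem pev_sub (p q : MvPolynomial (Fin d) ℝ) (y : Pt d) :
    pev (p - q) y = pev p y - pev q y := by simp [pev]

@[simp] theorem pev_mul (p q : MvPolynomial (Fin d) ℝ) (y : Pt d) :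
    pev (p * q) y = pev p y * pev q y := by simp [pev]

@[simp] theorem pev_neg (p : MvPolynomial (Fin d) ℝ) (y : Pt d) :
    pev (-p) y = -pev p y := by simp [pev]

@[simp] theorem pev_pow (p : MvPolynomial (Fin d) ℝ) (n : ℕ) (y : Pt d) :
    pev (p ^ n) y = pev p y ^ n := by simp [pev]

@[simp] theorem pev_C (a : ℝ) (y : Pt d) : pev (C a) y = a := by simp [pev]

@[simp] theorem pev_zero (y : Pt d) : pev 0 y = 0 := by simp [pev]

@[simp] theorem pev_one (y : Pt d) : pev 1 y = 1 := by simp [pev]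

@[simp] theorem pev_X (i : Fin d) (y : Pt d) : pev (X i) y = y i := by simp [pev]

@[simp] theorem pev_sum {κ : Type*} (F : Finset κ) (f : κ → MvPolynomial (Fin d) ℝ) (y : Pt d) :
    pev (∑ a ∈ F, f a) y = ∑ a ∈ F, pev (f a) y := by simp [pev]

theorem eq_of_pev_eq {p q : MvPolynomial (Fin d) ℝ} (h : ∀ y, pev p y = pev q y) : p = q :=
  MvPolynomial.funext fun y => h (WithLp.toLp 2 y)

theorem contDiff_pev (p : MvPolynomial (Fin d) ℝ) : ContDiff ℝ ∞ (pev p) := by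
  have : pev p = fun y => ∑ s ∈ p.support, coeff s p * ∏ i, y i ^ s i := by
    ext y
    rw [pev, eval_eq']
  rw [this]
  fun_prop

theorem partialDeriv_pev (p : MvPolynomial (Fin d) ℝ) (i : Fin d) (y : Pt d) :
    partialDeriv i (pev p) y = pev (pderiv i p) y := by
  induction p using MvPolynomial.induction_on with
  | C a =>
    have : pev (C a : MvPolynomial (Fin d) ℝ) = fun _ => a := by ext; simp
    rw [this, pderiv_C, pev_zero, partialDeriv, fderiv_const_apply]
    rfl
  | add p q hp hq =>
    have : pev (p + q) = fun y => pev p y + pev q y := by ext; simp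
    rw [this, map_add, pev_add, ← hp, ← hq, partialDeriv,
      fderiv_fun_add ((contDiff_pev p).differentiable (by simp) y)
        ((contDiff_pev q).differentiable (by simp) y)]
    rfl
  | mul_X p j hp =>
    have : pev (p * X j) = fun y => pev p y * pev (X j) y := by ext; simp
    rw [this, partialDeriv_mul (contDiff_pev p) (contDiff_pev _), hp, pderiv_mul]
    have hX : partialDeriv i (pev (X j : MvPolynomial (Fin d) ℝ)) y = pev (pderiv i (X j)) y := by
      have h1 : pev (X j : MvPolynomial (Fin d) ℝ) = fun y => EuclideanSpace.proj (𝕜 := ℝ) j y := by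
        ext; simp
      rw [partialDeriv, h1, ContinuousLinearMap.fderiv, pderiv_X]
      by_cases h : i = j
      · subst h; simp
      · simp [Ne.symm h]
    rw [hX]
    simp only [pev_add, pev_mul]
    ring

theorem continuous_pev (p : MvPolynomial (Fin d) ℝ) : Continuous (pev p) :=
  (contDiff_pev p).continuous

theorem eq_zero_of_pev_eqOn_ball {p : MvPolynomial (Fin d) ℝ}
    (h : ∀ y ∈ Metric.ball (0 : Pt d) 1, pev p y = 0) : p = 0 := by
  have ho : IsOpen {x : Fin d → ℝ | WithLp.toLp 2 x ∈ Metric.ball (0 : Pt d) 1} :=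
    Metric.isOpen_ball.preimage (PiLp.continuous_toLp 2 _)
  obtain ⟨ε, hε, hb⟩ := Metric.isOpen_iff.1 ho 0 (by simp)
  refine MvPolynomial.funext_set (fun _ => Metric.ball (0 : ℝ) ε) (fun i => ?_) fun x hx => ?_
  · rw [Real.ball_eq_Ioo]
    exact Set.Ioo_infinite (by linarith)
  · have : x ∈ Metric.ball (0 : Fin d → ℝ) ε := by
      rw [ball_pi _ hε]
      exact hx
    simpa [pev] using h _ (hb this)

/-- All norms on the space of polynomials of degree at most `m` are equivalent: the coefficients
are controlled by the `L²` norm on the unit ball. -/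
theorem exists_coefNorm_sq_le_setIntegral_unitBall (d m : ℕ) :
    ∃ C : ℝ, 0 < C ∧ ∀ p : MvPolynomial (Fin d) ℝ, p.totalDegree ≤ m →
      coefNorm p ^ 2 ≤ C * ∫ y in Metric.ball (0 : Pt d) 1, pev p y ^ 2 := by
  let E := restrictTotalDegree (Fin d) ℝ m
  let b := Module.finBasis ℝ E
  let n := Module.finrank ℝ E
  have : IsFiniteMeasure (volume.restrict (Metric.ball (0 : Pt d) 1)) :=
    isFiniteMeasure_restrict_of_isBounded Metric.isBounded_ball
  have hmem : ∀ p : MvPolynomial (Fin d) ℝ,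
      MemLp (pev p) 2 (volume.restrict (Metric.ball (0 : Pt d) 1)) := by
    intro p
    refine MemLp.of_bound (continuous_pev p).aestronglyMeasurable (coefNorm p) ?_
    filter_upwards [ae_restrict_mem measurableSet_ball] with y hy
    exact abs_pev_le (le_of_lt (by simpa using hy))
  let L : (Fin n → ℝ) →ₗ[ℝ] L2 (Metric.ball (0 : Pt d) 1) :=
    { toFun := fun c => (hmem (∑ i, c i • b i : E)).toLp _
      map_add' := by
        intro c c'
        rw [← MemLp.toLp_add]
        congr 1
        ext y
        simp [add_smul, Finset.sum_add_distrib, pev]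
      map_smul' := by
        intro a c
        rw [RingHom.id_apply, ← MemLp.toLp_const_smul]
        congr 1
        ext y
        simp [pev, mul_assoc, Finset.mul_sum] }
  have hker : LinearMap.ker L = ⊥ := by
    rw [LinearMap.ker_eq_bot']
    intro c hc
    have h1 : pev (∑ i, c i • b i : E) =ᵐ[volume.restrict (Metric.ball (0 : Pt d) 1)] 0 :=
      (hmem _).coeFn_toLp.symm.trans ((Lp.ext_iff.1 hc).trans (Lp.coeFn_zero _ _ _))
    have h2 := Measure.eqOn_open_of_ae_eq h1 Metric.isOpen_ball
      (continuous_pev _).continuousOn continuousOn_const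
    have h3 := eq_zero_of_pev_eqOn_ball h2
    have h4 : ∑ i, c i • b i = 0 := Subtype.ext h3
    funext i
    exact Fintype.linearIndependent_iff.1 b.linearIndependent c h4 i
  obtain ⟨K, hK0, hK⟩ := L.exists_antilipschitzWith hker
  let S : ℝ := ∑ i, coefNorm (b i : MvPolynomial (Fin d) ℝ)
  have hS : 0 ≤ S := Finset.sum_nonneg fun _ _ => coefNorm_nonneg _
  refine ⟨(S * K) ^ 2 + 1, by positivity, fun p hp => ?_⟩
  let P : E := ⟨p, (mem_restrictTotalDegree _ _ _).2 hp⟩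
  let c : Fin n → ℝ := fun i => b.repr P i
  have hc : ∑ i, c i • b i = P := b.sum_repr P
  have hcp : ((∑ i, c i • b i : E) : MvPolynomial (Fin d) ℝ) = p := by rw [hc]
  have h1 : ‖c‖ ≤ K * ‖L c‖ := by
    have := hK.le_mul_dist c 0
    simpa using this
  have h2 : ‖L c‖ ^ 2 = ∫ y in Metric.ball (0 : Pt d) 1, pev p y ^ 2 := by
    have : L c = (hmem (∑ i, c i • b i : E)).toLp _ := rfl
    rw [this, norm_toLp_sq, hcp]
  have h3 : coefNorm p ≤ S * ‖c‖ := by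
    rw [← hcp, Submodule.coe_sum]
    refine (coefNorm_sum_le _ _).trans ?_
    rw [Finset.sum_mul]
    refine Finset.sum_le_sum fun i _ => ?_
    rw [Submodule.coe_smul, smul_eq_C_mul]
    refine (coefNorm_mul_le _ _).trans ?_
    rw [coefNorm_C, mul_comm]
    exact mul_le_mul_of_nonneg_left (norm_le_pi_norm c i) (coefNorm_nonneg _)
  rw [← h2]
  have h4 : coefNorm p ≤ S * K * ‖L c‖ := by
    rw [mul_assoc]
    exact h3.trans (mul_le_mul_of_nonneg_left h1 hS)
  have h5 := pow_le_pow_left₀ (coefNorm_nonneg p) h4 2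
  rw [mul_pow] at h5
  nlinarith [sq_nonneg ‖L c‖]

/-- The value at `y` of a polynomial in the coordinates `(y - x) / h`. -/
noncomputable def sev (x : Pt d) (h : ℝ) (p : MvPolynomial (Fin d) ℝ) (y : Pt d) : ℝ :=
  pev p (h⁻¹ • (y - x))

theorem contDiff_sev (x : Pt d) (h : ℝ) (p : MvPolynomial (Fin d) ℝ) : ContDiff ℝ ∞ (sev x h p) :=
  (contDiff_pev p).comp ((contDiff_id.sub contDiff_const).const_smul h⁻¹)

theorem partialDeriv_sev (x : Pt d) (h : ℝ) (p : MvPolynomial (Fin d) ℝ) (i : Fin d) (y : Pt d) :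
    partialDeriv i (sev x h p) y = h⁻¹ * sev x h (pderiv i p) y := by
  have h1 : HasFDerivAt (fun y : Pt d => h⁻¹ • (y - x)) (h⁻¹ • ContinuousLinearMap.id ℝ (Pt d)) y :=
    ((hasFDerivAt_id y).sub_const x).const_smul h⁻¹
  have h2 := (((contDiff_pev p).differentiable (by simp)) (h⁻¹ • (y - x))).hasFDerivAt.comp y h1
  have h3 : fderiv ℝ (sev x h p) y = _ := h2.fderiv
  rw [partialDeriv, h3, sev, ← partialDeriv_pev, partialDeriv]
  simp

theorem abs_sev_le {x y : Pt d} {h : ℝ} (hh : 0 < h) (p : MvPolynomial (Fin d) ℝ)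
    (hy : ‖y - x‖ ≤ h) : |sev x h p y| ≤ coefNorm p := by
  refine abs_pev_le ?_
  rw [norm_smul, norm_inv, Real.norm_eq_abs, abs_of_pos hh, inv_mul_le_iff₀ hh, mul_one]
  exact hy

theorem pev_homSubst_one {k : ℕ} {Y : Fin d → MvPolynomial (Fin d) ℝ}
    {p : MvPolynomial (Fin d) ℝ} (hp : p.totalDegree ≤ k)
    {y z : Pt d} (h : ∀ i, pev (Y i) y = z i) :
    pev (homSubst k 1 Y p) y = pev p z := by
  rw [pev_homSubst_of_eq hp (z := z) (by simpa using h)]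
  simp

theorem PolyBound.affine (a b : ℝ) (i : Fin d) :
    PolyBound 1 (|a| + |b|) (C a + C b * MvPolynomial.X i) := by
  simpa using ((PolyBound.const (d := d) (le_refl |a|)).mono zero_le_one le_rfl).add
    ((PolyBound.X i).const_mul (le_refl |b|))

theorem PolyBound.one {m : ℕ} {A : ℝ} (hA : 1 ≤ A) :
    PolyBound m A (1 : MvPolynomial (Fin d) ℝ) := by
  rw [← C_1]
  exact (PolyBound.const (by simpa using hA)).mono (Nat.zero_le _) le_rfl

theorem totalDegree_homSubst_affine_le {k : ℕ} {p : MvPolynomial (Fin d) ℝ}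
    (hp : p.totalDegree ≤ k) (a : Fin d → ℝ) (b : ℝ) :
    (homSubst k 1 (fun i => C (a i) + C b * X i) p).totalDegree ≤ k := by
  have hs : ∀ i, |a i| ≤ ∑ i, |a i| := fun i =>
    Finset.single_le_sum (f := fun i => |a i|) (fun _ _ => abs_nonneg _) (Finset.mem_univ i)
  have h0 : 0 ≤ ∑ i, |a i| := Finset.sum_nonneg fun _ _ => abs_nonneg _
  have hb := abs_nonneg b
  exact (PolyBound.homSubst ⟨hp, le_rfl⟩ (A := 1 + ∑ i, |a i| + |b|) (by linarith)
    (PolyBound.one (by linarith))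
    fun i => (PolyBound.affine (a i) b i).mono le_rfl (by linarith [hs i])).deg

theorem exists_sev_eq_pev {m : ℕ} {p : MvPolynomial (Fin d) ℝ} (hp : p.totalDegree ≤ m) (x : Pt d)
    {h : ℝ} (hh : h ≠ 0) :
    ∃ p' : MvPolynomial (Fin d) ℝ, p'.totalDegree ≤ m ∧ ∀ y, sev x h p' y = pev p y := by
  refine ⟨homSubst m 1 (fun i => C (x i) + C h * X i) p,
    totalDegree_homSubst_affine_le hp _ _, fun y => ?_⟩
  rw [sev, pev_homSubst_one hp (z := y)]
  intro i
  simp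
  field_simp
  ring

theorem exists_pev_eq_sev {m : ℕ} {p : MvPolynomial (Fin d) ℝ} (hp : p.totalDegree ≤ m) (x : Pt d)
    (h : ℝ) : ∃ p' : MvPolynomial (Fin d) ℝ, p'.totalDegree ≤ m ∧ ∀ y, pev p' y = sev x h p y := by
  refine ⟨homSubst m 1 (fun i => C (-(h⁻¹ * x i)) + C h⁻¹ * X i) p,
    totalDegree_homSubst_affine_le hp _ _, fun y => ?_⟩
  rw [sev, pev_homSubst_one hp]
  intro i
  simp
  ring

/-- The coefficients of a polynomial, in coordinates centred at `x` and scaled by `h`, are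
controlled by its `L²` norm on any ball of comparable radius which is not too far away. -/
theorem exists_coefNorm_sq_le_setIntegral_ball (d m : ℕ) {σ : ℝ} (hσ : 0 < σ) :
    ∃ K : ℝ, 0 < K ∧ ∀ (p : MvPolynomial (Fin d) ℝ) (x c : Pt d) (h ρ : ℝ), p.totalDegree ≤ m →
      0 < h → σ * h ≤ ρ → ‖c - x‖ ≤ h →
      coefNorm p ^ 2 * h ^ d ≤ K * ∫ y in Metric.ball c ρ, sev x h p y ^ 2 := by
  obtain ⟨K, hK, H⟩ := exists_coefNorm_sq_le_setIntegral_unitBall d m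
  let A : ℝ := 1 + 2 / σ
  have hA : 1 ≤ A := by
    have : 0 < 2 / σ := by positivity
    simp only [A]
    linarith
  refine ⟨(A ^ m) ^ 2 * K / σ ^ d, by positivity, fun p x c h ρ hp hh hρ hc => ?_⟩
  have hρ0 : 0 < ρ := lt_of_lt_of_le (by positivity) hρ
  have hcx : ∀ i, |c i - x i| ≤ h := fun i =>
    (Real.norm_eq_abs _ ▸ PiLp.norm_apply_le (c - x) i).trans hc
  have hhρ : h / ρ ≤ 1 / σ := by
    rw [div_le_div_iff₀ hρ0 hσ]
    linarith
  -- the polynomial in the coordinates of the ball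
  let r := homSubst m 1 (fun i => C ((c i - x i) / h) + C (ρ / h) * X i) p
  have hr : r.totalDegree ≤ m := totalDegree_homSubst_affine_le hp _ _
  have hrev : ∀ z, pev r z = sev x h p (c + ρ • z) := fun z => by
    rw [sev]
    refine pev_homSubst_one hp fun i => ?_
    simp
    ring
  have hpr : p = homSubst m 1 (fun i => C (-((c i - x i) / ρ)) + C (h / ρ) * X i) r := by
    refine eq_of_pev_eq fun y => ?_
    rw [pev_homSubst_one hr (z := ρ⁻¹ • (h • y - (c - x)))]
    · rw [hrev, smul_inv_smul₀ hρ0.ne', sev]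
      congr 1
      rw [show c + (h • y - (c - x)) - x = h • y by abel, inv_smul_smul₀ hh.ne']
    · intro i
      simp
      ring
  have h1 : coefNorm p ≤ coefNorm r * A ^ m := by
    conv_lhs => rw [hpr]
    refine (PolyBound.homSubst ⟨hr, le_rfl⟩ hA (PolyBound.one hA) fun i => ?_).norm
    refine (PolyBound.affine _ _ i).mono le_rfl ?_
    have h2 : |(c i - x i) / ρ| ≤ 1 / σ := by
      rw [abs_div, abs_of_pos hρ0]
      exact (div_le_div_of_nonneg_right (hcx i) hρ0.le).trans hhρ
    rw [abs_neg, abs_of_pos (show 0 < h / ρ by positivity)]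
    have h3 : 2 / σ = 1 / σ + 1 / σ := by ring
    simp only [A]
    linarith
  have h2 := H r hr
  have h3 : ∫ y in Metric.ball c ρ, sev x h p y ^ 2 =
      ρ ^ d * ∫ z in Metric.ball (0 : Pt d) 1, pev r z ^ 2 := by
    have e1 := Measure.setIntegral_comp_smul_of_pos (volume : Measure (Pt d))
      (fun z => sev x h p (c + z) ^ 2) (Metric.ball (0 : Pt d) 1) hρ0
    simp only [hrev]
    rw [e1, smul_unitBall_of_pos hρ0, finrank_euclideanSpace_fin, smul_eq_mul,
      mul_inv_cancel_left₀ (by positivity)]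
    have e2 : (fun z : Pt d => c + z) ⁻¹' Metric.ball c ρ = Metric.ball 0 ρ := by
      ext z
      simp
    rw [← e2]
    exact ((measurePreserving_add_left volume c).setIntegral_preimage_emb
      (measurableEmbedding_addLeft c) (fun y => sev x h p y ^ 2) _).symm
  have hI : 0 ≤ ∫ z in Metric.ball (0 : Pt d) 1, pev r z ^ 2 :=
    integral_nonneg fun _ => sq_nonneg _
  rw [h3]
  have h4 : coefNorm p ^ 2 ≤ (A ^ m) ^ 2 * (K * ∫ z in Metric.ball (0 : Pt d) 1, pev r z ^ 2) := by
    calc coefNorm p ^ 2 ≤ (coefNorm r * A ^ m) ^ 2 := pow_le_pow_left₀ (coefNorm_nonneg _) h1 2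
      _ = (A ^ m) ^ 2 * coefNorm r ^ 2 := by ring
      _ ≤ _ := by gcongr
  have h5 : h ^ d ≤ ρ ^ d / σ ^ d := by
    rw [← div_pow]
    refine pow_le_pow_left₀ hh.le ?_ d
    rw [le_div_iff₀ hσ]
    linarith
  calc coefNorm p ^ 2 * h ^ d ≤
      ((A ^ m) ^ 2 * (K * ∫ z in Metric.ball (0 : Pt d) 1, pev r z ^ 2)) * (ρ ^ d / σ ^ d) := by
        gcongr
    _ = _ := by ring

end Polynomials

/-! ### Polynomials on a split simplex -/

section SplitSimplex

open MvPolynomial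

/-- A simplex in `ℝ^d` whose interior contains the origin, at which it is split.
The vertices `v a` have length at most one, the `c a` are the barycentric coordinates of the
origin, and `g a` is the gradient of the affine function `μ a` which is `1` at the origin and
vanishes on the facet opposite to `v a`; thus `c a * μ a` is the barycentric coordinate of
`v a`. -/
structure SplitSimplex (d : ℕ) where
  /-- the barycentric coordinates of the origin -/
  c : Fin (d + 1) → ℝ
  /-- the vertices -/
  v : Fin (d + 1) → Pt d
  /-- the gradients of the functions `μ a` -/
  g : Fin (d + 1) → Pt d
  c_pos : ∀ a, 0 < c a
  sum_c : ∑ a, c a = 1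
  sum_c_smul_v : ∑ a, c a • v a = 0
  sum_c_smul_g : ∑ a, c a • g a = 0
  inner_g_v : ∀ a b, inner ℝ (g b) (v a) = (if a = b then (c a)⁻¹ else 0) - 1
  sum_inner_smul : ∀ y, ∑ a, (c a * inner ℝ (g a) y) • v a = y
  norm_v_le : ∀ a, ‖v a‖ ≤ 1

theorem inner_eq_sum {d : ℕ} (x y : Pt d) : inner ℝ x y = ∑ i, x i * y i := by
  simp [PiLp.inner_apply, mul_comm]

/-- If `p` has degree at most `m + 1`, then Euler's identity makes the terms of top degree in
`p - (m + 1)⁻¹ ∑ X_i ∂_i p` cancel. -/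
theorem PolyBound.euler_remainder {d m : ℕ} {M : ℝ} {p : MvPolynomial (Fin d) ℝ}
    (hp : PolyBound (m + 1) M p) :
    PolyBound m M (p - C (((m : ℝ) + 1)⁻¹) * ∑ i, MvPolynomial.X i * MvPolynomial.pderiv i p) := by
  have hm : (0 : ℝ) < (m : ℝ) + 1 := by positivity
  have h1 : p - C (((m : ℝ) + 1)⁻¹) * ∑ i, MvPolynomial.X i * MvPolynomial.pderiv i p =
      ∑ s ∈ p.support, monomial s (coeff s p * (1 - ((m : ℝ) + 1)⁻¹ * (∑ i, s i : ℕ))) := by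
    have h2 : ∑ i, MvPolynomial.X i * MvPolynomial.pderiv i p =
        ∑ s ∈ p.support, monomial s (coeff s p * (∑ i, s i : ℕ)) := by
      have h3 : ∀ i, MvPolynomial.X i * MvPolynomial.pderiv i p =
          ∑ s ∈ p.support, monomial s (coeff s p * (s i : ℕ)) := by
        intro i
        conv_lhs => rw [as_sum p]
        rw [map_sum, Finset.mul_sum]
        refine Finset.sum_congr rfl fun s _ => ?_
        rw [X_mul_pderiv_monomial, ← map_nsmul, nsmul_eq_mul, mul_comm]
      simp only [h3]
      rw [Finset.sum_comm]
      refine Finset.sum_congr rfl fun s _ => ?_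
      rw [← map_sum, ← Finset.mul_sum, Nat.cast_sum]
    rw [h2]
    rw [Finset.mul_sum]
    simp only [C_mul_monomial]
    refine (congrArg (fun r => r - _) (as_sum p)).trans ?_
    rw [← Finset.sum_sub_distrib]
    refine Finset.sum_congr rfl fun s _ => ?_
    rw [← map_sub]
    congr 1
    ring
  rw [h1]
  constructor
  · refine totalDegree_finsetSum_le fun s hs => ?_
    have h2 := sum_le_of_mem_support hp.deg hs
    by_cases h3 : ∑ i, s i = m + 1
    · have : (1 : ℝ) - ((m : ℝ) + 1)⁻¹ * (∑ i, s i : ℕ) = 0 := by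
        rw [h3]
        push_cast
        rw [inv_mul_cancel₀ hm.ne', sub_self]
      rw [this, mul_zero, monomial_zero, totalDegree_zero]
      exact Nat.zero_le _
    · refine (totalDegree_monomial_le _ _).trans ?_
      rw [Finsupp.sum_fintype _ _ (fun _ => rfl)]
      change ∑ i, s i ≤ m
      omega
  · refine (coefNorm_sum_le _ _).trans (le_trans ?_ hp.norm)
    refine Finset.sum_le_sum fun s hs => ?_
    rw [coefNorm_monomial, abs_mul]
    refine mul_le_of_le_one_right (abs_nonneg _) ?_
    have h2 : ((∑ i, s i : ℕ) : ℝ) ≤ m + 1 := by exact_mod_cast sum_le_of_mem_support hp.deg hs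
    have h3 : (0 : ℝ) ≤ (∑ i, s i : ℕ) := Nat.cast_nonneg _
    have h4 : ((m : ℝ) + 1)⁻¹ * (∑ i, s i : ℕ) ≤ 1 := by
      rw [inv_mul_le_iff₀ hm, mul_one]
      exact h2
    rw [abs_le]
    constructor
    · linarith
    · have : 0 ≤ ((m : ℝ) + 1)⁻¹ * (∑ i, s i : ℕ) := by positivity
      linarith

namespace SplitSimplex

variable {d : ℕ} (S : SplitSimplex d)

/-- The affine function which is `1` at the origin and `0` on the facet opposite to `v a`. -/
noncomputable def mu (a : Fin (d + 1)) : MvPolynomial (Fin d) ℝ := 1 + ∑ i, C (S.g a i) * X i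

theorem pev_mu (a : Fin (d + 1)) (y : Pt d) : pev (S.mu a) y = 1 + inner ℝ (S.g a) y := by
  simp [mu, inner_eq_sum]

theorem pderiv_mu (a : Fin (d + 1)) (i : Fin d) : pderiv i (S.mu a) = C (S.g a i) := by
  classical
  simp [mu, pderiv_X, Pi.single_apply]

theorem c_le_one (a : Fin (d + 1)) : S.c a ≤ 1 := by
  rw [← S.sum_c]
  exact Finset.single_le_sum (fun b _ => (S.c_pos b).le) (Finset.mem_univ a)

theorem abs_c_le (a : Fin (d + 1)) : |S.c a| ≤ 1 := by
  rw [abs_of_pos (S.c_pos a)]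
  exact S.c_le_one a

theorem abs_v_le (a : Fin (d + 1)) (i : Fin d) : |S.v a i| ≤ 1 :=
  (Real.norm_eq_abs _ ▸ PiLp.norm_apply_le (S.v a) i).trans (S.norm_v_le a)

theorem abs_c_mul_v_le (a : Fin (d + 1)) (i : Fin d) : |S.c a * S.v a i| ≤ 1 := by
  rw [abs_mul]
  exact mul_le_one₀ (S.abs_c_le a) (abs_nonneg _) (S.abs_v_le a i)

theorem sum_c_mul_inner (y : Pt d) : ∑ a, S.c a * inner ℝ (S.g a) y = 0 := by
  have h := congrArg (fun z => inner ℝ z y) S.sum_c_smul_g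
  simpa [sum_inner, inner_smul_left] using h

theorem sum_mu (y : Pt d) : ∑ a, S.c a * pev (S.mu a) y = 1 := by
  simp only [pev_mu, mul_add, mul_one, Finset.sum_add_distrib, S.sum_c, S.sum_c_mul_inner,
    add_zero]

theorem sum_c_mul_v (i : Fin d) : ∑ a, S.c a * S.v a i = 0 := by
  have h := congrArg (fun z : Pt d => z i) S.sum_c_smul_v
  simpa [Finset.sum_apply] using h

theorem sum_mu_mul_v (y : Pt d) (i : Fin d) :
    ∑ a, S.c a * pev (S.mu a) y * S.v a i = y i := by
  have h := congrArg (fun z : Pt d => z i) (S.sum_inner_smul y)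
  have h' : ∑ a, S.c a * inner ℝ (S.g a) y * S.v a i = y i := by
    simpa [Finset.sum_apply] using h
  simp only [pev_mu, mul_add, mul_one, add_mul, Finset.sum_add_distrib, S.sum_c_mul_v, zero_add, h']

/-- The moments of the vertices reproduce tuples with vanishing weighted sum. -/
theorem sum_g_mul_sum (W : Fin (d + 1) → ℝ) (b : Fin (d + 1)) :
    ∑ i, S.g b i * ∑ a, S.c a * S.v a i * W a = W b - ∑ a, S.c a * W a := by
  have h1 : ∑ i, S.g b i * ∑ a, S.c a * S.v a i * W a =
      ∑ a, S.c a * W a * inner ℝ (S.g b) (S.v a) := by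
    simp only [Finset.mul_sum, inner_eq_sum]
    rw [Finset.sum_comm]
    refine Finset.sum_congr rfl fun a _ => Finset.sum_congr rfl fun i _ => ?_
    ring
  rw [h1]
  simp only [S.inner_g_v, mul_sub, mul_one, Finset.sum_sub_distrib, mul_ite, mul_zero,
    Finset.sum_ite_eq', Finset.mem_univ, if_true]
  rw [mul_comm (S.c b), mul_assoc, mul_inv_cancel₀ (S.c_pos b).ne', mul_one]

/-- Every piecewise polynomial `q` of degree `m + 1` is a sum of `∇μ · w` with a polynomial field
`w` and of a product of `μ` with a piecewise polynomial of degree `m`. -/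
theorem exists_eq_grad_mu_add_mu_mul {m : ℕ} {A M : ℝ} (hμ : ∀ a, PolyBound 1 A (S.mu a))
    {q : Fin (d + 1) → MvPolynomial (Fin d) ℝ} (hq : ∀ a, PolyBound (m + 1) M (q a)) :
    ∃ (w : Fin d → MvPolynomial (Fin d) ℝ) (t : Fin (d + 1) → MvPolynomial (Fin d) ℝ),
      (∀ i, PolyBound (m + 1) ((d + 1) * (1 + A * ((d + 1) * (1 + d * (m + 1)))) * M) (w i)) ∧
      (∀ a, PolyBound m ((d + 1) * (1 + d * (m + 1)) * M) (t a)) ∧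
      ∀ a, q a = (∑ i, C (S.g a i) * w i) + S.mu a * t a := by
  have hm : (0 : ℝ) < (m : ℝ) + 1 := by positivity
  let p : MvPolynomial (Fin d) ℝ := ∑ a, C (S.c a) * q a
  have hp : PolyBound (m + 1) ((d + 1) * M) p := by
    have := PolyBound.sum (F := Finset.univ) fun a _ => (hq a).const_mul (S.abs_c_le a)
    simpa using this
  let t : Fin (d + 1) → MvPolynomial (Fin d) ℝ := fun a =>
    (p - C (((m : ℝ) + 1)⁻¹) * ∑ i, X i * pderiv i p) +
      ∑ i, C (((m : ℝ) + 1)⁻¹ * S.v a i) * pderiv i p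
  have ht : ∀ a, PolyBound m ((d + 1) * (1 + d * (m + 1)) * M) (t a) := by
    intro a
    have h1 : ∀ i, |((m : ℝ) + 1)⁻¹ * S.v a i| ≤ 1 := by
      intro i
      rw [abs_mul]
      refine mul_le_one₀ ?_ (abs_nonneg _) (S.abs_v_le a i)
      rw [abs_of_pos (by positivity)]
      refine inv_le_one_of_one_le₀ ?_
      have : (0 : ℝ) ≤ m := Nat.cast_nonneg m
      linarith
    refine (hp.euler_remainder.add
      (PolyBound.sum (F := Finset.univ) fun i _ => (hp.pderiv i).const_mul (h1 i))).mono le_rfl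
      (le_of_eq ?_)
    simp
    ring
  let W : Fin (d + 1) → MvPolynomial (Fin d) ℝ := fun a => q a - S.mu a * t a
  have hW : ∀ a, PolyBound (m + 1) ((1 + A * ((d + 1) * (1 + d * (m + 1)))) * M) (W a) := by
    intro a
    refine ((hq a).sub (((hμ a).mul (ht a)).mono (by omega) le_rfl)).mono le_rfl (le_of_eq ?_)
    ring
  let w : Fin d → MvPolynomial (Fin d) ℝ := fun i => ∑ a, C (S.c a * S.v a i) * W a
  refine ⟨w, t, fun i => ?_, ht, fun b => eq_of_pev_eq fun y => ?_⟩
  · refine (PolyBound.sum (F := Finset.univ) fun a _ =>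
      (hW a).const_mul (S.abs_c_mul_v_le a i)).mono le_rfl (le_of_eq ?_)
    simp
    ring
  · have hτ : ∀ a, pev (t a) y = pev p y - ((m : ℝ) + 1)⁻¹ * ∑ i, y i * pev (pderiv i p) y +
        ∑ i, ((m : ℝ) + 1)⁻¹ * S.v a i * pev (pderiv i p) y := by
      intro a
      simp [t]
    have h1 : ∑ a, S.c a * pev (S.mu a) y * pev (t a) y = pev p y := by
      have h2 : ∑ a, S.c a * pev (S.mu a) y *
          (∑ i, ((m : ℝ) + 1)⁻¹ * S.v a i * pev (pderiv i p) y) =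
          ((m : ℝ) + 1)⁻¹ * ∑ i, y i * pev (pderiv i p) y := by
        simp only [Finset.mul_sum]
        rw [Finset.sum_comm]
        refine Finset.sum_congr rfl fun i _ => ?_
        rw [← S.sum_mu_mul_v y i, Finset.sum_mul, Finset.mul_sum]
        refine Finset.sum_congr rfl fun a _ => ?_
        ring
      simp only [hτ]
      simp only [mul_add, Finset.sum_add_distrib]
      rw [h2, ← Finset.sum_mul, S.sum_mu]
      ring
    have h3 : ∑ a, S.c a * pev (W a) y = 0 := by
      have hpy : pev p y = ∑ a, S.c a * pev (q a) y := by simp [p]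
      simp only [W, pev_sub, pev_mul, mul_sub, Finset.sum_sub_distrib]
      simp only [mul_assoc] at h1
      rw [h1, hpy, sub_self]
    have h4 := S.sum_g_mul_sum (fun a => pev (W a) y) b
    rw [h3, sub_zero] at h4
    have h5 : pev (∑ i, C (S.g b i) * w i) y =
        ∑ i, S.g b i * ∑ a, S.c a * S.v a i * pev (W a) y := by
      simp [w]
    rw [pev_add, h5, h4]
    simp [W]

theorem pderiv_mu_pow_mul (a : Fin (d + 1)) (s : ℕ) (u : MvPolynomial (Fin d) ℝ) (i : Fin d) :
    pderiv i (S.mu a ^ (s + 1) * (C (((s : ℝ) + 1)⁻¹) * u)) =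
      S.mu a ^ s * (C (S.g a i) * u) +
        S.mu a ^ (s + 1) * (C (((s : ℝ) + 1)⁻¹) * pderiv i u) := by
  have hs : ((s : ℝ) + 1) ≠ 0 := by positivity
  have h1 : (C (((s : ℝ) + 1)⁻¹) : MvPolynomial (Fin d) ℝ) * ((s : MvPolynomial (Fin d) ℝ) + 1) = 1 := by
    have : ((s : MvPolynomial (Fin d) ℝ) + 1) = C ((s : ℝ) + 1) := by simp
    rw [this, ← C_mul, inv_mul_cancel₀ hs, C_1]
  rw [pderiv_mul, pderiv_pow, pderiv_mu, pderiv_C_mul, Nat.add_sub_cancel, Nat.cast_add,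
    Nat.cast_one]
  linear_combination (S.mu a ^ s * C (S.g a i) * u) * h1

/-- Up to a multiple of `μ ^ (s + m)`, every piecewise polynomial `μ ^ s * q` with `q` of degree `m`
is the divergence of a continuous piecewise polynomial field vanishing on the boundary, whose
coefficients are controlled by those of `q`. -/
theorem exists_div_eq (d m : ℕ) {A : ℝ} (hA : 1 ≤ A) (s : ℕ) :
    ∃ K : ℝ, 0 ≤ K ∧ ∀ (S : SplitSimplex d), (∀ a, PolyBound 1 A (S.mu a)) →
      ∀ (M : ℝ) (q : Fin (d + 1) → MvPolynomial (Fin d) ℝ), (∀ a, PolyBound m M (q a)) →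
      ∃ (V : Fin (d + 1) → Fin d → MvPolynomial (Fin d) ℝ) (κ : ℝ),
        (∀ a i, PolyBound (s + m + 1) (K * M) (V a i)) ∧
        (∀ a b y, pev (S.mu a) y = pev (S.mu b) y → ∀ i, pev (V a i) y = pev (V b i) y) ∧
        (∀ a y, pev (S.mu a) y = 0 → ∀ i, pev (V a i) y = 0) ∧
        ∀ a, ∑ i, pderiv i (V a i) = S.mu a ^ s * q a - C κ * S.mu a ^ (s + m) := by
  have hA0 : 0 ≤ A := by linarith
  induction m generalizing s with
  | zero =>
    refine ⟨A ^ (s + 1) * (d + 1), by positivity, fun S hμ M q hq => ?_⟩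
    have hqC : ∀ a, q a = C (coeff 0 (q a)) := fun a =>
      totalDegree_eq_zero_iff_eq_C.1 (Nat.le_zero.1 (hq a).deg)
    have hs : |((s : ℝ) + 1)⁻¹| ≤ 1 := by
      rw [abs_of_pos (by positivity)]
      refine inv_le_one_of_one_le₀ ?_
      have : (0 : ℝ) ≤ s := Nat.cast_nonneg s
      linarith
    let w : Fin d → MvPolynomial (Fin d) ℝ := fun i => ∑ a, C (S.c a * S.v a i) * q a
    have hwC : ∀ i, w i = C (∑ a, S.c a * S.v a i * coeff 0 (q a)) := by
      intro i
      simp only [w, map_sum]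
      refine Finset.sum_congr rfl fun a _ => ?_
      conv_lhs => rw [hqC a]
      rw [← C_mul]
    have hw : ∀ i, PolyBound 0 ((d + 1) * M) (w i) := by
      intro i
      exact (PolyBound.sum (F := Finset.univ) fun a _ =>
        (hq a).const_mul (S.abs_c_mul_v_le a i)).mono le_rfl (le_of_eq (by simp))
    refine ⟨fun a i => S.mu a ^ (s + 1) * (C (((s : ℝ) + 1)⁻¹) * w i),
      ∑ a, S.c a * coeff 0 (q a), fun a i => ?_, fun a b y h i => ?_, fun a y h i => ?_,
      fun b => ?_⟩
    · refine (((hμ a).pow (s + 1)).mul ((hw i).const_mul hs)).mono (by omega) (le_of_eq ?_)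
      ring
    · simp [h]
    · simp [h]
    · simp only [pderiv_mu_pow_mul, hwC, pderiv_C, mul_zero, add_zero]
      rw [← Finset.mul_sum]
      have h1 := S.sum_g_mul_sum (fun a => coeff 0 (q a)) b
      have h2 : ∑ i, (C (S.g b i) : MvPolynomial (Fin d) ℝ) *
          C (∑ a, S.c a * S.v a i * coeff 0 (q a)) =
          q b - C (∑ a, S.c a * coeff 0 (q a)) := by
        conv_rhs => rw [hqC b]
        rw [← C_sub, ← h1, map_sum]
        simp only [C_mul]
      rw [h2]
      ring
  | succ m ih =>
    obtain ⟨K, hK0, hK⟩ := ih (s + 1)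
    let K1 : ℝ := (d + 1) * (1 + A * ((d + 1) * (1 + d * (m + 1))))
    let K2 : ℝ := (d + 1) * (1 + d * (m + 1))
    have hK1 : 0 ≤ K1 := by positivity
    have hK2 : 0 ≤ K2 := by positivity
    refine ⟨A ^ (s + 1) * K1 + K * (K2 + d * ((m + 1) * K1)), by positivity,
      fun S hμ M q hq => ?_⟩
    obtain ⟨w, t, hw, ht, hqe⟩ := S.exists_eq_grad_mu_add_mu_mul hμ hq
    have hs : |((s : ℝ) + 1)⁻¹| ≤ 1 := by
      rw [abs_of_pos (by positivity)]
      refine inv_le_one_of_one_le₀ ?_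
      have : (0 : ℝ) ≤ s := Nat.cast_nonneg s
      linarith
    have hq' : ∀ a, PolyBound m ((K2 + d * ((m + 1) * K1)) * M)
        (t a - C (((s : ℝ) + 1)⁻¹) * ∑ i, pderiv i (w i)) := by
      intro a
      refine ((ht a).sub ((PolyBound.sum (F := Finset.univ) fun i _ =>
        (hw i).pderiv i).const_mul hs)).mono le_rfl (le_of_eq ?_)
      simp [K1, K2]
      ring
    obtain ⟨V, κ, hV, hV1, hV2, hV3⟩ := hK S hμ _ _ hq'
    refine ⟨fun a i => S.mu a ^ (s + 1) * (C (((s : ℝ) + 1)⁻¹) * w i) + V a i, κ,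
      fun a i => ?_, fun a b y h i => ?_, fun a y h i => ?_, fun b => ?_⟩
    · refine ((((hμ a).pow (s + 1)).mul ((hw i).const_mul hs)).mono (by omega) le_rfl |>.add
        ((hV a i).mono (by omega) le_rfl)).mono le_rfl (le_of_eq ?_)
      simp only [K1, K2]
      ring
    · simp [h, hV1 a b y h i]
    · simp [h, hV2 a y h i]
    · simp only [map_add, pderiv_mu_pow_mul, Finset.sum_add_distrib]
      rw [hV3 b, ← Finset.mul_sum, ← Finset.mul_sum, ← Finset.mul_sum, show s + (m + 1) = s + 1 + m by omega]
      conv_rhs => rw [hqe b]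
      ring

/-! ### Interpolation of boundary values -/

/-- The barycentric coordinate of the vertex `v a`. -/
noncomputable def bary (a : Fin (d + 1)) : MvPolynomial (Fin d) ℝ := C (S.c a) * S.mu a

/-- For a polynomial `p` of degree at most `k`, the extension of the restriction of `p` to the
face spanned by the vertices outside of `F`, which is obtained by omitting from the
homogenization of degree `k` of `p` all terms containing the barycentric coordinates of vertices
in `F`. -/
noncomputable def faceExt (k : ℕ) (F : Finset (Fin (d + 1))) (p : MvPolynomial (Fin d) ℝ) :
    MvPolynomial (Fin d) ℝ :=
  homSubst k (∑ a ∈ Fᶜ, S.bary a) (fun i => ∑ a ∈ Fᶜ, C (S.v a i) * S.bary a) p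

theorem polyBound_bary {A : ℝ} {a : Fin (d + 1)} (hμ : PolyBound 1 A (S.mu a)) :
    PolyBound 1 A (S.bary a) := by
  simpa [bary] using hμ.const_mul (S.abs_c_le a)

theorem polyBound_faceExt {A : ℝ} (hA : 1 ≤ A) (hμ : ∀ a, PolyBound 1 A (S.mu a)) {k : ℕ} {M : ℝ}
    {p : MvPolynomial (Fin d) ℝ} (hp : PolyBound k M p) (F : Finset (Fin (d + 1))) :
    PolyBound k (M * ((d + 1) * A) ^ k) (S.faceExt k F p) := by
  have hd : (1 : ℝ) ≤ d + 1 := by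
    have : (0 : ℝ) ≤ d := Nat.cast_nonneg d
    linarith
  have hcard : ((Fᶜ.card : ℕ) : ℝ) ≤ d + 1 := by
    have : Fᶜ.card ≤ d + 1 := by simpa using Finset.card_le_univ Fᶜ
    exact_mod_cast this
  refine hp.homSubst (by nlinarith) ?_ fun i => ?_
  · exact (PolyBound.sum fun a _ => S.polyBound_bary (hμ a)).mono le_rfl (by gcongr)
  · refine (PolyBound.sum (A := A) fun a _ => ?_).mono le_rfl (by gcongr)
    simpa using (S.polyBound_bary (hμ a)).const_mul (S.abs_v_le a i)

theorem sum_bary (y : Pt d) : ∑ a, pev (S.bary a) y = 1 := by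
  simpa [bary] using S.sum_mu y

theorem sum_bary_smul_v (y : Pt d) : ∑ a, pev (S.bary a) y • S.v a = y := by
  ext i
  simpa [bary, Finset.sum_apply] using S.sum_mu_mul_v y i

theorem pev_mu_nonneg_iff (a : Fin (d + 1)) (y : Pt d) :
    0 ≤ pev (S.bary a) y ↔ 0 ≤ pev (S.mu a) y := by
  rw [bary, pev_mul, pev_C, mul_nonneg_iff_of_pos_left (S.c_pos a)]

theorem pev_bary_eq_zero_iff (a : Fin (d + 1)) (y : Pt d) :
    pev (S.bary a) y = 0 ↔ pev (S.mu a) y = 0 := by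
  rw [bary, pev_mul, pev_C, mul_eq_zero, or_iff_right (S.c_pos a).ne']

/-- The barycentric coordinates of an affine combination of the vertices. -/
theorem pev_bary_sum {β : Fin (d + 1) → ℝ} (hβ : ∑ a, β a = 1) (b : Fin (d + 1)) :
    pev (S.bary b) (∑ a, β a • S.v a) = β b := by
  rw [bary, pev_mul, pev_C, pev_mu, inner_sum]
  simp only [inner_smul_right, S.inner_g_v, mul_sub, mul_one, Finset.sum_sub_distrib, mul_ite,
    mul_zero, Finset.sum_ite_eq', Finset.mem_univ, if_true, hβ]
  have := (S.c_pos b).ne'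
  field_simp
  ring

/-- The extension only depends on the restriction of the polynomial to the face. -/
theorem pev_faceExt_eq {k : ℕ} (hk : 1 ≤ k) {F : Finset (Fin (d + 1))}
    {p q : MvPolynomial (Fin d) ℝ} (hp : p.totalDegree ≤ k) (hq : q.totalDegree ≤ k)
    (h : ∀ z, (∀ e, 0 ≤ pev (S.mu e) z) → (∀ e ∈ F, pev (S.mu e) z = 0) → pev p z = pev q z)
    {y : Pt d} (hy : ∀ e, 0 ≤ pev (S.mu e) y) :
    pev (S.faceExt k F p) y = pev (S.faceExt k F q) y := by
  classical
  have hb : ∀ e, 0 ≤ pev (S.bary e) y := fun e => (S.pev_mu_nonneg_iff e y).2 (hy e)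
  set σ : ℝ := ∑ a ∈ Fᶜ, pev (S.bary a) y with hσ
  have hσ0 : 0 ≤ σ := Finset.sum_nonneg fun a _ => hb a
  have hY : ∀ i, pev (∑ a ∈ Fᶜ, C (S.v a i) * S.bary a) y =
      ∑ a ∈ Fᶜ, S.v a i * pev (S.bary a) y := fun i => by simp
  have hσ' : pev (∑ a ∈ Fᶜ, S.bary a) y = σ := by simp [hσ]
  rcases hσ0.eq_or_lt with h0 | hpos
  · -- all the homogeneous coordinates vanish, and so do forms of positive degree
    have hz : ∀ a ∈ Fᶜ, pev (S.bary a) y = 0 :=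
      (Finset.sum_eq_zero_iff_of_nonneg fun a _ => hb a).1 h0.symm
    have hzero : ∀ r : MvPolynomial (Fin d) ℝ, r.totalDegree ≤ k → pev (S.faceExt k F r) y = 0 := by
      intro r hr
      rw [faceExt, pev_homSubst_of_eq hr (z := 0), hσ', ← h0, zero_pow (by omega), zero_mul]
      intro i
      rw [hY, hσ', ← h0, zero_mul]
      exact Finset.sum_eq_zero fun a ha => by rw [hz a ha, mul_zero]
    rw [hzero p hp, hzero q hq]
  · let β : Fin (d + 1) → ℝ := fun a => if a ∈ F then 0 else σ⁻¹ * pev (S.bary a) y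
    let z : Pt d := ∑ a, β a • S.v a
    have hsplit : ∀ f : Fin (d + 1) → ℝ, ∑ a, (if a ∈ F then 0 else f a) = ∑ a ∈ Fᶜ, f a := by
      intro f
      rw [Finset.sum_ite, Finset.sum_const_zero, zero_add]
      refine Finset.sum_congr ?_ fun _ _ => rfl
      ext a
      simp
    have hβ : ∑ a, β a = 1 := by
      rw [hsplit, ← Finset.mul_sum, inv_mul_cancel₀ hpos.ne']
    have hβ0 : ∀ a, 0 ≤ β a := by
      intro a
      simp only [β]
      split_ifs
      · exact le_rfl
      · exact mul_nonneg (inv_nonneg.2 hσ0) (hb a)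
    have hzi : ∀ i, pev (∑ a ∈ Fᶜ, C (S.v a i) * S.bary a) y =
        pev (∑ a ∈ Fᶜ, S.bary a) y * z i := by
      intro i
      have : z i = ∑ a, (if a ∈ F then 0 else σ⁻¹ * (S.v a i * pev (S.bary a) y)) := by
        simp only [z, WithLp.ofLp_sum, Finset.sum_apply, PiLp.smul_apply, smul_eq_mul, β]
        refine Finset.sum_congr rfl fun a _ => ?_
        split_ifs
        · exact zero_mul _
        · ring
      rw [hY, hσ', this, hsplit, ← Finset.mul_sum, mul_inv_cancel_left₀ hpos.ne']
    rw [faceExt, faceExt, pev_homSubst_of_eq hp hzi, pev_homSubst_of_eq hq hzi, h z]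
    · intro e
      rw [← S.pev_mu_nonneg_iff, S.pev_bary_sum hβ]
      exact hβ0 e
    · intro e he
      rw [← S.pev_bary_eq_zero_iff, S.pev_bary_sum hβ]
      simp [β, he]

theorem pev_faceExt_insert {k : ℕ} {F : Finset (Fin (d + 1))} {j : Fin (d + 1)} (hj : j ∉ F)
    (p : MvPolynomial (Fin d) ℝ) {y : Pt d} (hy : pev (S.mu j) y = 0) :
    pev (S.faceExt k (insert j F) p) y = pev (S.faceExt k F p) y := by
  classical
  have hj0 : pev (S.bary j) y = 0 := (S.pev_bary_eq_zero_iff j y).2 hy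
  have hc : Fᶜ = insert j (insert j F)ᶜ := by
    ext a
    by_cases h : a = j
    · simp [h, hj]
    · simp [h]
  have hs : ∀ f : Fin (d + 1) → ℝ, f j = 0 → ∑ a ∈ Fᶜ, f a = ∑ a ∈ (insert j F)ᶜ, f a := by
    intro f hf
    rw [hc, Finset.sum_insert (by simp), hf, zero_add]
  rw [faceExt, faceExt, pev_homSubst, pev_homSubst]
  simp only [pev_sum, pev_mul]
  rw [hs _ hj0]
  refine Finset.sum_congr rfl fun s _ => ?_
  congr 2
  refine Finset.prod_congr rfl fun i _ => ?_
  rw [hs _ (by rw [hj0, mul_zero])]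

theorem pev_faceExt_empty {k : ℕ} {p : MvPolynomial (Fin d) ℝ} (hp : p.totalDegree ≤ k)
    (y : Pt d) : pev (S.faceExt k ∅ p) y = pev p y := by
  rw [faceExt, Finset.compl_empty, pev_homSubst_of_eq hp (z := y)]
  · simp [S.sum_bary]
  · intro i
    have h := congrArg (fun z : Pt d => z i) (S.sum_bary_smul_v y)
    simp only [WithLp.ofLp_sum, Finset.sum_apply, PiLp.smul_apply, smul_eq_mul] at h
    rw [pev_sum, pev_sum, S.sum_bary, one_mul, ← h]
    refine Finset.sum_congr rfl fun a _ => ?_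
    rw [pev_mul, pev_C, mul_comm]

/-- Polynomials of degree `k` on the facets of a simplex which agree on the intersections of the
facets are the boundary values of one polynomial of degree `k`, by inclusion-exclusion over the
faces. -/
theorem exists_interpolant (d : ℕ) {k : ℕ} (hk : 1 ≤ k) {A : ℝ} (hA : 1 ≤ A) :
    ∃ K : ℝ, 0 ≤ K ∧ ∀ (S : SplitSimplex d), (∀ a, PolyBound 1 A (S.mu a)) →
      ∀ (M : ℝ) (q : Fin (d + 1) → MvPolynomial (Fin d) ℝ), (∀ a, PolyBound k M (q a)) →
      (∀ a b y, (∀ e, 0 ≤ pev (S.mu e) y) → pev (S.mu a) y = 0 → pev (S.mu b) y = 0 →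
        pev (q a) y = pev (q b) y) →
      ∃ u : MvPolynomial (Fin d) ℝ, PolyBound k (K * M) u ∧
        ∀ a y, (∀ e, 0 ≤ pev (S.mu e) y) → pev (S.mu a) y = 0 → pev u y = pev (q a) y := by
  classical
  have hA0 : 0 ≤ A := by linarith
  refine ⟨2 ^ (d + 1) * ((d + 1) * A) ^ k, by positivity, fun S hμ M q hq hc => ?_⟩
  let pick : Finset (Fin (d + 1)) → Fin (d + 1) := fun F => if h : F.Nonempty then h.choose else 0
  have hpick : ∀ F : Finset (Fin (d + 1)), F ≠ ∅ → pick F ∈ F := by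
    intro F hF
    have h := Finset.nonempty_iff_ne_empty.2 hF
    simp only [pick, dif_pos h]
    exact h.choose_spec
  let ε : Finset (Fin (d + 1)) → ℝ := fun F => if F = ∅ then 0 else (-1) ^ (F.card + 1)
  have hε : ∀ F, |ε F| ≤ 1 := by
    intro F
    simp only [ε]
    split_ifs
    · simp
    · simp [abs_pow]
  refine ⟨∑ F ∈ Finset.univ.powerset, C (ε F) * S.faceExt k F (q (pick F)), ?_, ?_⟩
  · refine (PolyBound.sum fun F _ =>
      (S.polyBound_faceExt hA hμ (hq (pick F)) F).const_mul (hε F)).mono le_rfl (le_of_eq ?_)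
    rw [Finset.card_powerset]
    simp
    ring
  · intro j y hy hj
    have hind : ∀ (F : Finset (Fin (d + 1))) (a b : Fin (d + 1)), a ∈ F → b ∈ F →
        pev (S.faceExt k F (q a)) y = pev (S.faceExt k F (q b)) y := fun F a b ha hb =>
      S.pev_faceExt_eq hk (hq a).deg (hq b).deg
        (fun z hz hF => hc a b z hz (hF a ha) (hF b hb)) hy
    have hu : (Finset.univ : Finset (Fin (d + 1))) = insert j (Finset.univ.erase j) := by simp
    rw [pev_sum, hu, Finset.sum_powerset_insert (Finset.notMem_erase _ _),
      ← Finset.sum_add_distrib]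
    rw [Finset.sum_eq_single ∅]
    · have h1 : pick (insert j ∅) = j := by
        have := hpick (insert j ∅) (by simp)
        simpa using this
      rw [h1]
      simp only [pev_mul, pev_C, ε, if_true, zero_mul, zero_add]
      rw [if_neg (by simp), S.pev_faceExt_insert (Finset.notMem_empty j) _ hj,
        S.pev_faceExt_empty (hq j).deg]
      simp
    · -- the faces with and without the facet `j` cancel
      intro F hF hF0
      have hjF : j ∉ F := fun h => Finset.notMem_erase j _ (Finset.mem_powerset.1 hF h)
      have h1 : pev (S.faceExt k (insert j F) (q (pick (insert j F)))) y =
          pev (S.faceExt k F (q (pick F))) y := by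
        rw [hind (insert j F) _ (pick F) (hpick _ (by simp))
          (Finset.mem_insert_of_mem (hpick F hF0)), S.pev_faceExt_insert hjF _ hj]
      simp only [pev_mul, pev_C, h1, ε, if_neg hF0, Finset.card_insert_of_notMem hjF]
      rw [if_neg (by simp)]
      ring
    · intro h
      simp at h

end SplitSimplex

end SplitSimplex

/-! ### Continuous piecewise polynomials on a split cell -/

section SplitCell

open Filter Topology
open scoped NNReal

/-- A function which is Lipschitz on each member of a finite closed cover of a normed space is
Lipschitz. -/
theorem lipschitzWith_of_finite_closed_cover {E κ : Type*} [NormedAddCommGroup E] [NormedSpace ℝ E]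
    [Finite κ] {s : κ → Set E} (hs : ∀ i, IsClosed (s i)) (hcov : ⋃ i, s i = univ) {L : ℝ≥0}
    {f : E → ℝ} (hf : ∀ i, LipschitzOnWith L f (s i)) : LipschitzWith L f := by
  have hfc : Continuous f :=
    (locallyFinite_of_finite s).continuous hcov hs fun i => (hf i).continuousOn
  refine LipschitzWith.of_dist_le_mul fun x y => ?_
  let γ : ℝ → E := fun t => x + t • (y - x)
  have hγ : Continuous γ := by fun_prop
  have hγd : ∀ t t', dist (γ t) (γ t') = |t - t'| * ‖y - x‖ := by
    intro t t'
    rw [dist_add_left, dist_eq_norm, ← sub_smul, norm_smul, Real.norm_eq_abs]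
  let T : Set ℝ := {t | dist (f (γ 0)) (f (γ t)) ≤ L * (t * ‖y - x‖)}
  have hT : IsClosed T := by
    refine isClosed_le ?_ ?_
    · exact continuous_const.dist (hfc.comp hγ)
    · fun_prop
  have hsub : Icc (0 : ℝ) 1 ⊆ T := by
    refine (hT.inter isClosed_Icc).Icc_subset_of_forall_exists_gt ?_ ?_
    · change dist (f (γ 0)) (f (γ 0)) ≤ _
      simp
    · rintro t ⟨ht, ht01⟩ z hz
      -- some member of the cover meets the curve arbitrarily close to the right of `t`
      have h1 : ∃ i, ∃ᶠ τ in 𝓝[>] t, γ τ ∈ s i := by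
        by_contra! hcon
        have h2 : ∀ᶠ τ in 𝓝[>] t, ∀ i, γ τ ∉ s i :=
          eventually_all.2 hcon
        obtain ⟨τ, hτ⟩ := h2.exists
        obtain ⟨i, hi⟩ := mem_iUnion.1 (hcov ▸ mem_univ (γ τ) : γ τ ∈ ⋃ i, s i)
        exact hτ i hi
      obtain ⟨i, hi⟩ := h1
      have hti : γ t ∈ s i := (hs i).mem_of_frequently_of_tendsto hi
        (hγ.continuousAt.tendsto.mono_left nhdsWithin_le_nhds)
      obtain ⟨τ, hτi, hτ⟩ := (hi.and_eventually (Ioc_mem_nhdsGT hz)).exists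
      refine ⟨τ, ?_, hτ⟩
      have h3 := (hf i).dist_le_mul _ hti _ hτi
      rw [hγd, abs_sub_comm, abs_of_pos (sub_pos.2 hτ.1)] at h3
      have h4 : dist (f (γ 0)) (f (γ t)) ≤ L * (t * ‖y - x‖) := ht
      calc dist (f (γ 0)) (f (γ τ)) ≤ dist (f (γ 0)) (f (γ t)) + dist (f (γ t)) (f (γ τ)) :=
            dist_triangle _ _ _
        _ ≤ L * (t * ‖y - x‖) + L * ((τ - t) * ‖y - x‖) := add_le_add h4 h3
        _ = L * (τ * ‖y - x‖) := by ring
  have h1 : dist (f (γ 0)) (f (γ 1)) ≤ L * (1 * ‖y - x‖) := hsub ⟨zero_le_one, le_rfl⟩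
  simpa [γ, dist_eq_norm, norm_sub_rev x y] using h1

/-- A simplex of `ℝ^d` with a splitting point `x` in its interior and a length scale `h` which
bounds the distances of its vertices from `x`. The split simplex `S` lives in the coordinates
`(y - x) / h`. -/
structure SplitCell (d : ℕ) where
  /-- the simplex in scaled coordinates -/
  S : SplitSimplex d
  /-- the splitting point -/
  x : Pt d
  /-- the length scale -/
  h : ℝ
  h_pos : 0 < h

namespace SplitCell

variable {d : ℕ} (Q : SplitCell d)

/-- The affine function which is `1` at the splitting point and vanishes on the facet opposite
to the vertex `a`. -/
noncomputable def mu (a : Fin (d + 1)) (y : Pt d) : ℝ := sev Q.x Q.h (Q.S.mu a) y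

/-- The simplex. -/
def cell : Set (Pt d) := {y | ∀ e, 0 ≤ Q.mu e y}

/-- The interior of the simplex. -/
def openCell : Set (Pt d) := {y | ∀ e, 0 < Q.mu e y}

/-- The part of the simplex spanned by the splitting point and the facet opposite to `a`. -/
def piece (a : Fin (d + 1)) : Set (Pt d) := {y | 0 ≤ Q.mu a y ∧ ∀ e, Q.mu a y ≤ Q.mu e y}

/-- The interior of the part `Q.piece a`. -/
def openPiece (a : Fin (d + 1)) : Set (Pt d) :=
  {y | 0 < Q.mu a y ∧ ∀ e, e ≠ a → Q.mu a y < Q.mu e y}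

theorem mu_eq (a : Fin (d + 1)) (y : Pt d) :
    Q.mu a y = 1 + inner ℝ (Q.S.g a) (Q.h⁻¹ • (y - Q.x)) := Q.S.pev_mu a _

theorem continuous_mu (a : Fin (d + 1)) : Continuous (Q.mu a) := (contDiff_sev _ _ _).continuous

theorem mu_convex_comb (a : Fin (d + 1)) (y z : Pt d) {s t : ℝ} (hst : s + t = 1) :
    Q.mu a (s • y + t • z) = s * Q.mu a y + t * Q.mu a z := by
  have h1 : s • y + t • z - Q.x = s • (y - Q.x) + t • (z - Q.x) := by
    have : Q.x = s • Q.x + t • Q.x := by rw [← add_smul, hst, one_smul]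
    conv_lhs => rw [this]
    module
  rw [mu_eq, mu_eq, mu_eq, h1, smul_add, smul_comm Q.h⁻¹ s, smul_comm Q.h⁻¹ t, inner_add_right,
    inner_smul_right _ (Q.h⁻¹ • (y - Q.x)) s, inner_smul_right _ (Q.h⁻¹ • (z - Q.x)) t]
  linear_combination -hst

theorem mu_center (a : Fin (d + 1)) : Q.mu a Q.x = 1 := by simp [mu_eq]

theorem isClosed_piece (a : Fin (d + 1)) : IsClosed (Q.piece a) := by
  have : Q.piece a = {y | 0 ≤ Q.mu a y} ∩ ⋂ e, {y | Q.mu a y ≤ Q.mu e y} := by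
    ext y
    simp [piece]
  rw [this]
  exact (isClosed_le continuous_const (Q.continuous_mu a)).inter
    (isClosed_iInter fun e => isClosed_le (Q.continuous_mu a) (Q.continuous_mu e))

theorem isOpen_openCell : IsOpen Q.openCell := by
  have : Q.openCell = ⋂ e, {y | 0 < Q.mu e y} := by
    ext y
    simp [openCell]
  rw [this]
  exact isOpen_iInter_of_finite fun e => isOpen_lt continuous_const (Q.continuous_mu e)

theorem isOpen_openPiece (a : Fin (d + 1)) : IsOpen (Q.openPiece a) := by
  have : Q.openPiece a = {y | 0 < Q.mu a y} ∩ ⋂ e, ⋂ (_ : e ≠ a), {y | Q.mu a y < Q.mu e y} := by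
    ext y
    simp [openPiece]
  rw [this]
  exact (isOpen_lt continuous_const (Q.continuous_mu a)).inter
    (isOpen_iInter_of_finite fun e => isOpen_iInter_of_finite fun _ =>
      isOpen_lt (Q.continuous_mu a) (Q.continuous_mu e))

theorem convex_piece (a : Fin (d + 1)) : Convex ℝ (Q.piece a) := by
  intro y hy z hz s t hs ht hst
  refine ⟨?_, fun e => ?_⟩
  · rw [Q.mu_convex_comb a y z hst]
    exact add_nonneg (mul_nonneg hs hy.1) (mul_nonneg ht hz.1)
  · rw [Q.mu_convex_comb a y z hst, Q.mu_convex_comb e y z hst]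
    exact add_le_add (mul_le_mul_of_nonneg_left (hy.2 e) hs) (mul_le_mul_of_nonneg_left (hz.2 e) ht)

theorem piece_subset_cell (a : Fin (d + 1)) : Q.piece a ⊆ Q.cell :=
  fun _ hy e => hy.1.trans (hy.2 e)

theorem openPiece_subset_piece (a : Fin (d + 1)) : Q.openPiece a ⊆ Q.piece a := by
  intro y hy
  refine ⟨hy.1.le, fun e => ?_⟩
  by_cases h : e = a
  · rw [h]
  · exact (hy.2 e h).le

theorem openPiece_subset_openCell (a : Fin (d + 1)) : Q.openPiece a ⊆ Q.openCell :=
  fun _ hy e => hy.1.trans_le ((Q.openPiece_subset_piece a hy).2 e)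

theorem openCell_subset_cell : Q.openCell ⊆ Q.cell := fun _ hy e => (hy e).le

theorem exists_mem_piece {y : Pt d} (hy : y ∈ Q.cell) : ∃ a, y ∈ Q.piece a := by
  obtain ⟨a, ha⟩ := Finite.exists_min fun a => Q.mu a y
  exact ⟨a, hy a, ha⟩

theorem openPiece_disjoint {a b : Fin (d + 1)} (hab : a ≠ b) :
    Disjoint (Q.openPiece a) (Q.openPiece b) := by
  rw [Set.disjoint_left]
  intro y ha hb
  exact lt_asymm (ha.2 b hab.symm) (hb.2 a hab)

theorem norm_sub_le {y : Pt d} (hy : y ∈ Q.cell) : ‖y - Q.x‖ ≤ Q.h := by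
  have h1 := Q.S.sum_bary_smul_v (Q.h⁻¹ • (y - Q.x))
  have h2 : ‖Q.h⁻¹ • (y - Q.x)‖ ≤ 1 := by
    conv_lhs => rw [← h1]
    refine (norm_sum_le _ _).trans ?_
    rw [← Q.S.sum_bary (Q.h⁻¹ • (y - Q.x))]
    refine Finset.sum_le_sum fun a _ => ?_
    have h3 : 0 ≤ pev (Q.S.bary a) (Q.h⁻¹ • (y - Q.x)) := (Q.S.pev_mu_nonneg_iff a _).2 (hy a)
    rw [norm_smul, Real.norm_eq_abs, abs_of_nonneg h3]
    exact mul_le_of_le_one_right h3 (Q.S.norm_v_le a)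
  rwa [norm_smul, norm_inv, Real.norm_eq_abs, abs_of_pos Q.h_pos, inv_mul_le_iff₀ Q.h_pos,
    mul_one] at h2

theorem cell_subset_closedBall : Q.cell ⊆ Metric.closedBall Q.x Q.h := fun y hy => by
  rw [Metric.mem_closedBall, dist_eq_norm]
  exact Q.norm_sub_le hy

theorem isCompact_piece (a : Fin (d + 1)) : IsCompact (Q.piece a) :=
  (isCompact_closedBall Q.x Q.h).of_isClosed_subset (Q.isClosed_piece a)
    ((Q.piece_subset_cell a).trans Q.cell_subset_closedBall)

theorem g_sub_ne_zero {a b : Fin (d + 1)} (hab : a ≠ b) : Q.S.g a - Q.S.g b ≠ 0 := by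
  intro h
  have h1 : inner ℝ (Q.S.g a - Q.S.g b) (Q.S.v a) = 0 := by rw [h, inner_zero_left]
  rw [inner_sub_left, Q.S.inner_g_v, Q.S.inner_g_v, if_pos rfl, if_neg hab] at h1
  have := (inv_pos.2 (Q.S.c_pos a)).ne'
  apply this
  linarith

theorem g_ne_zero (hd : 0 < d) (a : Fin (d + 1)) : Q.S.g a ≠ 0 := by
  intro h
  have : Nontrivial (Fin (d + 1)) := Fin.nontrivial_iff_two_le.2 (by omega)
  obtain ⟨b, hb⟩ := exists_ne a
  have h1 : inner ℝ (Q.S.g a) (Q.S.v b) = 0 := by rw [h, inner_zero_left]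
  rw [Q.S.inner_g_v, if_neg hb] at h1
  norm_num at h1

theorem ae_inner_add_ne_zero {n : Pt d} (hn : n ≠ 0) (α : ℝ) :
    ∀ᵐ y ∂(volume : Measure (Pt d)), α + inner ℝ n y ≠ 0 := by
  have h1 : (0 : ℝ) < ‖n‖ ^ 2 := by
    have := norm_pos_iff.2 hn
    positivity
  filter_upwards [ae_inner_ne_zero (-(α / ‖n‖ ^ 2) • n) hn] with y hy
  rw [inner_sub_right, inner_smul_right, real_inner_self_eq_norm_sq] at hy
  intro h
  apply hy
  field_simp
  linarith

theorem ae_mu_ne (hd : 0 < d) : ∀ᵐ y ∂(volume : Measure (Pt d)),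
    (∀ a, Q.mu a y ≠ 0) ∧ ∀ a b, a ≠ b → Q.mu a y ≠ Q.mu b y := by
  have hh := (inv_pos.2 Q.h_pos).ne'
  have h1 : ∀ a, ∀ᵐ y ∂(volume : Measure (Pt d)), Q.mu a y ≠ 0 := by
    intro a
    filter_upwards [ae_inner_add_ne_zero (smul_ne_zero hh (Q.g_ne_zero hd a))
      (1 - Q.h⁻¹ * inner ℝ (Q.S.g a) Q.x)] with y hy h
    apply hy
    rw [mu_eq, inner_smul_right, inner_sub_right] at h
    rw [inner_smul_left]
    simp only [conj_trivial]
    linarith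
  have h2 : ∀ a b, ∀ᵐ y ∂(volume : Measure (Pt d)), a ≠ b → Q.mu a y ≠ Q.mu b y := by
    intro a b
    by_cases hab : a = b
    · exact Eventually.of_forall fun y h => absurd hab h
    filter_upwards [ae_inner_add_ne_zero (smul_ne_zero hh (Q.g_sub_ne_zero hab))
      (- (Q.h⁻¹ * inner ℝ (Q.S.g a - Q.S.g b) Q.x))] with y hy _ h
    apply hy
    rw [mu_eq, mu_eq, inner_smul_right, inner_smul_right, inner_sub_right, inner_sub_right] at h
    rw [inner_smul_left]
    simp only [conj_trivial, inner_sub_left]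
    linarith
  exact (ae_all_iff.2 h1).and (ae_all_iff.2 fun a => ae_all_iff.2 fun b => h2 a b)

theorem ae_mem_openPiece (hd : 0 < d) : ∀ᵐ y ∂(volume : Measure (Pt d)),
    ∀ a, y ∈ Q.piece a → y ∈ Q.openPiece a := by
  filter_upwards [Q.ae_mu_ne hd] with y hy a ha
  exact ⟨lt_of_le_of_ne ha.1 (hy.1 a).symm, fun e he =>
    lt_of_le_of_ne (ha.2 e) (hy.2 a e he.symm)⟩

/-- The conditions under which polynomials on the parts of a split cell, given in scaled
coordinates, form a continuous function vanishing on the boundary of the cell. -/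
structure IsBubble (V : Fin (d + 1) → MvPolynomial (Fin d) ℝ) : Prop where
  compat : ∀ a b y, y ∈ Q.piece a → y ∈ Q.piece b → sev Q.x Q.h (V a) y = sev Q.x Q.h (V b) y
  boundary : ∀ a y, y ∈ Q.piece a → Q.mu a y = 0 → sev Q.x Q.h (V a) y = 0

open Classical in
/-- The function with the polynomial pieces `V a`, extended by zero. -/
noncomputable def bubble (V : Fin (d + 1) → MvPolynomial (Fin d) ℝ) (y : Pt d) : ℝ :=
  if h : ∃ a, y ∈ Q.piece a then sev Q.x Q.h (V h.choose) y else 0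

namespace IsBubble

variable {Q} {V : Fin (d + 1) → MvPolynomial (Fin d) ℝ} (hV : Q.IsBubble V)
include hV

theorem bubble_eq {a : Fin (d + 1)} {y : Pt d} (hy : y ∈ Q.piece a) :
    Q.bubble V y = sev Q.x Q.h (V a) y := by
  have h : ∃ a, y ∈ Q.piece a := ⟨a, hy⟩
  rw [bubble, dif_pos h]
  exact hV.compat _ _ _ h.choose_spec hy

theorem bubble_eq_zero {y : Pt d} (hy : y ∉ Q.openCell) : Q.bubble V y = 0 := by
  by_cases h : ∃ a, y ∈ Q.piece a
  · obtain ⟨a, ha⟩ := h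
    rw [hV.bubble_eq ha]
    refine hV.boundary a y ha ?_
    by_contra h0
    exact hy fun e => (lt_of_le_of_ne ha.1 (Ne.symm h0)).trans_le (ha.2 e)
  · rw [bubble, dif_neg h]

theorem hasCompactSupport : HasCompactSupport (Q.bubble V) :=
  HasCompactSupport.intro (isCompact_closedBall Q.x Q.h) fun _ hy =>
    hV.bubble_eq_zero fun h => hy (Q.cell_subset_closedBall (Q.openCell_subset_cell h))

theorem exists_lipschitzWith : ∃ L, LipschitzWith L (Q.bubble V) := by
  have h1 : ∀ a, ∃ L, LipschitzOnWith L (Q.bubble V) (Q.piece a) := by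
    intro a
    have h2 : LocallyLipschitz (sev Q.x Q.h (V a)) :=
      ((contDiff_sev Q.x Q.h (V a)).of_le (m := 1) (by simp)).locallyLipschitz
    obtain ⟨L, hL⟩ := (h2.locallyLipschitzOn (s := Q.piece a)).exists_lipschitzOnWith_of_compact
      (Q.isCompact_piece a)
    refine ⟨L, fun y hy z hz => ?_⟩
    rw [hV.bubble_eq hy, hV.bubble_eq hz]
    exact hL hy hz
  choose L hL using h1
  let s : Option (Fin (d + 1)) → Set (Pt d) := fun o => o.elim Q.openCellᶜ Q.piece
  refine ⟨∑ a, L a, lipschitzWith_of_finite_closed_cover (s := s) ?_ ?_ ?_⟩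
  · rintro (_ | a)
    · exact Q.isOpen_openCell.isClosed_compl
    · exact Q.isClosed_piece a
  · refine eq_univ_of_forall fun y => mem_iUnion.2 ?_
    by_cases hy : y ∈ Q.openCell
    · obtain ⟨a, ha⟩ := Q.exists_mem_piece (Q.openCell_subset_cell hy)
      exact ⟨some a, ha⟩
    · exact ⟨none, hy⟩
  · rintro (_ | a)
    · intro y hy z hz
      rw [hV.bubble_eq_zero hy, hV.bubble_eq_zero hz]
      simp
    · exact (hL a).weaken (Finset.single_le_sum (f := L) (fun _ _ => zero_le) (Finset.mem_univ a))

end IsBubble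

end SplitCell

end SplitCell

/-! ### Cells of a triangulation as split cells, and shape regularity -/

section Geometry

variable {d : ℕ}

/-- The split simplex, in the coordinates `(y - x) / h`, given by the vertices of an affine basis
and a point `x` in the interior of their convex hull. -/
noncomputable def SplitSimplex.ofAffineBasis (b : AffineBasis (Fin (d + 1)) ℝ (Pt d)) {x : Pt d}
    (hx : ∀ a, 0 < b.coord a x) {h : ℝ} (hh : 0 < h) (hb : ∀ a, ‖b a - x‖ ≤ h) :
    SplitSimplex d where
  c a := b.coord a x
  v a := h⁻¹ • (b a - x)
  g a := (h / b.coord a x) • (InnerProductSpace.toDual ℝ (Pt d)).symm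
    (LinearMap.toContinuousLinearMap (b.coord a).linear)
  c_pos := hx
  sum_c := b.sum_coord_apply_eq_one x
  sum_c_smul_v := by
    have h1 := b.linear_combination_coord_eq_self x
    have h2 := b.sum_coord_apply_eq_one x
    simp only [smul_comm _ h⁻¹]
    rw [← Finset.smul_sum]
    simp only [smul_sub, Finset.sum_sub_distrib]
    rw [h1, ← Finset.sum_smul, h2, one_smul, sub_self]
  sum_c_smul_g := by
    have h1 : ∀ a, b.coord a x • (h / b.coord a x) • (InnerProductSpace.toDual ℝ (Pt d)).symm
        (LinearMap.toContinuousLinearMap (b.coord a).linear) =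
        h • (InnerProductSpace.toDual ℝ (Pt d)).symm
        (LinearMap.toContinuousLinearMap (b.coord a).linear) := fun a => by
      rw [smul_smul, mul_div_cancel₀ _ (hx a).ne']
    simp only [h1]
    rw [← Finset.smul_sum, ← map_sum, ← map_sum]
    have h2 : ∑ a, (b.coord a).linear = 0 := by
      refine LinearMap.ext fun y => ?_
      have h3 : ∀ a, (b.coord a).linear y = b.coord a (y +ᵥ x) - b.coord a x := fun a => by
        rw [AffineMap.map_vadd, vadd_eq_add, add_sub_cancel_right]
      rw [LinearMap.sum_apply]
      simp only [h3, Finset.sum_sub_distrib, b.sum_coord_apply_eq_one, sub_self,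
        LinearMap.zero_apply]
    rw [h2]
    simp
  inner_g_v a c := by
    have h1 : (b.coord c).linear (b a - x) = b.coord c (b a) - b.coord c x := by
      rw [← vsub_eq_sub, AffineMap.linearMap_vsub, vsub_eq_sub]
    rw [inner_smul_left, InnerProductSpace.toDual_symm_apply]
    have h2 := (hx c).ne'
    simp only [LinearMap.coe_toContinuousLinearMap', map_smul, smul_eq_mul, h1, conj_trivial]
    by_cases hac : a = c
    · subst hac
      rw [if_pos rfl, b.coord_apply_eq]
      field_simp
    · rw [if_neg hac, b.coord_apply_ne (Ne.symm hac)]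
      field_simp
      ring
  sum_inner_smul y := by
    have h1 : ∀ a, (b.coord a x * inner ℝ ((h / b.coord a x) •
        (InnerProductSpace.toDual ℝ (Pt d)).symm
        (LinearMap.toContinuousLinearMap (b.coord a).linear)) y) • h⁻¹ • (b a - x) =
        (b.coord a).linear y • (b a - x) := by
      intro a
      rw [inner_smul_left, InnerProductSpace.toDual_symm_apply, smul_smul]
      congr 1
      have h2 := (hx a).ne'
      simp only [LinearMap.coe_toContinuousLinearMap', conj_trivial]
      field_simp
    simp only [h1]
    have h3 : ∀ a, (b.coord a).linear y = b.coord a (y +ᵥ x) - b.coord a x := fun a => by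
      rw [AffineMap.map_vadd, vadd_eq_add, add_sub_cancel_right]
    simp only [h3, sub_smul, smul_sub, Finset.sum_sub_distrib]
    rw [b.linear_combination_coord_eq_self, b.linear_combination_coord_eq_self,
      ← Finset.sum_smul, ← Finset.sum_smul, b.sum_coord_apply_eq_one, b.sum_coord_apply_eq_one,
      vadd_eq_add]
    abel
  norm_v_le a := by
    rw [norm_smul, norm_inv, Real.norm_eq_abs, abs_of_pos hh, inv_mul_le_iff₀ hh, mul_one]
    exact hb a

theorem hull_isBounded (K : Finset (Pt d)) : Bornology.IsBounded (hull K) :=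
  isBounded_convexHull.2 K.finite_toSet.isBounded

namespace SplitCell

theorem mu_add_smul_v (Q : SplitCell d) (a b : Fin (d + 1)) :
    Q.mu b (Q.x + Q.h • Q.S.v a) = if a = b then (Q.S.c a)⁻¹ else 0 := by
  rw [mu_eq, add_sub_cancel_left, inv_smul_smul₀ Q.h_pos.ne', Q.S.inner_g_v]
  ring

/-- The barycentric coordinates of a split cell reconstruct its points. -/
theorem sum_smul_vertex (Q : SplitCell d) (y : Pt d) :
    ∑ a, (Q.S.c a * Q.mu a y) • (Q.x + Q.h • Q.S.v a) = y := by
  have h1 := Q.S.sum_bary_smul_v (Q.h⁻¹ • (y - Q.x))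
  have h2 := Q.S.sum_bary (Q.h⁻¹ • (y - Q.x))
  have h3 : ∀ a, pev (Q.S.bary a) (Q.h⁻¹ • (y - Q.x)) = Q.S.c a * Q.mu a y := fun a => by
    rw [SplitSimplex.bary, pev_mul, pev_C]
    rfl
  simp only [h3] at h1 h2
  simp only [smul_add, smul_comm _ Q.h, Finset.sum_add_distrib]
  rw [← Finset.sum_smul, h2, ← Finset.smul_sum, h1, smul_inv_smul₀ Q.h_pos.ne', one_smul]
  abel

theorem sum_c_mul_mu (Q : SplitCell d) (y : Pt d) : ∑ a, Q.S.c a * Q.mu a y = 1 :=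
  Q.S.sum_mu _

theorem convex_cell (Q : SplitCell d) : Convex ℝ Q.cell := by
  intro y hy z hz s t hs ht hst e
  rw [Q.mu_convex_comb e y z hst]
  exact add_nonneg (mul_nonneg hs (hy e)) (mul_nonneg ht (hz e))

theorem cell_eq_convexHull (Q : SplitCell d) :
    Q.cell = convexHull ℝ (Set.range fun a => Q.x + Q.h • Q.S.v a) := by
  refine Subset.antisymm (fun y hy => ?_) (convexHull_min ?_ Q.convex_cell)
  · rw [← Q.sum_smul_vertex y]
    exact (convex_convexHull ℝ _).sum_mem
      (fun a _ => mul_nonneg (Q.S.c_pos a).le (hy a)) (Q.sum_c_mul_mu y)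
      fun a _ => subset_convexHull ℝ _ (mem_range_self a)
  · rintro _ ⟨a, rfl⟩ e
    rw [mu_add_smul_v]
    split_ifs
    · exact (inv_pos.2 (Q.S.c_pos a)).le
    · exact le_rfl

theorem vertex_mem_piece (Q : SplitCell d) {a e : Fin (d + 1)} (he : e ≠ a) :
    Q.x + Q.h • Q.S.v e ∈ Q.piece a := by
  constructor
  · rw [mu_add_smul_v, if_neg he]
  · intro f
    rw [mu_add_smul_v, mu_add_smul_v, if_neg he]
    split_ifs
    · exact (inv_pos.2 (Q.S.c_pos e)).le
    · exact le_rfl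

theorem center_mem_piece (Q : SplitCell d) (a : Fin (d + 1)) : Q.x ∈ Q.piece a := by
  constructor
  · rw [mu_center]
    exact zero_le_one
  · intro f
    rw [mu_center, mu_center]

theorem piece_eq_convexHull (Q : SplitCell d) (a : Fin (d + 1)) :
    Q.piece a = convexHull ℝ (insert Q.x ((fun e => Q.x + Q.h • Q.S.v e) '' {a}ᶜ)) := by
  refine Subset.antisymm (fun y hy => ?_) (convexHull_min ?_ (Q.convex_piece a))
  · let z : Fin (d + 1) → Pt d := fun e => if e = a then Q.x else Q.x + Q.h • Q.S.v e
    let w : Fin (d + 1) → ℝ := fun e =>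
      if e = a then Q.mu a y else Q.S.c e * (Q.mu e y - Q.mu a y)
    have hx := Q.sum_smul_vertex Q.x
    have hy' := Q.sum_smul_vertex y
    simp only [mu_center, mul_one] at hx
    have hw0 : ∀ e, 0 ≤ w e := by
      intro e
      simp only [w]
      split_ifs
      · exact hy.1
      · exact mul_nonneg (Q.S.c_pos e).le (sub_nonneg.2 (hy.2 e))
    have hw : ∀ e, w e = Q.S.c e * (Q.mu e y - Q.mu a y) + if e = a then Q.mu a y else 0 := by
      intro e
      simp only [w]
      split_ifs with h
      · subst h; ring
      · ring
    have hw1 : ∑ e, w e = 1 := by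
      simp only [hw, mul_sub, Finset.sum_add_distrib, Finset.sum_sub_distrib, Q.sum_c_mul_mu,
        ← Finset.sum_mul, Q.S.sum_c, Finset.sum_ite_eq', Finset.mem_univ, if_true]
      ring
    have hwz : ∑ e, w e • z e = y := by
      have h1 : ∀ e, w e • z e = (Q.S.c e * Q.mu e y) • (Q.x + Q.h • Q.S.v e) -
          Q.mu a y • Q.S.c e • (Q.x + Q.h • Q.S.v e) + if e = a then Q.mu a y • Q.x else 0 := by
        intro e
        simp only [w, z]
        split_ifs with h
        · subst h
          rw [smul_smul, mul_comm (Q.mu e y), sub_self, zero_add]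
        · rw [add_zero, smul_smul, ← sub_smul]
          congr 1
          ring
      simp only [h1, Finset.sum_add_distrib, Finset.sum_sub_distrib, ← Finset.smul_sum, hx, hy',
        Finset.sum_ite_eq', Finset.mem_univ, if_true]
      abel
    rw [← hwz]
    refine (convex_convexHull ℝ _).sum_mem (fun e _ => hw0 e) hw1 fun e _ =>
      subset_convexHull ℝ _ ?_
    simp only [z]
    split_ifs with h
    · exact mem_insert _ _
    · exact mem_insert_of_mem _ ⟨e, h, rfl⟩
  · rintro _ (rfl | ⟨e, he, rfl⟩)
    · exact Q.center_mem_piece a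
    · exact Q.vertex_mem_piece he

theorem openCell_subset_interior (Q : SplitCell d) : Q.openCell ⊆ interior Q.cell :=
  interior_maximal Q.openCell_subset_cell Q.isOpen_openCell

theorem interior_cell_subset (hd : 0 < d) (Q : SplitCell d) : interior Q.cell ⊆ Q.openCell := by
  intro y hy e
  have h0 : 0 ≤ Q.mu e y := interior_subset hy e
  refine lt_of_le_of_ne h0 fun h => ?_
  -- moving against the gradient leaves the cell
  have hc : Continuous fun t : ℝ => y - t • Q.S.g e := by fun_prop
  have hm : ∀ᶠ t in nhdsWithin (0 : ℝ) (Ioi 0), y - t • Q.S.g e ∈ interior Q.cell :=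
    (hc.continuousAt.eventually_mem (isOpen_interior.mem_nhds (by simpa using hy))).filter_mono
      nhdsWithin_le_nhds
  obtain ⟨t, ht, ht0⟩ := (hm.and self_mem_nhdsWithin).exists
  have h1 := interior_subset ht e
  have h2 : 0 < ‖Q.S.g e‖ ^ 2 := by
    have := norm_pos_iff.2 (Q.g_ne_zero hd e)
    positivity
  have h3 : Q.mu e (y - t • Q.S.g e) = Q.mu e y - Q.h⁻¹ * (t * ‖Q.S.g e‖ ^ 2) := by
    rw [mu_eq, mu_eq, show y - t • Q.S.g e - Q.x = (y - Q.x) - t • Q.S.g e by abel, smul_sub,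
      inner_sub_right, inner_smul_right _ (t • Q.S.g e), inner_smul_right _ (Q.S.g e),
      real_inner_self_eq_norm_sq]
    ring
  rw [h3, ← h] at h1
  have h4 : 0 < Q.h⁻¹ * (t * ‖Q.S.g e‖ ^ 2) :=
    mul_pos (inv_pos.2 Q.h_pos) (mul_pos ht0 h2)
  linarith

theorem openCell_eq_interior (hd : 0 < d) (Q : SplitCell d) : Q.openCell = interior Q.cell :=
  Subset.antisymm Q.openCell_subset_interior (Q.interior_cell_subset hd)

/-- A lower bound for the variation of an affine function on a ball. -/
theorem two_mul_norm_g_le (Q : SplitCell d) {a : Fin (d + 1)} {c : Pt d} {r B : ℝ} (hr : 0 ≤ r)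
    (h0 : ∀ y ∈ Metric.closedBall c r, 0 ≤ Q.mu a y)
    (h1 : ∀ y ∈ Metric.closedBall c r, Q.mu a y ≤ B) : 2 * r * ‖Q.S.g a‖ ≤ B * Q.h := by
  by_cases hg : Q.S.g a = 0
  · rw [hg, norm_zero, mul_zero]
    have hB : 0 ≤ B := (h0 c (Metric.mem_closedBall_self hr)).trans
      (h1 c (Metric.mem_closedBall_self hr))
    exact mul_nonneg hB Q.h_pos.le
  have hg' : 0 < ‖Q.S.g a‖ := norm_pos_iff.2 hg
  let n : Pt d := (r * ‖Q.S.g a‖⁻¹) • Q.S.g a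
  have hn : ‖n‖ ≤ r := by
    rw [norm_smul, Real.norm_eq_abs, abs_of_nonneg (by positivity), mul_assoc,
      inv_mul_cancel₀ hg'.ne', mul_one]
  have hgn : inner ℝ (Q.S.g a) n = r * ‖Q.S.g a‖ := by
    rw [inner_smul_right, real_inner_self_eq_norm_sq]
    field_simp
  have e1 := h1 (c + n) (by simpa [Metric.mem_closedBall, dist_eq_norm] using hn)
  have e0 := h0 (c - n) (by simpa [Metric.mem_closedBall, dist_eq_norm] using hn)
  rw [mu_eq, show c + n - Q.x = (c - Q.x) + n by abel, smul_add, inner_add_right,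
    inner_smul_right _ n, hgn] at e1
  rw [mu_eq, show c - n - Q.x = (c - Q.x) - n by abel, smul_sub, inner_sub_right,
    inner_smul_right _ n, hgn] at e0
  have h2 : 2 * (Q.h⁻¹ * (r * ‖Q.S.g a‖)) ≤ B := by linarith
  have h3 := mul_le_mul_of_nonneg_right h2 Q.h_pos.le
  have h4 : 2 * (Q.h⁻¹ * (r * ‖Q.S.g a‖)) * Q.h = 2 * r * ‖Q.S.g a‖ := by
    have := Q.h_pos.ne'
    field_simp
  linarith

theorem c_mul_mu_le_one (Q : SplitCell d) {y : Pt d} (hy : y ∈ Q.cell) (a : Fin (d + 1)) :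
    Q.S.c a * Q.mu a y ≤ 1 := by
  rw [← Q.sum_c_mul_mu y]
  exact Finset.single_le_sum (f := fun a => Q.S.c a * Q.mu a y)
    (fun e _ => mul_nonneg (Q.S.c_pos e).le (hy e)) (Finset.mem_univ a)

theorem mu_le_one_of_mem_piece (Q : SplitCell d) {y : Pt d} {a : Fin (d + 1)} (hy : y ∈ Q.piece a) :
    Q.mu a y ≤ 1 := by
  have h1 : ∑ e, Q.S.c e * Q.mu a y ≤ ∑ e, Q.S.c e * Q.mu e y :=
    Finset.sum_le_sum fun e _ => mul_le_mul_of_nonneg_left (hy.2 e) (Q.S.c_pos e).le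
  rwa [← Finset.sum_mul, Q.S.sum_c, one_mul, Q.sum_c_mul_mu] at h1

/-- Edges are at least as long as the diameters of inscribed balls. -/
theorem two_mul_radius_le_dist (hd : 0 < d) (Q : SplitCell d) {c : Pt d} {r : ℝ} (hr : 0 ≤ r)
    (hc : Metric.closedBall c r ⊆ Q.cell) {a b : Fin (d + 1)} (hab : a ≠ b) :
    2 * r ≤ dist (Q.x + Q.h • Q.S.v a) (Q.x + Q.h • Q.S.v b) := by
  have hca := Q.S.c_pos a
  have h1 := Q.two_mul_norm_g_le (a := a) hr (fun y hy => hc hy a) (B := (Q.S.c a)⁻¹)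
    fun y hy => by
      have := Q.c_mul_mu_le_one (hc hy) a
      rwa [← one_div, le_div_iff₀' hca]
  have h2 : inner ℝ (Q.S.g a) (Q.S.v a - Q.S.v b) = (Q.S.c a)⁻¹ := by
    rw [inner_sub_right, Q.S.inner_g_v, Q.S.inner_g_v, if_pos rfl, if_neg (Ne.symm hab)]
    ring
  have h3 : (Q.S.c a)⁻¹ ≤ ‖Q.S.g a‖ * ‖Q.S.v a - Q.S.v b‖ := h2 ▸ real_inner_le_norm _ _
  have hg : 0 < ‖Q.S.g a‖ := norm_pos_iff.2 (Q.g_ne_zero hd a)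
  rw [dist_add_left, dist_eq_norm, ← smul_sub, norm_smul, Real.norm_eq_abs, abs_of_pos Q.h_pos]
  have h4 : (Q.S.c a)⁻¹ * Q.h ≤ ‖Q.S.g a‖ * ‖Q.S.v a - Q.S.v b‖ * Q.h :=
    mul_le_mul_of_nonneg_right h3 Q.h_pos.le
  have h5 : 2 * r * ‖Q.S.g a‖ ≤ (Q.h * ‖Q.S.v a - Q.S.v b‖) * ‖Q.S.g a‖ := by linarith
  exact le_of_mul_le_mul_right h5 hg

/-- Each of the parts of the split cell contains a ball of radius `σ * h`. -/
def Regular (Q : SplitCell d) (σ : ℝ) : Prop :=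
  ∀ a, ∃ c, Metric.closedBall c (σ * Q.h) ⊆ Q.piece a

theorem Regular.polyBound_mu {Q : SplitCell d} {σ : ℝ} (hσ : 0 < σ) (hQ : Q.Regular σ)
    (a : Fin (d + 1)) : PolyBound 1 (1 + d / (2 * σ)) (Q.S.mu a) := by
  obtain ⟨c, hc⟩ := hQ a
  have h1 := Q.two_mul_norm_g_le (a := a) (B := 1) (mul_pos hσ Q.h_pos).le
    (fun y hy => (hc hy).1) (fun y hy => Q.mu_le_one_of_mem_piece (hc hy))
  have h2 : ‖Q.S.g a‖ ≤ 1 / (2 * σ) := by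
    rw [le_div_iff₀ (by positivity)]
    refine le_of_mul_le_mul_right ?_ Q.h_pos
    linarith
  have h3 : ∀ i, |Q.S.g a i| ≤ 1 / (2 * σ) := fun i =>
    (Real.norm_eq_abs _ ▸ PiLp.norm_apply_le (Q.S.g a) i).trans h2
  refine ((PolyBound.one le_rfl).add (PolyBound.sum (F := Finset.univ) fun i _ =>
    (PolyBound.X i).const_mul (h3 i))).mono le_rfl (le_of_eq ?_)
  simp
  ring

end SplitCell

end Geometry

section Mesh

variable {d : ℕ}

/-- `Q` describes the simplex with vertex set `K`, split at `x`, in coordinates scaled by its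
diameter; `e` enumerates the vertices. -/
structure SplitCell.Describes (Q : SplitCell d) (K : Finset (Pt d)) (x : Pt d)
    (e : Fin (d + 1) ≃ K) : Prop where
  x_eq : Q.x = x
  h_eq : Q.h = Metric.diam (hull K)
  vertex_eq : ∀ a, Q.x + Q.h • Q.S.v a = e a

/-- Every simplex of full dimension with a splitting point in its interior is a split cell. -/
theorem exists_describes (hd : 0 < d) {K : Finset (Pt d)}
    (hK : AffineIndependent ℝ ((↑) : K → Pt d)) (hc : K.card = d + 1) {x : Pt d}
    (hx : x ∈ interior (hull K)) : ∃ (Q : SplitCell d) (e : Fin (d + 1) ≃ K), Q.Describes K x e := by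
  have e : Fin (d + 1) ≃ K := (K.equivFinOfCardEq hc).symm
  have hK' : AffineIndependent ℝ fun a => (e a : Pt d) := hK.comp_embedding e.toEmbedding
  have ht : affineSpan ℝ (range fun a => (e a : Pt d)) = ⊤ := by
    rw [hK'.affineSpan_eq_top_iff_card_eq_finrank_add_one]
    simp
  have hr : range (fun a => (e a : Pt d)) = K := by
    rw [show (fun a => (e a : Pt d)) = Subtype.val ∘ e from rfl, e.surjective.range_comp]
    simp
  let b : AffineBasis (Fin (d + 1)) ℝ (Pt d) := ⟨fun a => (e a : Pt d), hK', ht⟩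
  have hx' : ∀ a, 0 < b.coord a x := by
    have h1 := b.interior_convexHull
    rw [show range b = K from hr] at h1
    rw [h1] at hx
    exact hx
  have hbK : ∀ a, b a ∈ hull K := fun a => subset_convexHull ℝ _ (e a).2
  have hbd := hull_isBounded K
  have hh : 0 < Metric.diam (hull K) := by
    have : Nontrivial (Fin (d + 1)) := Fin.nontrivial_iff_two_le.2 (by omega)
    obtain ⟨a, c, hac⟩ := exists_pair_ne (Fin (d + 1))
    exact (dist_pos.2 (b.ind.injective.ne hac)).trans_le
      (Metric.dist_le_diam_of_mem hbd (hbK a) (hbK c))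
  refine ⟨⟨SplitSimplex.ofAffineBasis b hx' hh fun a => ?_, x, _, hh⟩, e, rfl, rfl, fun a => ?_⟩
  · rw [← dist_eq_norm]
    exact Metric.dist_le_diam_of_mem hbd (hbK a) (interior_subset hx)
  · change x + Metric.diam (hull K) • ((Metric.diam (hull K))⁻¹ • (b a - x)) = e a
    rw [smul_inv_smul₀ hh.ne', add_sub_cancel]
    rfl

namespace SplitCell

namespace Describes

variable {Q : SplitCell d} {K : Finset (Pt d)} {x : Pt d} {e : Fin (d + 1) ≃ K}
  (hQ : Q.Describes K x e)
include hQ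

theorem cell_eq : Q.cell = hull K := by
  rw [cell_eq_convexHull, funext hQ.vertex_eq, show (fun a => (e a : Pt d)) = Subtype.val ∘ e from rfl,
    e.surjective.range_comp]
  simp

theorem piece_eq [DecidableEq (Pt d)] (a : Fin (d + 1)) :
    Q.piece a = hull (insert x (K.erase (e a))) := by
  rw [piece_eq_convexHull, funext hQ.vertex_eq, hQ.x_eq, hull, Finset.coe_insert, Finset.coe_erase]
  congr 2
  ext y
  constructor
  · rintro ⟨b, hb, rfl⟩
    exact ⟨(e b).2, fun h => hb (e.injective (Subtype.ext h))⟩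
  · rintro ⟨hy, hya⟩
    refine ⟨e.symm ⟨y, hy⟩, fun h => hya ?_, by simp⟩
    rw [mem_singleton_iff] at h
    simp [← h]

theorem openCell_eq (hd : 0 < d) : Q.openCell = interior (hull K) := by
  rw [Q.openCell_eq_interior hd, hQ.cell_eq]

end Describes

theorem openPiece_nonempty (Q : SplitCell d) (a : Fin (d + 1)) :
    (Q.openPiece a).Nonempty := by
  have hc := Q.S.c_pos a
  have h1 : ∀ b, Q.mu b ((1 + Q.S.c a / 2) • Q.x + (-(Q.S.c a / 2)) • (Q.x + Q.h • Q.S.v a)) =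
      (1 + Q.S.c a / 2) - if a = b then 1 / 2 else 0 := by
    intro b
    rw [Q.mu_convex_comb b _ _ (by ring), mu_center, mu_add_smul_v]
    split_ifs
    · field_simp
      ring
    · ring
  -- move from the splitting point away from the vertex `a`
  refine ⟨(1 + Q.S.c a / 2) • Q.x + (-(Q.S.c a / 2)) • (Q.x + Q.h • Q.S.v a), ?_, fun b hb => ?_⟩
  · rw [h1, if_pos rfl]
    linarith
  · rw [h1, h1, if_pos rfl, if_neg (Ne.symm hb)]
    linarith

end SplitCell

/-- A simplex with a bounded ratio of its diameter and its inscribed diameter contains a ball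
whose radius is comparable to its diameter. -/
theorem exists_closedBall_subset_hull (hd : 0 < d) {K : Finset (Pt d)}
    (hint : (interior (hull K)).Nonempty) {C : ℝ} (hC : 0 < C)
    (h : Metric.diam (hull K) / inscribedDiam K ≤ C) :
    ∃ c, Metric.closedBall c (Metric.diam (hull K) / (4 * C)) ⊆ hull K := by
  have : Nonempty (Fin d) := ⟨⟨0, hd⟩⟩
  let s : Set ℝ := {δ : ℝ | ∃ (c : Pt d) (r : ℝ), 0 ≤ r ∧ Metric.closedBall c r ⊆ hull K ∧ δ = 2 * r}
  have hs : BddAbove s := by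
    refine ⟨Metric.diam (hull K), ?_⟩
    rintro _ ⟨c, r, hr, hcr, rfl⟩
    rw [← Metric.diam_closedBall_eq c hr]
    exact Metric.diam_mono hcr (hull_isBounded K)
  obtain ⟨c, hc⟩ := hint
  obtain ⟨r, hr, hcr⟩ := Metric.nhds_basis_closedBall.mem_iff.1 (mem_interior_iff_mem_nhds.1 hc)
  have hrs : 2 * r ∈ s := ⟨c, r, hr.le, hcr, rfl⟩
  have hpos : 0 < inscribedDiam K := (by positivity : 0 < 2 * r).trans_le (le_csSup hs hrs)
  obtain ⟨_, ⟨c', r', hr', hcr', rfl⟩, hlt⟩ :=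
    exists_lt_of_lt_csSup ⟨_, hrs⟩ (show inscribedDiam K / 2 < sSup s from half_lt_self hpos)
  refine ⟨c', (Metric.closedBall_subset_closedBall ?_).trans hcr'⟩
  rw [div_le_iff₀ hpos] at h
  rw [div_le_iff₀ (by positivity)]
  nlinarith

/-- Shape regularity of the triangulations and of their refinements makes the split cells
uniformly regular. -/
theorem exists_forall_regular (hd : 2 ≤ d) {ι : Type*} {S S' : ι → Set (Finset (Pt d))}
    (hS : ShapeRegular S) (hS' : ShapeRegular S') :
    ∃ σ > 0, ∀ h, ∀ K ∈ S h, ∀ (Q : SplitCell d) (x : Pt d) (e : Fin (d + 1) ≃ K),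
      Q.Describes K x e → (∀ a, ∃ T ∈ S' h, Q.piece a = hull T) → Q.Regular σ := by
  obtain ⟨C, hC⟩ := hS
  obtain ⟨C', hC'⟩ := hS'
  have hd0 : 0 < d := by omega
  have hC1 : 0 < max C 1 := lt_max_of_lt_right one_pos
  have hC1' : 0 < max C' 1 := lt_max_of_lt_right one_pos
  refine ⟨1 / (8 * max C 1 * max C' 1), by positivity, fun h K hK Q x e hQ hT a => ?_⟩
  have hint : (interior (hull K)).Nonempty := by
    obtain ⟨y, hy⟩ := Q.openPiece_nonempty a
    exact ⟨y, hQ.openCell_eq hd0 ▸ Q.openPiece_subset_openCell a hy⟩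
  obtain ⟨c, hc⟩ := exists_closedBall_subset_hull hd0 hint hC1 ((hC h K hK).trans (le_max_left _ _))
  obtain ⟨T, hTS, hTa⟩ := hT a
  have hint' : (interior (hull T)).Nonempty := by
    rw [← hTa]
    exact (Q.openPiece_nonempty a).mono
      (interior_maximal (Q.openPiece_subset_piece a) (Q.isOpen_openPiece a))
  obtain ⟨c', hc'⟩ := exists_closedBall_subset_hull hd0 hint' hC1'
    ((hC' h T hTS).trans (le_max_left _ _))
  refine ⟨c', (Metric.closedBall_subset_closedBall ?_).trans (hc'.trans hTa.symm.subset)⟩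
  -- the part keeps an edge of the simplex
  obtain ⟨b, b', hba, hba', hbb⟩ : ∃ b b' : Fin (d + 1), b ≠ a ∧ b' ≠ a ∧ b ≠ b' := by
    have h3 : 2 < Fintype.card (Fin (d + 1)) := by simp; omega
    have h4 : 1 < (Finset.univ.erase a).card := by
      rw [Finset.card_erase_of_mem (Finset.mem_univ a), Finset.card_univ]
      omega
    obtain ⟨b, hb, b', hb', hne⟩ := Finset.one_lt_card.1 h4
    exact ⟨b, b', (Finset.mem_erase.1 hb).1, (Finset.mem_erase.1 hb').1, hne⟩
  have h1 := Q.two_mul_radius_le_dist hd0 (div_nonneg Metric.diam_nonneg (by positivity))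
    (hc.trans hQ.cell_eq.symm.subset) hbb
  have h2 := Metric.dist_le_diam_of_mem (Q.isCompact_piece a).isBounded (Q.vertex_mem_piece hba)
    (Q.vertex_mem_piece hba')
  rw [hTa] at h2
  rw [hQ.h_eq]
  have h3 := h1.trans h2
  rw [le_div_iff₀ (by positivity)]
  refine le_trans (le_of_eq ?_) h3
  field_simp
  ring

/-- A simplex with at most `d` vertices is a null set. -/
theorem volume_hull_eq_zero {s : Finset (Pt d)} (hs : s.card ≤ d) : volume (hull s) = 0 := by
  refine measure_mono_null (convexHull_subset_affineSpan _)
    (Measure.addHaar_affineSubspace volume _ fun htop => ?_)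
  rcases s.eq_empty_or_nonempty with rfl | hne
  · have h1 : (affineSpan ℝ ((∅ : Finset (Pt d)) : Set (Pt d)) : Set (Pt d)) = ∅ := by simp
    rw [htop] at h1
    exact (Set.univ_nonempty (α := Pt d)).ne_empty h1
  · obtain ⟨n, hn⟩ : ∃ n, s.card = n + 1 := ⟨s.card - 1, by have := hne.card_pos; omega⟩
    classical
    have h1 := finrank_vectorSpan_image_finset_le ℝ (id : Pt d → Pt d) s hn
    rw [Finset.image_id, ← direction_affineSpan, htop, AffineSubspace.direction_top, finrank_top,
      finrank_euclideanSpace_fin] at h1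
    omega

/-! ### Split meshes -/

/-- A family of split cells which covers `Ω` up to a null set, without overlaps. -/
structure IsSplitMesh {κ : Type*} (Q : κ → SplitCell d) (Ω : Set (Pt d)) : Prop where
  isOpen : IsOpen Ω
  isBounded : Bornology.IsBounded Ω
  openCell_subset : ∀ K, (Q K).openCell ⊆ Ω
  disjoint : ∀ K L, K ≠ L → Disjoint (Q K).openCell (Q L).openCell
  ae_cover : ∀ᵐ y ∂(volume.restrict Ω), ∃ K, y ∈ (Q K).cell

theorem IsPolytopeDomain.isOpen {Ω : Set (Pt d)} (hΩ : IsPolytopeDomain Ω) : IsOpen Ω := by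
  obtain ⟨-, P, -, rfl⟩ := hΩ
  exact isOpen_interior

theorem IsPolytopeDomain.interior_closure_subset {Ω : Set (Pt d)} (hΩ : IsPolytopeDomain Ω) :
    interior (closure Ω) ⊆ Ω := by
  obtain ⟨-, P, hP, h⟩ := hΩ
  have hcl : IsClosed (⋃ s ∈ P, convexHull ℝ (s : Set (Pt d))) :=
    hP.isClosed_biUnion fun s _ => s.finite_toSet.isClosed_convexHull ℝ
  have h1 : closure Ω ⊆ ⋃ s ∈ P, convexHull ℝ (s : Set (Pt d)) :=
    closure_minimal (h ▸ interior_subset) hcl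
  exact (interior_mono h1).trans h.symm.subset

theorem IsPolytopeDomain.isBounded {Ω : Set (Pt d)} (hΩ : IsPolytopeDomain Ω) :
    Bornology.IsBounded Ω := by
  obtain ⟨-, P, hP, rfl⟩ := hΩ
  refine Bornology.IsBounded.subset ?_ interior_subset
  exact (Bornology.isBounded_biUnion hP).2 fun s _ => hull_isBounded s

/-- The elements of a triangulation, described as split cells, form a split mesh. -/
theorem IsTriangulation.isSplitMesh (hd : 0 < d) {Ω : Set (Pt d)} (hΩ : IsPolytopeDomain Ω)
    {𝒯 : Geometry.SimplicialComplex ℝ (Pt d)} (h𝒯 : IsTriangulation 𝒯 Ω)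
    {Q : cells 𝒯 → SplitCell d} {x : Finset (Pt d) → Pt d}
    {e : ∀ K : cells 𝒯, Fin (d + 1) ≃ (K : Finset (Pt d))}
    (hQ : ∀ K, (Q K).Describes K (x K) (e K)) : IsSplitMesh Q Ω where
  isOpen := hΩ.isOpen
  isBounded := hΩ.isBounded
  openCell_subset K := by
    rw [(hQ K).openCell_eq hd]
    refine subset_trans (interior_mono ?_) hΩ.interior_closure_subset
    rw [← h𝒯.space_eq]
    exact Geometry.SimplicialComplex.convexHull_subset_space K.2.1
  disjoint K L hKL := by
    rw [(hQ K).openCell_eq hd, (hQ L).openCell_eq hd, Set.disjoint_iff_inter_eq_empty,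
      ← interior_inter]
    classical
    have h1 : hull (K : Finset (Pt d)) ∩ hull (L : Finset (Pt d)) ⊆
        hull ((K : Finset (Pt d)) ∩ L) := by
      rw [hull, hull, hull, Finset.coe_inter]
      exact 𝒯.inter_subset_convexHull K.2.1 L.2.1
    have h2 : ((K : Finset (Pt d)) ∩ L).card ≤ d := by
      by_contra! hlt
      have h3 : (K : Finset (Pt d)) ∩ L = K :=
        Finset.eq_of_subset_of_card_le Finset.inter_subset_left (by rw [K.2.2]; omega)
      have h4 : (K : Finset (Pt d)) ∩ L = L :=
        Finset.eq_of_subset_of_card_le Finset.inter_subset_right (by rw [L.2.2]; omega)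
      exact hKL (Subtype.ext (h3.symm.trans h4))
    exact (isOpen_interior.measure_eq_zero_iff volume).1
      (measure_mono_null (interior_subset.trans h1) (volume_hull_eq_zero h2))
  ae_cover := by
    have h1 : ∀ᵐ y ∂(volume : Measure (Pt d)), ∀ s ∈ 𝒯.faces, s.card ≤ d → y ∉ hull s := by
      refine (ae_ball_iff h𝒯.finite.countable).2 fun s _ => ?_
      by_cases hs : s.card ≤ d
      · filter_upwards [measure_eq_zero_iff_ae_notMem.1 (volume_hull_eq_zero hs)] with y hy _
        exact hy
      · exact Filter.Eventually.of_forall fun y h => absurd h hs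
    filter_upwards [ae_restrict_of_ae h1, ae_restrict_mem hΩ.isOpen.measurableSet] with y hy hyΩ
    have hys : y ∈ 𝒯.space := h𝒯.space_eq ▸ subset_closure hyΩ
    obtain ⟨s, hs, hys⟩ := Geometry.SimplicialComplex.mem_space_iff.1 hys
    have h2 : ¬ s.card ≤ d := fun hsd => hy s hs hsd hys
    have h3 : s.card ≤ d + 1 := by
      have h4 := (𝒯.indep hs).card_le_finrank_succ
      have h5 := Submodule.finrank_le (vectorSpan ℝ (range ((↑) : s → Pt d)))
      rw [finrank_euclideanSpace_fin] at h5
      rw [Fintype.card_coe] at h4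
      omega
    refine ⟨⟨s, hs, by omega⟩, ?_⟩
    rw [(hQ _).cell_eq]
    exact hys

end Mesh

/-! ### Assembling functions from the cells of a split mesh -/

section Assembly

open Filter Topology
open scoped NNReal

variable {d : ℕ}

theorem setIntegral_eq_sum_of_ae_cover {ι : Type*} [Fintype ι] {Ω : Set (Pt d)} {s : ι → Set (Pt d)}
    (hm : ∀ i, MeasurableSet (s i)) (hsub : ∀ i, s i ⊆ Ω)
    (hdisj : ∀ i j, i ≠ j → Disjoint (s i) (s j))
    (hcov : ∀ᵐ y ∂(volume.restrict Ω), ∃ i, y ∈ s i) {f : Pt d → ℝ}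
    (hf : Integrable f (volume.restrict Ω)) : ∫ y in Ω, f y = ∑ i, ∫ y in s i, f y := by
  have h1 : volume.restrict Ω = volume.restrict (⋃ i, s i) := by
    rw [← Measure.restrict_restrict_of_subset (iUnion_subset hsub)]
    refine (Measure.restrict_eq_self_of_ae_mem ?_).symm
    filter_upwards [hcov] with y hy using mem_iUnion.2 hy
  rw [h1, integral_iUnion_fintype hm (fun i j => hdisj i j) fun i =>
    IntegrableOn.mono_set (t := Ω) hf (hsub i)]

namespace SplitCell

theorem ae_mem_openPiece_of_mem_cell (hd : 0 < d) (Q : SplitCell d) :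
    ∀ᵐ y ∂(volume : Measure (Pt d)), y ∈ Q.cell → ∃ a, y ∈ Q.openPiece a := by
  filter_upwards [Q.ae_mem_openPiece hd] with y hy hyc
  obtain ⟨a, ha⟩ := Q.exists_mem_piece hyc
  exact ⟨a, hy a ha⟩

theorem setIntegral_openCell (hd : 0 < d) (Q : SplitCell d) {f : Pt d → ℝ}
    (hf : Integrable f (volume.restrict Q.openCell)) :
    ∫ y in Q.openCell, f y = ∑ a, ∫ y in Q.openPiece a, f y := by
  refine setIntegral_eq_sum_of_ae_cover (fun a => (Q.isOpen_openPiece a).measurableSet)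
    Q.openPiece_subset_openCell (fun a b h => Q.openPiece_disjoint h) ?_ hf
  filter_upwards [ae_restrict_of_ae (Q.ae_mem_openPiece_of_mem_cell hd),
    ae_restrict_mem Q.isOpen_openCell.measurableSet] with y hy hyc
  exact hy (Q.openCell_subset_cell hyc)

theorem isBounded_openCell (Q : SplitCell d) : Bornology.IsBounded Q.openCell :=
  Metric.isBounded_closedBall.subset (Q.openCell_subset_cell.trans Q.cell_subset_closedBall)

theorem measureReal_openCell_le (Q : SplitCell d) :
    volume.real Q.openCell ≤ volume.real (Metric.ball (0 : Pt d) 1) * Q.h ^ d := by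
  have h1 : volume.real (Metric.closedBall Q.x Q.h) =
      Q.h ^ d * volume.real (Metric.ball (0 : Pt d) 1) := by
    rw [Measure.addHaar_real_closedBall _ _ Q.h_pos.le, finrank_euclideanSpace_fin]
  rw [mul_comm, ← h1]
  exact measureReal_mono (Q.openCell_subset_cell.trans Q.cell_subset_closedBall)
    measure_closedBall_lt_top.ne

/-- The divergence theorem for bubbles: their derivatives have zero mean on the cell. -/
theorem IsBubble.sum_setIntegral_pderiv (hd : 0 < d) {Q : SplitCell d}
    {V : Fin (d + 1) → MvPolynomial (Fin d) ℝ} (hV : Q.IsBubble V) (i : Fin d) :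
    ∑ a, ∫ y in Q.openPiece a, Q.h⁻¹ * sev Q.x Q.h (MvPolynomial.pderiv i (V a)) y = 0 := by
  obtain ⟨L, hL⟩ := hV.exists_lipschitzWith
  have := isFiniteMeasure_restrict_of_isBounded Q.isBounded_openCell
  rw [← integral_lineDeriv_eq_zero hL hV.hasCompactSupport (stdVec i),
    ← setIntegral_eq_integral_of_ae_compl_eq_zero (s := Q.openCell),
    Q.setIntegral_openCell hd ((memLp_two_lineDeriv hL (stdVec i)).integrable (by norm_num))]
  · refine Finset.sum_congr rfl fun a _ => ?_
    refine setIntegral_congr_fun (Q.isOpen_openPiece a).measurableSet fun y hy => ?_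
    have h1 : Q.bubble V =ᶠ[𝓝 y] sev Q.x Q.h (V a) := by
      filter_upwards [(Q.isOpen_openPiece a).mem_nhds hy] with z hz
      exact hV.bubble_eq (Q.openPiece_subset_piece a hz)
    have h2 : lineDeriv ℝ (Q.bubble V) y (stdVec i) = lineDeriv ℝ (sev Q.x Q.h (V a)) y (stdVec i) :=
      h1.lineDeriv_eq
    rw [h2, ← partialDeriv_sev,
      ((contDiff_sev Q.x Q.h (V a)).differentiable (by simp) y).lineDeriv_eq_fderiv]
    rfl
  · filter_upwards [Q.ae_mem_openPiece_of_mem_cell hd] with y hy hyc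
    have h3 : y ∈ Q.cellᶜ := fun h =>
      (hy h).elim fun a ha => hyc (Q.openPiece_subset_openCell a ha)
    have hcl : IsClosed Q.cell := by
      have : Q.cell = ⋂ e, {y | 0 ≤ Q.mu e y} := by
        ext y
        simp [cell]
      rw [this]
      exact isClosed_iInter fun e => isClosed_le continuous_const (Q.continuous_mu e)
    have h1 : Q.bubble V =ᶠ[𝓝 y] fun _ => 0 := by
      filter_upwards [hcl.isOpen_compl.mem_nhds h3] with z hz
      exact hV.bubble_eq_zero fun h => hz (Q.openCell_subset_cell h)
    have h2 : lineDeriv ℝ (Q.bubble V) y (stdVec i) = lineDeriv ℝ (fun _ => (0 : ℝ)) y (stdVec i) :=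
      h1.lineDeriv_eq
    rw [h2]
    simp [lineDeriv]

end SplitCell

namespace IsSplitMesh

variable {κ : Type*} {Q : κ → SplitCell d} {Ω : Set (Pt d)} (hQ : IsSplitMesh Q Ω)
include hQ

theorem openPiece_subset (K : κ) (a : Fin (d + 1)) : (Q K).openPiece a ⊆ Ω :=
  ((Q K).openPiece_subset_openCell a).trans (hQ.openCell_subset K)

theorem isFiniteMeasure_restrict : IsFiniteMeasure (volume.restrict Ω) :=
  isFiniteMeasure_restrict_of_isBounded hQ.isBounded

theorem ae_restrict_openPiece {P : Pt d → Prop} {K : κ} {a : Fin (d + 1)}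
    (h : ∀ᵐ y ∂(volume.restrict Ω), y ∈ (Q K).piece a → P y) :
    ∀ᵐ y ∂(volume.restrict ((Q K).openPiece a)), P y := by
  filter_upwards [ae_restrict_of_ae_restrict_of_subset (hQ.openPiece_subset K a) h,
    ae_restrict_mem ((Q K).isOpen_openPiece a).measurableSet] with y hy hya
  exact hy ((Q K).openPiece_subset_piece a hya)

variable [Fintype κ]

theorem ae_exists_mem_openPiece (hd : 0 < d) :
    ∀ᵐ y ∂(volume.restrict Ω), ∃ K a, y ∈ (Q K).openPiece a := by
  filter_upwards [hQ.ae_cover, ae_restrict_of_ae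
    (ae_all_iff.2 fun K => (Q K).ae_mem_openPiece_of_mem_cell hd)] with y ⟨K, hK⟩ hy
  exact ⟨K, hy K hK⟩

theorem setIntegral_eq_sum (hd : 0 < d) {f : Pt d → ℝ} (hf : Integrable f (volume.restrict Ω)) :
    ∫ y in Ω, f y = ∑ K, ∫ y in (Q K).openCell, f y := by
  refine setIntegral_eq_sum_of_ae_cover (fun K => (Q K).isOpen_openCell.measurableSet)
    hQ.openCell_subset hQ.disjoint ?_ hf
  filter_upwards [hQ.ae_exists_mem_openPiece hd] with y ⟨K, a, h⟩
  exact ⟨K, (Q K).openPiece_subset_openCell a h⟩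

theorem setIntegral_eq_sum_sum (hd : 0 < d) {f : Pt d → ℝ}
    (hf : Integrable f (volume.restrict Ω)) :
    ∫ y in Ω, f y = ∑ K, ∑ a, ∫ y in (Q K).openPiece a, f y := by
  rw [hQ.setIntegral_eq_sum hd hf]
  exact Finset.sum_congr rfl fun K _ => (Q K).setIntegral_openCell hd
    (IntegrableOn.mono_set (t := Ω) hf (hQ.openCell_subset K))

theorem norm_sq_eq_sum (hd : 0 < d) (w : L2 Ω) :
    ‖w‖ ^ 2 = ∑ K, ∑ a, ∫ y in (Q K).openPiece a, w y ^ 2 := by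
  rw [norm_sq_eq_integral, hQ.setIntegral_eq_sum_sum hd (Lp.memLp w).integrable_sq]

/-- A bound for the `L²` norm from bounds for the values on the cells. -/
theorem norm_sq_le_of_ae_bound (hd : 0 < d) {w : L2 Ω} {B : κ → ℝ}
    (h : ∀ K a, ∀ᵐ y ∂(volume.restrict Ω), y ∈ (Q K).piece a → |w y| ≤ B K) :
    ‖w‖ ^ 2 ≤ volume.real (Metric.ball (0 : Pt d) 1) * ∑ K, B K ^ 2 * (Q K).h ^ d := by
  rw [norm_sq_eq_integral, hQ.setIntegral_eq_sum hd (Lp.memLp w).integrable_sq, Finset.mul_sum]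
  refine Finset.sum_le_sum fun K _ => ?_
  have := isFiniteMeasure_restrict_of_isBounded (Q K).isBounded_openCell
  have h1 : ∫ y in (Q K).openCell, w y ^ 2 ≤ ∫ y in (Q K).openCell, B K ^ 2 := by
    refine integral_mono_ae (IntegrableOn.mono_set (t := Ω) (Lp.memLp w).integrable_sq
      (hQ.openCell_subset K)) (integrable_const _) ?_
    filter_upwards [ae_restrict_of_ae_restrict_of_subset (hQ.openCell_subset K)
      (ae_all_iff.2 fun a => h K a), ae_restrict_mem (Q K).isOpen_openCell.measurableSet]
      with y hy hyc
    obtain ⟨a, ha⟩ := (Q K).exists_mem_piece ((Q K).openCell_subset_cell hyc)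
    exact sq_le_sq.2 ((hy a ha).trans (le_abs_self _))
  refine h1.trans ?_
  rw [setIntegral_const, smul_eq_mul]
  have h2 := mul_le_mul_of_nonneg_right (Q K).measureReal_openCell_le (sq_nonneg (B K))
  linarith

omit [Fintype κ] in
theorem weakPartial_ae_eq {u : L2 Ω} (hu : MemH1 Ω u) (hd : 0 < d) {K : κ} {a : Fin (d + 1)}
    {p : MvPolynomial (Fin d) ℝ}
    (h : ∀ᵐ y ∂(volume.restrict Ω), y ∈ (Q K).piece a → u y = sev (Q K).x (Q K).h p y)
    (i : Fin d) : ∀ᵐ y ∂(volume.restrict Ω), y ∈ (Q K).piece a →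
      weakPartial i u y = (Q K).h⁻¹ * sev (Q K).x (Q K).h (MvPolynomial.pderiv i p) y := by
  have h1 := (isWeakPartial_weakPartial hu i).ae_eq_partialDeriv ((Q K).isOpen_openPiece a)
    (hQ.openPiece_subset K a) (contDiff_sev (Q K).x (Q K).h p) (by
      filter_upwards [h] with y hy hya using hy ((Q K).openPiece_subset_piece a hya))
  filter_upwards [h1, ae_restrict_of_ae ((Q K).ae_mem_openPiece hd)] with y hy hya hyp
  rw [hy (hya a hyp), partialDeriv_sev]

omit hQ in
theorem exists_lipschitzWith_sum {F : κ → Pt d → ℝ} (h : ∀ K, ∃ L, LipschitzWith L (F K)) :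
    ∃ L, LipschitzWith L fun y => ∑ K, F K y := by
  classical
  choose L hL using h
  have : ∀ s : Finset κ, LipschitzWith (∑ K ∈ s, L K) fun y => ∑ K ∈ s, F K y := by
    intro s
    induction s using Finset.induction_on with
    | empty => simp
    | insert K s hK ih =>
      simp only [Finset.sum_insert hK]
      exact (hL K).add ih
  exact ⟨_, this Finset.univ⟩

/-- Bubbles on the cells, added up, give a function in `H¹₀(Ω)`. -/
theorem exists_sum_bubble (hd : 0 < d) {V : κ → Fin (d + 1) → MvPolynomial (Fin d) ℝ}
    (hV : ∀ K, (Q K).IsBubble (V K)) :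
    ∃ u : L2 Ω, MemH10 Ω u ∧ ∀ K a, ∀ᵐ y ∂(volume.restrict Ω), y ∈ (Q K).piece a →
      u y = sev (Q K).x (Q K).h (V K a) y := by
  have := hQ.isFiniteMeasure_restrict
  let F : Pt d → ℝ := fun y => ∑ K, (Q K).bubble (V K) y
  obtain ⟨L, hL⟩ : ∃ L, LipschitzWith L F :=
    exists_lipschitzWith_sum fun K => (hV K).exists_lipschitzWith
  have h0 : ∀ y ∉ Ω, F y = 0 := fun y hy =>
    Finset.sum_eq_zero fun K _ => (hV K).bubble_eq_zero fun h => hy (hQ.openCell_subset K h)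
  have hc : HasCompactSupport F := HasCompactSupport.intro hQ.isBounded.isCompact_closure
    fun y hy => h0 y fun h => hy (subset_closure h)
  have hm : MemLp F 2 (volume.restrict Ω) :=
    (hL.continuous.memLp_of_hasCompactSupport hc).restrict Ω
  refine ⟨hm.toLp F, memH10_of_lipschitz hQ.isOpen hL hc h0 hm, fun K a => ?_⟩
  filter_upwards [hm.coeFn_toLp, ae_restrict_of_ae ((Q K).ae_mem_openPiece hd)] with y hy hya hyp
  have hyc := (Q K).openPiece_subset_openCell a (hya a hyp)
  rw [hy, ← (hV K).bubble_eq hyp]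
  exact Finset.sum_eq_single K (fun L' _ hL' => (hV L').bubble_eq_zero fun h =>
    Set.disjoint_left.1 (hQ.disjoint L' K hL') h hyc) fun h => absurd (Finset.mem_univ K) h

omit [Fintype κ] in
/-- The derivatives of a sum of bubbles have zero mean on each cell. -/
theorem setIntegral_weakPartial_eq_zero (hd : 0 < d)
    {V : κ → Fin (d + 1) → MvPolynomial (Fin d) ℝ}
    (hV : ∀ K, (Q K).IsBubble (V K)) {u : L2 Ω} (hu : MemH1 Ω u)
    (h : ∀ K a, ∀ᵐ y ∂(volume.restrict Ω), y ∈ (Q K).piece a →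
      u y = sev (Q K).x (Q K).h (V K a) y) (i : Fin d) (K : κ) :
    ∫ y in (Q K).openCell, weakPartial i u y = 0 := by
  have := hQ.isFiniteMeasure_restrict
  rw [(Q K).setIntegral_openCell hd (IntegrableOn.mono_set (t := Ω)
    ((Lp.memLp (weakPartial i u)).integrable (by norm_num)) (hQ.openCell_subset K)),
    ← (hV K).sum_setIntegral_pderiv hd i]
  exact Finset.sum_congr rfl fun a _ =>
    integral_congr_ae (hQ.ae_restrict_openPiece (hQ.weakPartial_ae_eq hu hd (h K a) i))

/-- A bound for the `H¹` norm of a piecewise polynomial from bounds for its coefficients. -/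
theorem h1Norm_sq_le (hd : 0 < d) {D : ℝ} (hD : ∀ K, (Q K).h ≤ D) {k : ℕ}
    {V : κ → Fin (d + 1) → MvPolynomial (Fin d) ℝ} {N : κ → ℝ}
    (hN : ∀ K a, PolyBound k ((Q K).h * N K) (V K a)) {u : L2 Ω} (hu : MemH1 Ω u)
    (h : ∀ K a, ∀ᵐ y ∂(volume.restrict Ω), y ∈ (Q K).piece a →
      u y = sev (Q K).x (Q K).h (V K a) y) :
    h1Norm u ^ 2 ≤ volume.real (Metric.ball (0 : Pt d) 1) * (D ^ 2 + d * (k + 1) ^ 2) *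
      ∑ K, N K ^ 2 * (Q K).h ^ d := by
  have hw : 0 ≤ volume.real (Metric.ball (0 : Pt d) 1) := measureReal_nonneg
  have h1 : ‖u‖ ^ 2 ≤ volume.real (Metric.ball (0 : Pt d) 1) *
      ∑ K, (D * N K) ^ 2 * (Q K).h ^ d := by
    refine hQ.norm_sq_le_of_ae_bound hd fun K a => ?_
    filter_upwards [h K a] with y hy hya
    rw [hy hya]
    refine (abs_sev_le (Q K).h_pos _ ((Q K).norm_sub_le ((Q K).piece_subset_cell a hya))).trans
      ((hN K a).norm.trans ?_)
    exact mul_le_mul_of_nonneg_right (hD K)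
      (nonneg_of_mul_nonneg_right (hN K a).nonneg (Q K).h_pos)
  have h2 : ∀ i, ‖weakPartial i u‖ ^ 2 ≤ volume.real (Metric.ball (0 : Pt d) 1) *
      ∑ K, ((k + 1) * N K) ^ 2 * (Q K).h ^ d := by
    intro i
    refine hQ.norm_sq_le_of_ae_bound hd fun K a => ?_
    filter_upwards [hQ.weakPartial_ae_eq hu hd (h K a) i] with y hy hya
    have hh := (Q K).h_pos
    rw [hy hya, abs_mul, abs_of_pos (inv_pos.2 hh), inv_mul_le_iff₀ hh]
    refine (abs_sev_le hh _ ((Q K).norm_sub_le ((Q K).piece_subset_cell a hya))).trans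
      (((((hN K a).mono (Nat.le_succ k) le_rfl).pderiv i).norm).trans (le_of_eq ?_))
    ring
  rw [h1Norm_sq]
  refine (add_le_add h1 (Finset.sum_le_sum fun i _ => h2 i)).trans (le_of_eq ?_)
  simp only [mul_pow, mul_assoc, ← Finset.mul_sum, Finset.sum_const, Finset.card_univ,
    Fintype.card_fin, nsmul_eq_mul]
  ring

end IsSplitMesh

/-- On regular cells, the coefficients of a polynomial on one of the parts are controlled by its
`L²` norm. -/
theorem exists_coefNorm_sq_le_setIntegral_openPiece (hd : 0 < d) (m : ℕ) {σ : ℝ} (hσ : 0 < σ) :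
    ∃ C : ℝ, 0 < C ∧ ∀ (Q : SplitCell d), Q.Regular σ → ∀ a (p : MvPolynomial (Fin d) ℝ),
      p.totalDegree ≤ m →
      coefNorm p ^ 2 * Q.h ^ d ≤ C * ∫ y in Q.openPiece a, sev Q.x Q.h p y ^ 2 := by
  obtain ⟨C, hC, H⟩ := exists_coefNorm_sq_le_setIntegral_ball d m hσ
  refine ⟨C, hC, fun Q hQ a p hp => ?_⟩
  obtain ⟨c, hc⟩ := hQ a
  have hcm : c ∈ Q.piece a := hc (Metric.mem_closedBall_self (mul_pos hσ Q.h_pos).le)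
  refine (H p Q.x c Q.h (σ * Q.h) hp Q.h_pos le_rfl
    (Q.norm_sub_le (Q.piece_subset_cell a hcm))).trans (mul_le_mul_of_nonneg_left ?_ hC.le)
  refine setIntegral_mono_set ?_ (Eventually.of_forall fun y => sq_nonneg _) ?_
  · have h1 : Continuous fun y => sev Q.x Q.h p y ^ 2 := (contDiff_sev _ _ _).continuous.pow 2
    exact (h1.continuousOn.integrableOn_compact (Q.isCompact_piece a)).mono_set
      (Q.openPiece_subset_piece a)
  · filter_upwards [Q.ae_mem_openPiece hd] with y hy hyb
    exact hy a (hc (Metric.ball_subset_closedBall hyb))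

end Assembly

/-! ### Right inverse of the divergence on the refined mesh -/

section Divergence

open Filter Topology

variable {d : ℕ}

/-- On a regular mesh, the coefficients of a piecewise polynomial are controlled by its `L²`
norm. -/
theorem exists_sum_coefNorm_sq_le (hd : 0 < d) (m : ℕ) {σ : ℝ} (hσ : 0 < σ) :
    ∃ C : ℝ, 0 < C ∧ ∀ {κ : Type} [Fintype κ] {Q : κ → SplitCell d} {Ω : Set (Pt d)},
      IsSplitMesh Q Ω → (∀ K, (Q K).Regular σ) →
      ∀ (q : L2 Ω) (p : κ → Fin (d + 1) → MvPolynomial (Fin d) ℝ),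
      (∀ K a, (p K a).totalDegree ≤ m) →
      (∀ K a, ∀ᵐ y ∂(volume.restrict Ω), y ∈ (Q K).piece a →
        q y = sev (Q K).x (Q K).h (p K a) y) →
      ∑ K, (∑ a, coefNorm (p K a)) ^ 2 * (Q K).h ^ d ≤ C * ‖q‖ ^ 2 := by
  obtain ⟨C, hC, H⟩ := exists_coefNorm_sq_le_setIntegral_openPiece hd m hσ
  refine ⟨(d + 1) * C, by positivity, fun {κ _ Q Ω} hQ hreg q p hp hq => ?_⟩
  rw [hQ.norm_sq_eq_sum hd, Finset.mul_sum]
  refine Finset.sum_le_sum fun K _ => ?_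
  have h1 : (∑ a, coefNorm (p K a)) ^ 2 ≤ (d + 1) * ∑ a, coefNorm (p K a) ^ 2 := by
    simpa using sq_sum_le_card_mul_sum_sq (s := Finset.univ) (f := fun a => coefNorm (p K a))
  have h2 := mul_le_mul_of_nonneg_right h1 (pow_pos (Q K).h_pos d).le
  refine h2.trans ?_
  rw [mul_assoc, mul_assoc, Finset.sum_mul, Finset.mul_sum (a := C)]
  refine mul_le_mul_of_nonneg_left (Finset.sum_le_sum fun a _ => ?_) (by positivity)
  refine (H (Q K) (hreg K) a (p K a) (hp K a)).trans (le_of_eq ?_)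
  congr 1
  refine integral_congr_ae ?_
  filter_upwards [hQ.ae_restrict_openPiece (hq K a)] with y hy
  rw [hy]

theorem ae_wdiv_eq {Ω : Set (Pt d)} (v : Fin d → L2 Ω) :
    ∀ᵐ y ∂(volume.restrict Ω), wdiv v y = ∑ i, weakPartial i (v i) y := by
  have h := Lp.coeFn_finsetSum (μ := volume.restrict Ω) Finset.univ fun i => weakPartial i (v i)
  filter_upwards [h] with y hy
  rw [wdiv, hy, Finset.sum_apply]

theorem SplitCell.integrableOn_openPiece (Q : SplitCell d) (a : Fin (d + 1)) {f : Pt d → ℝ}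
    (hf : Continuous f) : IntegrableOn f (Q.openPiece a) :=
  (hf.continuousOn.integrableOn_compact (Q.isCompact_piece a)).mono_set (Q.openPiece_subset_piece a)

theorem SplitCell.sum_setIntegral_mu_pow_pos (Q : SplitCell d) (m : ℕ) :
    0 < ∑ a, ∫ y in Q.openPiece a, Q.mu a y ^ m := by
  refine Finset.sum_pos (fun a _ => ?_) Finset.univ_nonempty
  have hc : Continuous fun y => Q.mu a y ^ m := (Q.continuous_mu a).pow m
  have hs : MeasurableSet (Q.openPiece a) := (Q.isOpen_openPiece a).measurableSet
  rw [setIntegral_pos_iff_support_of_nonneg_ae]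
  · have h1 : Q.openPiece a ⊆ Function.support (fun y => Q.mu a y ^ m) ∩ Q.openPiece a :=
      fun y hy => ⟨(pow_pos hy.1 m).ne', hy⟩
    exact ((Q.isOpen_openPiece a).measure_pos volume (Q.openPiece_nonempty a)).trans_le
      (measure_mono h1)
  · filter_upwards [ae_restrict_mem hs] with y hy
    exact pow_nonneg hy.1.le m
  · exact Q.integrableOn_openPiece a hc

/-- Every piecewise polynomial with zero mean on the cells of the unrefined mesh is the divergence
of a field in the velocity space of the refined mesh, with a bound for its norm. -/
theorem exists_wdiv_eq (hd : 0 < d) (m : ℕ) {σ : ℝ} (hσ : 0 < σ) (D : ℝ) :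
    ∃ C : ℝ, 0 ≤ C ∧ ∀ {κ : Type} [Fintype κ] {Q : κ → SplitCell d} {Ω : Set (Pt d)},
      IsSplitMesh Q Ω → (∀ K, (Q K).Regular σ) → (∀ K, (Q K).h ≤ D) →
      ∀ q : L2 Ω, (∀ K a, ∃ p : MvPolynomial (Fin d) ℝ, p.totalDegree ≤ m ∧
        ∀ᵐ y ∂(volume.restrict Ω), y ∈ (Q K).piece a → q y = sev (Q K).x (Q K).h p y) →
      (∀ K, ∫ y in (Q K).openCell, q y = 0) →
      ∃ v : Fin d → L2 Ω, (∀ j, MemH10 Ω (v j)) ∧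
        (∀ j K a, ∃ p : MvPolynomial (Fin d) ℝ, p.totalDegree ≤ m + 1 ∧
          ∀ᵐ y ∂(volume.restrict Ω), y ∈ (Q K).piece a → v j y = sev (Q K).x (Q K).h p y) ∧
        wdiv v = q ∧ vecH1Norm v ^ 2 ≤ C * ‖q‖ ^ 2 := by
  have hA : (1 : ℝ) ≤ 1 + d / (2 * σ) := le_add_of_nonneg_right (by positivity)
  obtain ⟨B, hB, H⟩ := SplitSimplex.exists_div_eq d m hA 0
  obtain ⟨C₁, hC₁, H₁⟩ := exists_sum_coefNorm_sq_le hd m hσ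
  refine ⟨d * (volume.real (Metric.ball (0 : Pt d) 1) * (D ^ 2 + d * ((m + 1 : ℕ) + 1) ^ 2) *
    (B ^ 2 * C₁)), by positivity, fun {κ _ Q Ω} hQ hreg hD q hq hq0 => ?_⟩
  choose p hp hqp using hq
  let M : κ → ℝ := fun K => ∑ a, coefNorm (p K a)
  have hpM : ∀ K a, PolyBound m (M K) (p K a) := fun K a => ⟨hp K a,
    Finset.single_le_sum (f := fun a => coefNorm (p K a)) (fun _ _ => coefNorm_nonneg _)
      (Finset.mem_univ a)⟩
  choose V c hVb hVc hV0 hVd using fun K => H (Q K).S (fun a => (hreg K).polyBound_mu hσ a)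
    (M K) (p K) (hpM K)
  simp only [zero_add, pow_zero, one_mul] at hVb hVd
  -- undo the scaling of the derivatives
  let W : κ → Fin d → Fin (d + 1) → MvPolynomial (Fin d) ℝ :=
    fun K i a => MvPolynomial.C (Q K).h * V K a i
  have hsev : ∀ K i a y, sev (Q K).x (Q K).h (W K i a) y =
      (Q K).h * sev (Q K).x (Q K).h (V K a i) y := fun K i a y => by
    simp only [sev, W, pev_mul, pev_C]
  have hW : ∀ K i, (Q K).IsBubble (W K i) := by
    intro K i
    constructor
    · intro a b y ha hb
      rw [hsev, hsev]
      have h1 : (Q K).mu a y = (Q K).mu b y := le_antisymm (ha.2 b) (hb.2 a)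
      congr 1
      exact hVc K a b _ h1 i
    · intro a y _ h0
      rw [hsev]
      have h1 : sev (Q K).x (Q K).h (V K a i) y = 0 := hV0 K a _ h0 i
      rw [h1, mul_zero]
  have hWb : ∀ i K a, PolyBound (m + 1) ((Q K).h * (B * M K)) (W K i a) := fun i K a =>
    (hVb K a i).const_mul (abs_of_pos (Q K).h_pos).le
  have hdiv : ∀ K a y, ∑ i, (Q K).h⁻¹ * sev (Q K).x (Q K).h (MvPolynomial.pderiv i (W K i a)) y =
      sev (Q K).x (Q K).h (p K a) y - c K * (Q K).mu a y ^ m := by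
    intro K a y
    have h1 : ∀ i, (Q K).h⁻¹ * sev (Q K).x (Q K).h (MvPolynomial.pderiv i (W K i a)) y =
        pev (MvPolynomial.pderiv i (V K a i)) ((Q K).h⁻¹ • (y - (Q K).x)) := by
      intro i
      simp only [W, sev, MvPolynomial.pderiv_C_mul, pev_mul, pev_C]
      rw [← mul_assoc, inv_mul_cancel₀ (Q K).h_pos.ne', one_mul]
    simp only [h1]
    rw [← pev_sum, hVd K a]
    simp only [pev_sub, pev_mul, pev_C, pev_pow]
    rfl
  -- the mean value condition eliminates the remainder term
  have hc : ∀ K, c K = 0 := by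
    intro K
    have e1 : ∑ a, ∫ y in (Q K).openPiece a,
        (sev (Q K).x (Q K).h (p K a) y - c K * (Q K).mu a y ^ m) = 0 := by
      simp only [← hdiv]
      have h1 : ∀ a, ∫ y in (Q K).openPiece a, ∑ i, (Q K).h⁻¹ *
          sev (Q K).x (Q K).h (MvPolynomial.pderiv i (W K i a)) y =
          ∑ i, ∫ y in (Q K).openPiece a, (Q K).h⁻¹ *
          sev (Q K).x (Q K).h (MvPolynomial.pderiv i (W K i a)) y := fun a =>
        integral_finsetSum _ fun i _ => (Q K).integrableOn_openPiece a
          (continuous_const.mul (contDiff_sev _ _ _).continuous)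
      simp only [h1]
      rw [Finset.sum_comm]
      exact Finset.sum_eq_zero fun i _ => (hW K i).sum_setIntegral_pderiv hd i
    have e2 : ∑ a, ∫ y in (Q K).openPiece a, sev (Q K).x (Q K).h (p K a) y = 0 := by
      have := hQ.isFiniteMeasure_restrict
      rw [← hq0 K, (Q K).setIntegral_openCell hd (IntegrableOn.mono_set (t := Ω)
        ((Lp.memLp q).integrable (by norm_num)) (hQ.openCell_subset K))]
      refine Finset.sum_congr rfl fun a _ => integral_congr_ae ?_
      filter_upwards [hQ.ae_restrict_openPiece (hqp K a)] with y hy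
      rw [hy]
    have e3 : ∀ a, ∫ y in (Q K).openPiece a,
        (sev (Q K).x (Q K).h (p K a) y - c K * (Q K).mu a y ^ m) =
        (∫ y in (Q K).openPiece a, sev (Q K).x (Q K).h (p K a) y) -
          c K * ∫ y in (Q K).openPiece a, (Q K).mu a y ^ m := by
      intro a
      have i1 : IntegrableOn (fun y => c K * (Q K).mu a y ^ m) ((Q K).openPiece a) :=
        (Q K).integrableOn_openPiece a (continuous_const.mul (((Q K).continuous_mu a).pow m))
      rw [integral_sub ((Q K).integrableOn_openPiece a (contDiff_sev _ _ _).continuous) i1,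
        integral_const_mul]
    simp only [e3, Finset.sum_sub_distrib, e2, ← Finset.mul_sum, zero_sub, neg_eq_zero] at e1
    exact (mul_eq_zero.1 e1).resolve_right ((Q K).sum_setIntegral_mu_pow_pos m).ne'
  choose v hv hvW using fun i => hQ.exists_sum_bubble hd fun K => hW K i
  refine ⟨v, hv, fun j K a => ⟨W K j a, (hWb j K a).deg, hvW j K a⟩, ?_, ?_⟩
  · apply Lp.ext
    have h1 := fun K a i => hQ.weakPartial_ae_eq (hv i).1 hd (hvW i K a) i
    filter_upwards [ae_wdiv_eq v, hQ.ae_exists_mem_openPiece hd,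
      ae_all_iff.2 fun K => ae_all_iff.2 fun a => ae_all_iff.2 (h1 K a),
      ae_all_iff.2 fun K => ae_all_iff.2 (hqp K)] with y hy ⟨K, a, hya⟩ h2 h3
    have hya' := (Q K).openPiece_subset_piece a hya
    rw [hy, h3 K a hya', Finset.sum_congr rfl fun i _ => h2 K a i hya', hdiv, hc K, zero_mul,
      sub_zero]
  · have h1 : ∀ j, h1Norm (v j) ^ 2 ≤ volume.real (Metric.ball (0 : Pt d) 1) *
        (D ^ 2 + d * ((m + 1 : ℕ) + 1) ^ 2) * (B ^ 2 * C₁) * ‖q‖ ^ 2 := by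
      intro j
      refine (hQ.h1Norm_sq_le hd hD (hWb j) (hv j).1 (hvW j)).trans ?_
      rw [mul_assoc _ (B ^ 2 * C₁), mul_assoc (B ^ 2)]
      refine mul_le_mul_of_nonneg_left ?_ (by positivity)
      simp only [mul_pow, mul_assoc, ← Finset.mul_sum]
      exact mul_le_mul_of_nonneg_left (H₁ hQ hreg q p hp hqp) (sq_nonneg B)
    rw [vecH1Norm_sq]
    refine (Finset.sum_le_sum fun j _ => h1 j).trans (le_of_eq ?_)
    rw [Finset.sum_const, Finset.card_univ, Fintype.card_fin, nsmul_eq_mul]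
    ring

end Divergence

/-! ### Stability of the refined pair from stability of the unrefined one -/

section FineFromCoarse

open Filter Topology

variable {d : ℕ}

/-- `u` is a polynomial of degree at most `m` on each of the cells. -/
def PiecewisePoly {κ : Type*} (Q : κ → SplitCell d) {Ω : Set (Pt d)} (m : ℕ) (u : L2 Ω) : Prop :=
  ∀ K, ∃ p : MvPolynomial (Fin d) ℝ, p.totalDegree ≤ m ∧
    ∀ᵐ y ∂(volume.restrict Ω), y ∈ (Q K).cell → u y = sev (Q K).x (Q K).h p y

/-- `u` is a polynomial of degree at most `m` on each of the parts of the split cells. -/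
def RefinedPiecewisePoly {κ : Type*} (Q : κ → SplitCell d) {Ω : Set (Pt d)} (m : ℕ) (u : L2 Ω) :
    Prop :=
  ∀ K a, ∃ p : MvPolynomial (Fin d) ℝ, p.totalDegree ≤ m ∧
    ∀ᵐ y ∂(volume.restrict Ω), y ∈ (Q K).piece a → u y = sev (Q K).x (Q K).h p y

section PiecewisePoly

variable {κ : Type*} {Q : κ → SplitCell d} {Ω : Set (Pt d)} {m : ℕ} {u w : L2 Ω}

theorem PiecewisePoly.refined (hu : PiecewisePoly Q m u) : RefinedPiecewisePoly Q m u := by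
  intro K a
  obtain ⟨p, hp, h⟩ := hu K
  refine ⟨p, hp, ?_⟩
  filter_upwards [h] with y hy hya using hy ((Q K).piece_subset_cell a hya)

theorem PiecewisePoly.mono (hu : PiecewisePoly Q m u) {n : ℕ} (hmn : m ≤ n) :
    PiecewisePoly Q n u := fun K =>
  let ⟨p, hp, h⟩ := hu K
  ⟨p, hp.trans hmn, h⟩

theorem sev_add (x : Pt d) (h : ℝ) (p q : MvPolynomial (Fin d) ℝ) (y : Pt d) :
    sev x h (p + q) y = sev x h p y + sev x h q y := pev_add _ _ _

theorem sev_C_mul (x : Pt d) (h c : ℝ) (p : MvPolynomial (Fin d) ℝ) (y : Pt d) :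
    sev x h (MvPolynomial.C c * p) y = c * sev x h p y := by
  rw [sev, pev_mul, pev_C]
  rfl

theorem totalDegree_C_mul_le (c : ℝ) {p : MvPolynomial (Fin d) ℝ} (hp : p.totalDegree ≤ m) :
    (MvPolynomial.C c * p).totalDegree ≤ m :=
  ((PolyBound.mk hp le_rfl).const_mul (le_refl |c|)).deg

theorem RefinedPiecewisePoly.add (hu : RefinedPiecewisePoly Q m u)
    (hw : RefinedPiecewisePoly Q m w) : RefinedPiecewisePoly Q m (u + w) := by
  intro K a
  obtain ⟨p, hp, h⟩ := hu K a
  obtain ⟨q, hq, h'⟩ := hw K a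
  refine ⟨p + q, (MvPolynomial.totalDegree_add _ _).trans (max_le hp hq), ?_⟩
  filter_upwards [h, h', Lp.coeFn_add u w] with y hy hy' e hya
  rw [e, Pi.add_apply, hy hya, hy' hya, sev_add]

theorem RefinedPiecewisePoly.smul (hu : RefinedPiecewisePoly Q m u) (c : ℝ) :
    RefinedPiecewisePoly Q m (c • u) := by
  intro K a
  obtain ⟨p, hp, h⟩ := hu K a
  refine ⟨MvPolynomial.C c * p, totalDegree_C_mul_le c hp, ?_⟩
  filter_upwards [h, Lp.coeFn_smul c u] with y hy e hya
  rw [e, Pi.smul_apply, hy hya, sev_C_mul, smul_eq_mul]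

theorem PiecewisePoly.smul (hu : PiecewisePoly Q m u) (c : ℝ) : PiecewisePoly Q m (c • u) := by
  intro K
  obtain ⟨p, hp, h⟩ := hu K
  refine ⟨MvPolynomial.C c * p, totalDegree_C_mul_le c hp, ?_⟩
  filter_upwards [h, Lp.coeFn_smul c u] with y hy e hya
  rw [e, Pi.smul_apply, hy hya, sev_C_mul, smul_eq_mul]

theorem piecewisePoly_zero_iff :
    PiecewisePoly Q 0 u ↔ ∃ c : κ → ℝ, ∀ K, ∀ᵐ y ∂(volume.restrict Ω), y ∈ (Q K).cell →
      u y = c K := by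
  constructor
  · intro h
    choose p hp hu using h
    refine ⟨fun K => MvPolynomial.coeff 0 (p K), fun K => ?_⟩
    filter_upwards [hu K] with y hy hya
    rw [hy hya, MvPolynomial.totalDegree_eq_zero_iff_eq_C.1 (Nat.le_zero.1 (hp K)), sev, pev_C,
      MvPolynomial.coeff_zero_C]
  · rintro ⟨c, hc⟩ K
    refine ⟨MvPolynomial.C (c K), (MvPolynomial.totalDegree_C _).le, ?_⟩
    filter_upwards [hc K] with y hy hya
    rw [hy hya, sev, pev_C]

end PiecewisePoly

namespace IsSplitMesh

variable {κ : Type*} [Fintype κ] {Q : κ → SplitCell d} {Ω : Set (Pt d)} (hQ : IsSplitMesh Q Ω)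
include hQ

/-- Functions with zero mean on each cell are orthogonal to the piecewise constants. -/
theorem inner_eq_zero (hd : 0 < d) {q r : L2 Ω} (hq : PiecewisePoly Q 0 q)
    (hr : ∀ K, ∫ y in (Q K).openCell, r y = 0) : inner ℝ q r = 0 := by
  obtain ⟨c, hc⟩ := piecewisePoly_zero_iff.1 hq
  have hi : Integrable (fun y => q y * r y) (volume.restrict Ω) :=
    (Lp.memLp q).integrable_mul (Lp.memLp r)
  rw [← integral_mul_eq_inner, hQ.setIntegral_eq_sum hd hi]
  refine Finset.sum_eq_zero fun K _ => ?_
  have h1 : ∫ y in (Q K).openCell, q y * r y = ∫ y in (Q K).openCell, c K * r y := by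
    refine integral_congr_ae ?_
    filter_upwards [ae_restrict_of_ae_restrict_of_subset (hQ.openCell_subset K) (hc K),
      ae_restrict_mem (Q K).isOpen_openCell.measurableSet] with y hy hyc
    rw [hy ((Q K).openCell_subset_cell hyc)]
  rw [h1, integral_const_mul, hr K, mul_zero]

/-- The cellwise mean value of a function. -/
theorem exists_cellMean (hd : 0 < d) (q : L2 Ω) :
    ∃ q' : L2 Ω, PiecewisePoly Q 0 q' ∧ ∀ K, ∫ y in (Q K).openCell, (q - q' : L2 Ω) y = 0 := by
  have := hQ.isFiniteMeasure_restrict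
  let c : κ → ℝ := fun K => (volume.real (Q K).openCell)⁻¹ * ∫ y in (Q K).openCell, q y
  let F : Pt d → ℝ := fun y => ∑ K, (Q K).openCell.indicator (fun _ => c K) y
  have hF : ∀ K, ∀ y ∈ (Q K).openCell, F y = c K := by
    intro K y hy
    have h1 : F y = (Q K).openCell.indicator (fun _ => c K) y :=
      Finset.sum_eq_single K (fun L _ hL => indicator_of_notMem
        (fun h => Set.disjoint_left.1 (hQ.disjoint L K hL) h hy) _)
        fun h => absurd (Finset.mem_univ K) h
    rw [h1, indicator_of_mem hy]
  have hm : MemLp F 2 (volume.restrict Ω) := memLp_finsetSum _ fun K _ =>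
    (memLp_const (c K)).indicator (Q K).isOpen_openCell.measurableSet
  refine ⟨hm.toLp F, piecewisePoly_zero_iff.2 ⟨c, fun K => ?_⟩, fun K => ?_⟩
  · filter_upwards [hm.coeFn_toLp, ae_restrict_of_ae ((Q K).ae_mem_openPiece_of_mem_cell hd)]
      with y hy hyp hyc
    obtain ⟨a, ha⟩ := hyp hyc
    rw [hy, hF K y ((Q K).openPiece_subset_openCell a ha)]
  · have h1 : ∫ y in (Q K).openCell, (q - hm.toLp F : L2 Ω) y =
        ∫ y in (Q K).openCell, (q y - c K) := by
      refine integral_congr_ae ?_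
      filter_upwards [ae_restrict_of_ae_restrict_of_subset (hQ.openCell_subset K)
        (Lp.coeFn_sub q (hm.toLp F)), ae_restrict_of_ae_restrict_of_subset (hQ.openCell_subset K)
        hm.coeFn_toLp, ae_restrict_mem (Q K).isOpen_openCell.measurableSet] with y h1 h2 hy
      rw [h1, Pi.sub_apply, h2, hF K y hy]
    have := isFiniteMeasure_restrict_of_isBounded (Q K).isBounded_openCell
    have hpos : 0 < volume.real (Q K).openCell := by
      obtain ⟨y, hy⟩ := (Q K).openPiece_nonempty 0
      exact ENNReal.toReal_pos ((Q K).isOpen_openCell.measure_pos volume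
        ⟨y, (Q K).openPiece_subset_openCell 0 hy⟩).ne' (Q K).isBounded_openCell.measure_lt_top.ne
    rw [h1, integral_sub (IntegrableOn.mono_set (t := Ω) ((Lp.memLp q).integrable (by norm_num))
      (hQ.openCell_subset K)) (integrable_const _), setIntegral_const, smul_eq_mul]
    simp only [c]
    rw [mul_inv_cancel_left₀ hpos.ne', sub_self]

theorem setIntegral_eq_zero (hd : 0 < d) {r : L2 Ω}
    (hr : ∀ K, ∫ y in (Q K).openCell, r y = 0) : ∫ y in Ω, r y = 0 := by
  have := hQ.isFiniteMeasure_restrict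
  rw [hQ.setIntegral_eq_sum hd ((Lp.memLp r).integrable (by norm_num))]
  exact Finset.sum_eq_zero fun K _ => hr K

end IsSplitMesh

/-- Fields from the stability of the unrefined pair take care of the cell means, and fields with
prescribed divergence of the rest of the pressure. -/
theorem exists_refined_stable (hd : 0 < d) (m : ℕ) {σ : ℝ} (hσ : 0 < σ) (D : ℝ) {γ : ℝ}
    (hγ : 0 < γ) :
    ∃ β : ℝ, 0 < β ∧ ∀ {κ : Type} [Fintype κ] {Q : κ → SplitCell d} {Ω : Set (Pt d)},
      IsSplitMesh Q Ω → (∀ K, (Q K).Regular σ) → (∀ K, (Q K).h ≤ D) →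
      (∀ q : L2 Ω, ∫ y in Ω, q y = 0 → PiecewisePoly Q 0 q → ∃ v : Fin d → L2 Ω,
        (∀ j, MemH10 Ω (v j) ∧ PiecewisePoly Q (m + 1) (v j)) ∧
        γ * ‖q‖ ^ 2 ≤ inner ℝ q (wdiv v) ∧ vecH1Norm v ≤ ‖q‖) →
      ∀ q : L2 Ω, ∫ y in Ω, q y = 0 → RefinedPiecewisePoly Q m q → ∃ v : Fin d → L2 Ω,
        (∀ j, MemH10 Ω (v j) ∧ RefinedPiecewisePoly Q (m + 1) (v j)) ∧
        β * ‖q‖ ^ 2 ≤ inner ℝ q (wdiv v) ∧ vecH1Norm v ≤ ‖q‖ := by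
  obtain ⟨C, hC, H⟩ := exists_wdiv_eq hd m hσ D
  -- chosen such that `γ / 2 * a ^ 2 - √d * a * b + (A - γ / 2) * b ^ 2` is a square
  let A : ℝ := d / (2 * γ) + γ / 2
  let s : ℝ := (√(2 + 2 * A ^ 2 * C))⁻¹
  have hs0 : 0 < 2 + 2 * A ^ 2 * C := by positivity
  have hs : 0 < s := inv_pos.2 (Real.sqrt_pos.2 hs0)
  have hs2 : s ^ 2 * (2 + 2 * A ^ 2 * C) = 1 := by
    simp only [s]
    rw [inv_pow, Real.sq_sqrt hs0.le, inv_mul_cancel₀ hs0.ne']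
  refine ⟨s * (γ / 2), by positivity, fun {κ _ Q Ω} hQ hreg hD hst q hq0 hq => ?_⟩
  have := hQ.isFiniteMeasure_restrict
  obtain ⟨q', hq', hr⟩ := hQ.exists_cellMean hd q
  have hq'0 : ∫ y in Ω, q' y = 0 := by
    have h1 := hQ.setIntegral_eq_zero hd hr
    have h2 : ∫ y in Ω, (q - q' : L2 Ω) y = (∫ y in Ω, q y) - ∫ y in Ω, q' y := by
      rw [← integral_sub ((Lp.memLp q).integrable (by norm_num))
        ((Lp.memLp q').integrable (by norm_num))]
      exact integral_congr_ae (Lp.coeFn_sub q q')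
    linarith
  have hrp : RefinedPiecewisePoly Q m (q - q') := by
    have h1 := hq.add ((hq'.mono (Nat.zero_le m)).refined.smul (-1))
    rwa [neg_one_smul, ← sub_eq_add_neg] at h1
  obtain ⟨v₁, hv₁, h₁, hn₁⟩ := hst q' hq'0 hq'
  obtain ⟨v₀, hv₀, hp₀, hd₀, hn₀⟩ := H hQ hreg hD (q - q') hrp hr
  have hm₁ : ∀ j, MemH1 Ω (v₁ j) := fun j => (hv₁ j).1.1
  have hm₀ : ∀ j, MemH1 Ω (v₀ j) := fun j => (hv₀ j).1
  have hm₀' : ∀ j, MemH1 Ω ((A • v₀) j) := fun j => (hm₀ j).smul A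
  have hm : ∀ j, MemH1 Ω ((v₁ + A • v₀) j) := fun j => (hm₁ j).add (hm₀' j)
  have horth : inner ℝ q' (q - q') = 0 := hQ.inner_eq_zero hd hq' hr
  have hq_eq : q = q' + (q - q') := by abel
  have hnorm : ‖q‖ ^ 2 = ‖q'‖ ^ 2 + ‖q - q'‖ ^ 2 := by
    conv_lhs => rw [hq_eq]
    rw [norm_add_sq_real, horth]
    ring
  have hdiv₁ : ‖wdiv v₁‖ ≤ √d * ‖q'‖ := by
    refine (sq_le_sq₀ (norm_nonneg _) (by positivity)).1 ?_
    rw [mul_pow, Real.sq_sqrt (Nat.cast_nonneg d)]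
    exact (norm_wdiv_sq_le v₁).trans (mul_le_mul_of_nonneg_left
      (pow_le_pow_left₀ (vecH1Norm_nonneg _) hn₁ 2) (Nat.cast_nonneg d))
  refine ⟨s • (v₁ + A • v₀), fun j => ⟨?_, ?_⟩, ?_, ?_⟩
  · exact ((hv₁ j).1.add hQ.isOpen ((hv₀ j).smul hQ.isOpen A)).smul hQ.isOpen s
  · exact ((hv₁ j).2.refined.add (RefinedPiecewisePoly.smul (hp₀ j) A)).smul s
  · rw [wdiv_smul hQ.isOpen hm, wdiv_add hQ.isOpen hm₁ hm₀', wdiv_smul hQ.isOpen hm₀, hd₀,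
      inner_smul_right, mul_assoc]
    refine mul_le_mul_of_nonneg_left ?_ hs.le
    have e1 : inner ℝ q (wdiv v₁ + A • (q - q')) =
        inner ℝ q' (wdiv v₁) + inner ℝ (q - q') (wdiv v₁) + A * ‖q - q'‖ ^ 2 := by
      rw [inner_add_right, inner_smul_right]
      conv_lhs => rw [hq_eq]
      rw [inner_add_left, add_sub_cancel_left, inner_add_left, horth,
        real_inner_self_eq_norm_sq]
      ring
    have e2 : -(‖q - q'‖ * (√d * ‖q'‖)) ≤ inner ℝ (q - q') (wdiv v₁) :=
      (neg_le_neg (mul_le_mul_of_nonneg_left hdiv₁ (norm_nonneg _))).trans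
        (neg_le_of_abs_le (abs_real_inner_le_norm _ _))
    have e3 : 0 ≤ (γ * ‖q'‖ - √d * ‖q - q'‖) ^ 2 / (2 * γ) := by positivity
    have e4 : (γ * ‖q'‖ - √d * ‖q - q'‖) ^ 2 / (2 * γ) =
        γ / 2 * ‖q'‖ ^ 2 - ‖q - q'‖ * (√d * ‖q'‖) + d / (2 * γ) * ‖q - q'‖ ^ 2 := by
      have e5 : √(d : ℝ) ^ 2 = d := Real.sq_sqrt (Nat.cast_nonneg d)
      field_simp
      ring_nf
      rw [e5]
      ring
    rw [e1, hnorm]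
    simp only [A]
    nlinarith
  · rw [vecH1Norm_smul hQ.isOpen hm, abs_of_pos hs]
    refine (sq_le_sq₀ (mul_nonneg hs.le (vecH1Norm_nonneg _)) (norm_nonneg _)).1 ?_
    have e1 := vecH1Norm_add_sq_le hQ.isOpen hm₁ hm₀'
    rw [vecH1Norm_smul hQ.isOpen hm₀, mul_pow, sq_abs] at e1
    have e2 : vecH1Norm v₁ ^ 2 ≤ ‖q‖ ^ 2 := by
      have := pow_le_pow_left₀ (vecH1Norm_nonneg _) hn₁ 2
      nlinarith [sq_nonneg ‖q - q'‖]
    have e3 : A ^ 2 * vecH1Norm v₀ ^ 2 ≤ A ^ 2 * (C * ‖q‖ ^ 2) := by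
      refine mul_le_mul_of_nonneg_left (hn₀.trans (mul_le_mul_of_nonneg_left ?_ hC)) (sq_nonneg A)
      rw [hnorm]
      exact le_add_of_nonneg_left (sq_nonneg _)
    calc (s * vecH1Norm (v₁ + A • v₀)) ^ 2 = s ^ 2 * vecH1Norm (v₁ + A • v₀) ^ 2 := mul_pow _ _ 2
      _ ≤ s ^ 2 * ((2 + 2 * A ^ 2 * C) * ‖q‖ ^ 2) :=
        mul_le_mul_of_nonneg_left (by linarith) (sq_nonneg s)
      _ = ‖q‖ ^ 2 := by rw [← mul_assoc, hs2, one_mul]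

end FineFromCoarse

/-! ### Stability of the unrefined pair from stability of the refined one -/

section CoarseFromFine

open Filter Topology

variable {d : ℕ}

/-- Up to its constant term, a polynomial is controlled by its derivatives. -/
theorem coefNorm_sub_const_le (p : MvPolynomial (Fin d) ℝ) :
    coefNorm (p - MvPolynomial.C (MvPolynomial.coeff 0 p)) ≤
      ∑ i, coefNorm (MvPolynomial.pderiv i p) := by
  classical
  have hsupp : (p - MvPolynomial.C (MvPolynomial.coeff 0 p)).support ⊆ p.support.erase 0 := by
    intro s hs
    rw [MvPolynomial.mem_support_iff, MvPolynomial.coeff_sub, MvPolynomial.coeff_C] at hs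
    have h0 : s ≠ 0 := by
      rintro rfl
      simp at hs
    rw [if_neg (Ne.symm h0), sub_zero] at hs
    exact Finset.mem_erase.2 ⟨h0, MvPolynomial.mem_support_iff.2 hs⟩
  have h1 : coefNorm (p - MvPolynomial.C (MvPolynomial.coeff 0 p)) =
      ∑ s ∈ p.support.erase 0, |MvPolynomial.coeff s p| := by
    rw [coefNorm_eq_sum hsupp]
    refine Finset.sum_congr rfl fun s hs => ?_
    rw [MvPolynomial.coeff_sub, MvPolynomial.coeff_C, if_neg (Ne.symm (Finset.mem_erase.1 hs).1),
      sub_zero]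
  have h2 : ∀ i, ∑ s ∈ p.support with s i ≠ 0, |MvPolynomial.coeff s p| ≤
      coefNorm (MvPolynomial.pderiv i p) := by
    intro i
    let f : (Fin d →₀ ℕ) → (Fin d →₀ ℕ) := fun s => s - Finsupp.single i 1
    have hf : ∀ s, s i ≠ 0 → f s + Finsupp.single i 1 = s := fun s hs =>
      tsub_add_cancel_of_le (Finsupp.single_le_iff.2 (Nat.one_le_iff_ne_zero.2 hs))
    have hinj : Set.InjOn f (p.support.filter fun s => s i ≠ 0 : Finset _) := by
      intro s hs t ht hst
      rw [← hf s (Finset.mem_filter.1 hs).2, ← hf t (Finset.mem_filter.1 ht).2, hst]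
    have h3 : ∀ s, s i ≠ 0 →
        |MvPolynomial.coeff s p| ≤ |MvPolynomial.coeff (f s) (MvPolynomial.pderiv i p)| := by
      intro s hs
      rw [MvPolynomial.coeff_pderiv, hf s hs, abs_mul]
      refine le_mul_of_one_le_right (abs_nonneg _) ?_
      have h4 : (0 : ℝ) ≤ (f s) i := Nat.cast_nonneg _
      rw [abs_of_nonneg (by linarith)]
      linarith
    calc ∑ s ∈ p.support with s i ≠ 0, |MvPolynomial.coeff s p|
        ≤ ∑ s ∈ p.support with s i ≠ 0, |MvPolynomial.coeff (f s) (MvPolynomial.pderiv i p)| :=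
          Finset.sum_le_sum fun s hs => h3 s (Finset.mem_filter.1 hs).2
      _ = ∑ t ∈ (p.support.filter fun s => s i ≠ 0).image f,
            |MvPolynomial.coeff t (MvPolynomial.pderiv i p)| :=
          (Finset.sum_image (f := fun t => |MvPolynomial.coeff t (MvPolynomial.pderiv i p)|)
            hinj).symm
      _ ≤ ∑ t ∈ (p.support.filter fun s => s i ≠ 0).image f ∪ (MvPolynomial.pderiv i p).support,
            |MvPolynomial.coeff t (MvPolynomial.pderiv i p)| :=
          Finset.sum_le_sum_of_subset_of_nonneg Finset.subset_union_left
            fun _ _ _ => abs_nonneg _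
      _ = coefNorm (MvPolynomial.pderiv i p) := (coefNorm_eq_sum Finset.subset_union_right).symm
  rw [h1]
  refine le_trans ?_ (Finset.sum_le_sum fun i _ => h2 i)
  simp only [Finset.sum_filter]
  rw [Finset.sum_comm]
  refine (Finset.sum_le_sum fun s hs => ?_).trans (Finset.sum_le_sum_of_subset_of_nonneg
    (Finset.erase_subset 0 p.support) fun s _ _ => Finset.sum_nonneg fun i _ => by
      split_ifs <;> positivity)
  obtain ⟨i, hi⟩ := Finsupp.ne_iff.1 (Finset.mem_erase.1 hs).1
  have hi' : s i ≠ 0 := hi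
  refine le_trans (le_of_eq ?_) (Finset.single_le_sum (fun i _ => by split_ifs <;> positivity)
    (Finset.mem_univ i))
  rw [if_pos hi']

theorem pev_zero_eq_coeff (p : MvPolynomial (Fin d) ℝ) : pev p 0 = MvPolynomial.coeff 0 p := by
  have h : pev p 0 = MvPolynomial.eval 0 p := rfl
  rw [h, MvPolynomial.eval_zero, MvPolynomial.constantCoeff_eq]

namespace SplitCell

/-- The values of the `d + 1` functions `μ` in dimension `d` are subject to a single relation. -/
theorem exists_mu_eq (Q : SplitCell d) {m : Fin (d + 1) → ℝ} (hm : ∑ e, Q.S.c e * m e = 1) :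
    ∃ y, ∀ e, Q.mu e y = m e := by
  refine ⟨Q.x + Q.h • ∑ e, (Q.S.c e * m e) • Q.S.v e, fun b => ?_⟩
  have hb := (Q.S.c_pos b).ne'
  rw [mu_eq, add_sub_cancel_left, inv_smul_smul₀ Q.h_pos.ne', inner_sum]
  simp only [inner_smul_right, Q.S.inner_g_v, mul_sub, mul_one, Finset.sum_sub_distrib, hm,
    mul_ite, mul_zero, Finset.sum_ite_eq', Finset.mem_univ, if_true]
  field_simp
  ring

/-- Points in the relative interior of the common facet of two parts. -/
theorem exists_mem_common_facet (Q : SplitCell d) {a b : Fin (d + 1)} (hab : a ≠ b) :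
    ∃ w, 0 < Q.mu a w ∧ Q.mu a w = Q.mu b w ∧ ∀ e, e ≠ a → e ≠ b → Q.mu a w < Q.mu e w := by
  let s : ℝ := Q.S.c a + Q.S.c b
  have ha := Q.S.c_pos a
  have hb := Q.S.c_pos b
  let m : Fin (d + 1) → ℝ := fun e => 1 + s / 2 - if e = a ∨ e = b then 1 / 2 else 0
  have h1 : ∀ e, Q.S.c e * m e = Q.S.c e * (1 + s / 2) - ((if e = a then Q.S.c a / 2 else 0) +
      if e = b then Q.S.c b / 2 else 0) := by
    intro e
    simp only [m]
    by_cases hea : e = a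
    · subst hea
      simp [hab]
      ring
    · by_cases heb : e = b
      · subst heb
        simp [hea]
        ring
      · simp [hea, heb]
  have hm : ∑ e, Q.S.c e * m e = 1 := by
    simp only [h1, Finset.sum_sub_distrib, Finset.sum_add_distrib, ← Finset.sum_mul, Q.S.sum_c,
      Finset.sum_ite_eq', Finset.mem_univ, if_true, s]
    ring
  obtain ⟨w, hw⟩ := Q.exists_mu_eq hm
  refine ⟨w, ?_, ?_, fun e hea heb => ?_⟩
  · rw [hw]
    simp only [m, true_or, if_true, s]
    linarith
  · rw [hw, hw]
    simp only [m, true_or, or_true, if_true]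
  · rw [hw, hw]
    simp only [m, true_or, if_true, hea, heb, or_self, if_false]
    linarith

end SplitCell

/-- The polynomial pieces of a function in `H¹` fit together continuously. -/
theorem IsSplitMesh.sev_eq_of_memH1 {κ : Type*} {Q : κ → SplitCell d} {Ω : Set (Pt d)}
    (hQ : IsSplitMesh Q Ω) {v : L2 Ω} (hv : MemH1 Ω v)
    {K : κ} {p : Fin (d + 1) → MvPolynomial (Fin d) ℝ}
    (hp : ∀ a, ∀ᵐ y ∂(volume.restrict Ω), y ∈ (Q K).piece a →
      v y = sev (Q K).x (Q K).h (p a) y) {a b : Fin (d + 1)} {y : Pt d}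
    (ha : y ∈ (Q K).piece a) (hb : y ∈ (Q K).piece b) :
    sev (Q K).x (Q K).h (p a) y = sev (Q K).x (Q K).h (p b) y := by
  by_cases hab : a = b
  · rw [hab]
  -- equality at points of the common facet which belong to no other part
  have h1 : ∀ z, 0 < (Q K).mu a z → (Q K).mu a z = (Q K).mu b z →
      (∀ e, e ≠ a → e ≠ b → (Q K).mu a z < (Q K).mu e z) →
      sev (Q K).x (Q K).h (p a) z = sev (Q K).x (Q K).h (p b) z := by
    intro z h0 heq hlt
    have ho : ∀ᶠ y in 𝓝 z, 0 < (Q K).mu a y ∧ 0 < (Q K).mu b y ∧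
        ∀ e, e ≠ a → e ≠ b → (Q K).mu a y < (Q K).mu e y ∧ (Q K).mu b y < (Q K).mu e y := by
      refine ((Q K).continuous_mu a).continuousAt.eventually (lt_mem_nhds h0) |>.and
        ((((Q K).continuous_mu b).continuousAt.eventually (lt_mem_nhds (heq ▸ h0))).and ?_)
      refine eventually_all.2 fun e => ?_
      by_cases hea : e = a
      · exact Eventually.of_forall fun y h => absurd hea h
      by_cases heb : e = b
      · exact Eventually.of_forall fun y _ h => absurd heb h
      have e1 : ∀ᶠ y in 𝓝 z, (Q K).mu a y < (Q K).mu e y :=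
        ((Q K).continuous_mu a).continuousAt.eventually_lt ((Q K).continuous_mu e).continuousAt
          (hlt e hea heb)
      have e2 : ∀ᶠ y in 𝓝 z, (Q K).mu b y < (Q K).mu e y :=
        ((Q K).continuous_mu b).continuousAt.eventually_lt ((Q K).continuous_mu e).continuousAt
          (heq ▸ hlt e hea heb)
      filter_upwards [e1, e2] with y h1 h2 _ _ using ⟨h1, h2⟩
    obtain ⟨ρ, hρ, hball⟩ := Metric.eventually_nhds_iff_ball.1 ho
    have hdiff : ∀ y, inner ℝ ((Q K).S.g b - (Q K).S.g a) (y - z) =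
        (Q K).h * ((Q K).mu b y - (Q K).mu a y) := by
      intro y
      have h2 : y - (Q K).x = (y - z) + (z - (Q K).x) := by abel
      have h3 := heq
      rw [SplitCell.mu_eq, SplitCell.mu_eq, inner_smul_right, inner_smul_right] at h3
      have hh := (Q K).h_pos.ne'
      rw [SplitCell.mu_eq, SplitCell.mu_eq, inner_smul_right, inner_smul_right, h2,
        inner_add_right, inner_add_right, inner_sub_left]
      field_simp
      field_simp at h3
      linarith
    have hpa : ∀ y ∈ Metric.ball z ρ, (Q K).mu a y < (Q K).mu b y → y ∈ (Q K).openPiece a := by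
      intro y hy hlt
      refine ⟨(hball y hy).1, fun e he => ?_⟩
      by_cases heb : e = b
      · rwa [heb]
      · exact ((hball y hy).2.2 e he heb).1
    have hpb : ∀ y ∈ Metric.ball z ρ, (Q K).mu b y < (Q K).mu a y → y ∈ (Q K).openPiece b := by
      intro y hy hlt
      refine ⟨(hball y hy).2.1, fun e he => ?_⟩
      by_cases hea : e = a
      · rwa [hea]
      · exact ((hball y hy).2.2 e hea he).2
    refine eq_of_memH1_of_two_sided (x₀ := z) (n := (Q K).S.g b - (Q K).S.g a) hv
      (contDiff_sev _ _ _) (contDiff_sev _ _ _) ((Q K).g_sub_ne_zero (Ne.symm hab)) hρ ?_ ?_ ?_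
    · intro y hy
      refine hQ.openCell_subset K fun e => ?_
      by_cases hea : e = a
      · exact hea ▸ (hball y hy).1
      by_cases heb : e = b
      · exact heb ▸ (hball y hy).2.1
      · exact (hball y hy).1.trans ((hball y hy).2.2 e hea heb).1
    · filter_upwards [hp a] with y hy hyb hpos
      rw [hdiff] at hpos
      exact hy ((Q K).openPiece_subset_piece a
        (hpa y hyb (sub_pos.1 (pos_of_mul_pos_right hpos (Q K).h_pos.le))))
    · filter_upwards [hp b] with y hy hyb hneg
      rw [hdiff] at hneg
      exact hy ((Q K).openPiece_subset_piece b
        (hpb y hyb (sub_neg.1 (neg_of_mul_neg_right hneg (Q K).h_pos.le))))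
  -- such points are dense in the common facet
  obtain ⟨w, hw0, hweq, hwlt⟩ := (Q K).exists_mem_common_facet hab
  have hy : (Q K).mu a y = (Q K).mu b y := le_antisymm (ha.2 b) (hb.2 a)
  have hc : Continuous fun t : ℝ => (1 - t) • y + t • w := by fun_prop
  have hcl : IsClosed {z | sev (Q K).x (Q K).h (p a) z = sev (Q K).x (Q K).h (p b) z} :=
    isClosed_eq (contDiff_sev _ _ _).continuous (contDiff_sev _ _ _).continuous
  have ht : Tendsto (fun t : ℝ => (1 - t) • y + t • w) (𝓝[>] 0) (𝓝 y) := by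
    have h2 := hc.tendsto 0
    simp only [sub_zero, one_smul, zero_smul, add_zero] at h2
    exact h2.mono_left nhdsWithin_le_nhds
  refine hcl.mem_of_tendsto ht ?_
  filter_upwards [Ioo_mem_nhdsGT (zero_lt_one (α := ℝ))] with t ht
  have ht1 : (1 - t) + t = 1 := by ring
  have ht2 : 0 < 1 - t := sub_pos.2 ht.2
  refine h1 _ ?_ ?_ fun e hea heb => ?_
  · rw [(Q K).mu_convex_comb a y w ht1]
    exact add_pos_of_nonneg_of_pos (mul_nonneg ht2.le ha.1) (mul_pos ht.1 hw0)
  · rw [(Q K).mu_convex_comb a y w ht1, (Q K).mu_convex_comb b y w ht1, hy, hweq]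
  · rw [(Q K).mu_convex_comb a y w ht1, (Q K).mu_convex_comb e y w ht1]
    exact add_lt_add_of_le_of_lt (mul_le_mul_of_nonneg_left (ha.2 e) ht2.le)
      (mul_lt_mul_of_pos_left (hwlt e hea heb) ht.1)

end CoarseFromFine

section CoarseFromFineStability

open Filter Topology

variable {d : ℕ}

/-- A function in the velocity space of the refined mesh differs from a function in the velocity
space of the unrefined mesh by a sum of bubbles, whose derivatives have zero mean on the cells. -/
theorem exists_bubble_correction (hd : 0 < d) {k : ℕ} (hk : 1 ≤ k) {σ : ℝ} (hσ : 0 < σ) (D : ℝ) :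
    ∃ C : ℝ, 0 ≤ C ∧ ∀ {κ : Type} [Fintype κ] {Q : κ → SplitCell d} {Ω : Set (Pt d)},
      IsSplitMesh Q Ω → (∀ K, (Q K).Regular σ) → (∀ K, (Q K).h ≤ D) →
      ∀ v : L2 Ω, MemH1 Ω v → RefinedPiecewisePoly Q k v →
      ∃ z : L2 Ω, MemH10 Ω z ∧ PiecewisePoly Q k (v - z) ∧
        (∀ i K, ∫ y in (Q K).openCell, weakPartial i z y = 0) ∧
        h1Norm z ^ 2 ≤ C * h1Norm v ^ 2 := by
  have hA : (1 : ℝ) ≤ 1 + d / (2 * σ) := le_add_of_nonneg_right (by positivity)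
  obtain ⟨B, hB, H⟩ := SplitSimplex.exists_interpolant d hk hA
  obtain ⟨C₁, hC₁, H₁⟩ := exists_sum_coefNorm_sq_le hd k hσ
  refine ⟨volume.real (Metric.ball (0 : Pt d) 1) * (D ^ 2 + d * ((k : ℝ) + 1) ^ 2) *
    ((1 + B) ^ 2 * (d * C₁)), by positivity, fun {κ _ Q Ω} hQ hreg hD v hv hvp => ?_⟩
  choose p hp hvp using hvp
  have hcompat : ∀ K a b y, y ∈ (Q K).piece a → y ∈ (Q K).piece b →
      sev (Q K).x (Q K).h (p K a) y = sev (Q K).x (Q K).h (p K b) y := fun K a b y ha hb =>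
    hQ.sev_eq_of_memH1 hv (hvp K) ha hb
  -- subtract the value at the splitting point
  let c : κ → ℝ := fun K => MvPolynomial.coeff 0 (p K 0)
  have hc : ∀ K a, MvPolynomial.coeff 0 (p K a) = c K := by
    intro K a
    have h1 := hcompat K a 0 (Q K).x ((Q K).center_mem_piece a) ((Q K).center_mem_piece 0)
    simpa only [sev, sub_self, smul_zero, pev_zero_eq_coeff] using h1
  let q : κ → Fin (d + 1) → MvPolynomial (Fin d) ℝ := fun K a => p K a - MvPolynomial.C (c K)
  -- the derivatives of `v` in scaled coordinates
  let r : Fin d → κ → Fin (d + 1) → MvPolynomial (Fin d) ℝ := fun i K a =>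
    MvPolynomial.C (Q K).h⁻¹ * MvPolynomial.pderiv i (p K a)
  have hr : ∀ i K a, ∀ᵐ y ∂(volume.restrict Ω), y ∈ (Q K).piece a →
      weakPartial i v y = sev (Q K).x (Q K).h (r i K a) y := by
    intro i K a
    filter_upwards [hQ.weakPartial_ae_eq hv hd (hvp K a) i] with y hy hya
    rw [hy hya, sev_C_mul]
  have hrdeg : ∀ i K a, (r i K a).totalDegree ≤ k := fun i K a =>
    totalDegree_C_mul_le _ (((PolyBound.mk (hp K a) le_rfl).mono (Nat.le_succ k) le_rfl).pderiv i).deg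
  have hpr : ∀ i K a, coefNorm (MvPolynomial.pderiv i (p K a)) ≤ (Q K).h * coefNorm (r i K a) := by
    intro i K a
    have h1 : MvPolynomial.pderiv i (p K a) = MvPolynomial.C (Q K).h * r i K a := by
      simp only [r]
      rw [← mul_assoc, ← MvPolynomial.C_mul, mul_inv_cancel₀ (Q K).h_pos.ne', MvPolynomial.C_1,
        one_mul]
    conv_lhs => rw [h1]
    refine (coefNorm_mul_le _ _).trans (le_of_eq ?_)
    rw [coefNorm_C, abs_of_pos (Q K).h_pos]
  let M : κ → ℝ := fun K => ∑ i, ∑ a, coefNorm (r i K a)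
  have hq : ∀ K a, PolyBound k ((Q K).h * M K) (q K a) := by
    intro K a
    refine ⟨(((PolyBound.mk (hp K a) le_rfl).sub
      ((PolyBound.const (le_refl |c K|)).mono (Nat.zero_le k) le_rfl))).deg, ?_⟩
    simp only [q]
    rw [← hc K a]
    refine (coefNorm_sub_const_le _).trans ?_
    simp only [M]
    rw [Finset.mul_sum]
    refine Finset.sum_le_sum fun i _ => (hpr i K a).trans
      (mul_le_mul_of_nonneg_left ?_ (Q K).h_pos.le)
    exact Finset.single_le_sum (f := fun a => coefNorm (r i K a)) (fun _ _ => coefNorm_nonneg _)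
      (Finset.mem_univ a)
  have hqsev : ∀ K a y, sev (Q K).x (Q K).h (q K a) y = sev (Q K).x (Q K).h (p K a) y - c K :=
    fun K a y => by simp only [sev, q, pev_sub, pev_C]
  -- interpolation of the boundary values
  have hint : ∀ K, ∃ u, PolyBound k (B * ((Q K).h * M K)) u ∧
      ∀ a y, y ∈ (Q K).piece a → (Q K).mu a y = 0 →
        sev (Q K).x (Q K).h u y = sev (Q K).x (Q K).h (q K a) y := by
    intro K
    obtain ⟨u, hu, hu'⟩ := H (Q K).S (fun a => (hreg K).polyBound_mu hσ a) ((Q K).h * M K) (q K)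
      (hq K) (by
        intro a b y hy ha hb
        have hh := (Q K).h_pos.ne'
        have e1 : (Q K).h⁻¹ • ((Q K).x + (Q K).h • y - (Q K).x) = y := by
          rw [add_sub_cancel_left, inv_smul_smul₀ hh]
        have e2 : ∀ e, (Q K).mu e ((Q K).x + (Q K).h • y) = pev ((Q K).S.mu e) y := fun e => by
          rw [SplitCell.mu, sev, e1]
        have e3 : ∀ f, pev ((Q K).S.mu f) y = 0 → (Q K).x + (Q K).h • y ∈ (Q K).piece f := by
          intro f hf
          refine ⟨(e2 f ▸ hf).ge, fun e => ?_⟩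
          rw [e2, e2, hf]
          exact hy e
        have h1 := hcompat K a b _ (e3 a ha) (e3 b hb)
        simp only [sev, e1] at h1
        simp only [q, pev_sub, pev_C, h1])
    exact ⟨u, hu, fun a y hya h0 => hu' a _ ((Q K).piece_subset_cell a hya) h0⟩
  choose u hu hu' using hint
  let V : κ → Fin (d + 1) → MvPolynomial (Fin d) ℝ := fun K a => q K a - u K
  have hVsev : ∀ K a y, sev (Q K).x (Q K).h (V K a) y =
      sev (Q K).x (Q K).h (q K a) y - sev (Q K).x (Q K).h (u K) y := fun K a y => pev_sub _ _ _
  have hV : ∀ K, (Q K).IsBubble (V K) := by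
    intro K
    constructor
    · intro a b y ha hb
      rw [hVsev, hVsev, hqsev, hqsev, hcompat K a b y ha hb]
    · intro a y ha h0
      rw [hVsev, hu' K a y ha h0, sub_self]
  have hVb : ∀ K a, PolyBound k ((Q K).h * ((1 + B) * M K)) (V K a) := fun K a =>
    ((hq K a).sub (hu K)).mono le_rfl (le_of_eq (by ring))
  obtain ⟨z, hz, hzV⟩ := hQ.exists_sum_bubble hd hV
  refine ⟨z, hz, fun K => ⟨MvPolynomial.C (c K) + u K, ?_, ?_⟩,
    fun i K => hQ.setIntegral_weakPartial_eq_zero hd hV hz.1 hzV i K, ?_⟩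
  · exact ((((PolyBound.const (le_refl |c K|)).mono (Nat.zero_le k) le_rfl)).add (hu K)).deg
  · filter_upwards [ae_all_iff.2 (hvp K), ae_all_iff.2 (hzV K), Lp.coeFn_sub v z]
      with y h1 h2 h3 hyc
    obtain ⟨a, ha⟩ := (Q K).exists_mem_piece hyc
    rw [h3, Pi.sub_apply, h1 a ha, h2 a ha, hVsev, hqsev, sev_add,
      show sev (Q K).x (Q K).h (MvPolynomial.C (c K)) y = c K from pev_C _ _]
    ring
  · have h1 : ∑ K, M K ^ 2 * (Q K).h ^ d ≤ d * C₁ * h1Norm v ^ 2 := by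
      have h2 : ∀ K, M K ^ 2 * (Q K).h ^ d ≤
          ∑ i, d * ((∑ a, coefNorm (r i K a)) ^ 2 * (Q K).h ^ d) := by
        intro K
        have h3 : M K ^ 2 ≤ d * ∑ i, (∑ a, coefNorm (r i K a)) ^ 2 := by
          simpa using sq_sum_le_card_mul_sum_sq (s := Finset.univ)
            (f := fun i => ∑ a, coefNorm (r i K a))
        refine (mul_le_mul_of_nonneg_right h3 (pow_pos (Q K).h_pos d).le).trans (le_of_eq ?_)
        rw [← Finset.mul_sum, ← Finset.sum_mul, mul_assoc]
      refine (Finset.sum_le_sum fun K _ => h2 K).trans ?_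
      rw [Finset.sum_comm]
      simp only [← Finset.mul_sum]
      rw [mul_assoc]
      refine mul_le_mul_of_nonneg_left ?_ (Nat.cast_nonneg d)
      refine (Finset.sum_le_sum fun i _ => H₁ hQ hreg (weakPartial i v) (r i) (hrdeg i)
        (hr i)).trans ?_
      rw [← Finset.mul_sum, h1Norm_sq]
      exact mul_le_mul_of_nonneg_left (le_add_of_nonneg_left (sq_nonneg _)) hC₁.le
    refine (hQ.h1Norm_sq_le hd hD hVb hz.1 hzV).trans ?_
    rw [mul_assoc _ ((1 + B) ^ 2 * (d * C₁)), mul_assoc ((1 + B) ^ 2)]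
    refine mul_le_mul_of_nonneg_left ?_ (by positivity)
    simp only [mul_pow, mul_assoc, ← Finset.mul_sum]
    refine mul_le_mul_of_nonneg_left ?_ (by positivity)
    linarith

theorem wdiv_sub {Ω : Set (Pt d)} (hΩ : IsOpen Ω) {v w : Fin d → L2 Ω} (hv : ∀ j, MemH1 Ω (v j))
    (hw : ∀ j, MemH1 Ω (w j)) : wdiv (v - w) = wdiv v - wdiv w := by
  unfold wdiv
  rw [← Finset.sum_sub_distrib]
  exact Finset.sum_congr rfl fun i _ => weakPartial_sub hΩ (hv i) (hw i) i

/-- Removing bubbles from the fields of the refined velocity space does not change the pairing of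
their divergence with piecewise constants. -/
theorem exists_coarse_stable (hd : 0 < d) {k : ℕ} (hk : 1 ≤ k) {σ : ℝ} (hσ : 0 < σ) (D : ℝ) {γ : ℝ}
    (hγ : 0 < γ) :
    ∃ β : ℝ, 0 < β ∧ ∀ {κ : Type} [Fintype κ] {Q : κ → SplitCell d} {Ω : Set (Pt d)},
      IsSplitMesh Q Ω → (∀ K, (Q K).Regular σ) → (∀ K, (Q K).h ≤ D) →
      ∀ q : L2 Ω, PiecewisePoly Q 0 q →
      (∃ v : Fin d → L2 Ω, (∀ j, MemH10 Ω (v j) ∧ RefinedPiecewisePoly Q k (v j)) ∧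
        γ * ‖q‖ ^ 2 ≤ inner ℝ q (wdiv v) ∧ vecH1Norm v ≤ ‖q‖) →
      ∃ v : Fin d → L2 Ω, (∀ j, MemH10 Ω (v j) ∧ PiecewisePoly Q k (v j)) ∧
        β * ‖q‖ ^ 2 ≤ inner ℝ q (wdiv v) ∧ vecH1Norm v ≤ ‖q‖ := by
  obtain ⟨C, hC, H⟩ := exists_bubble_correction hd hk hσ D
  let s : ℝ := (√(2 + 2 * C))⁻¹
  have hs0 : 0 < 2 + 2 * C := by positivity
  have hs : 0 < s := inv_pos.2 (Real.sqrt_pos.2 hs0)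
  have hs2 : s ^ 2 * (2 + 2 * C) = 1 := by
    simp only [s]
    rw [inv_pow, Real.sq_sqrt hs0.le, inv_mul_cancel₀ hs0.ne']
  refine ⟨s * γ, mul_pos hs hγ, ?_⟩
  rintro κ _ Q Ω hQ hreg hD q hq ⟨v, hv, hqv, hvn⟩
  have := hQ.isFiniteMeasure_restrict
  choose z hz hvz hz0 hzn using fun j => H hQ hreg hD (v j) (hv j).1.1 (hv j).2
  have hvm : ∀ j, MemH1 Ω (v j) := fun j => (hv j).1.1
  have hzm : ∀ j, MemH1 Ω (z j) := fun j => (hz j).1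
  have hzm' : ∀ j, MemH1 Ω (((-1 : ℝ) • z) j) := fun j => (hzm j).smul (-1)
  have hsub : v - z = v + (-1 : ℝ) • z := by rw [neg_one_smul, sub_eq_add_neg]
  have hm : ∀ j, MemH1 Ω ((v - z) j) := fun j => (hvm j).sub (hzm j)
  refine ⟨s • (v - z), fun j => ⟨?_, (hvz j).smul s⟩, ?_, ?_⟩
  · rw [hsub]
    exact ((hv j).1.add hQ.isOpen ((hz j).smul hQ.isOpen (-1))).smul hQ.isOpen s
  · have h1 : inner ℝ q (wdiv z) = 0 := by
      rw [wdiv, inner_sum]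
      exact Finset.sum_eq_zero fun i _ => hQ.inner_eq_zero hd hq (hz0 i i)
    rw [wdiv_smul hQ.isOpen hm, wdiv_sub hQ.isOpen hvm hzm, inner_smul_right, inner_sub_right, h1,
      sub_zero, mul_assoc]
    exact mul_le_mul_of_nonneg_left hqv hs.le
  · rw [vecH1Norm_smul hQ.isOpen hm, abs_of_pos hs]
    refine (sq_le_sq₀ (mul_nonneg hs.le (vecH1Norm_nonneg _)) (norm_nonneg _)).1 ?_
    have e1 := vecH1Norm_add_sq_le hQ.isOpen hvm hzm'
    rw [vecH1Norm_smul hQ.isOpen hzm, ← hsub, mul_pow, abs_neg, abs_one, one_pow, one_mul] at e1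
    have e2 : vecH1Norm z ^ 2 ≤ C * vecH1Norm v ^ 2 := by
      rw [vecH1Norm_sq, vecH1Norm_sq, Finset.mul_sum]
      exact Finset.sum_le_sum fun j _ => hzn j
    have e3 := pow_le_pow_left₀ (vecH1Norm_nonneg _) hvn 2
    calc (s * vecH1Norm (v - z)) ^ 2 = s ^ 2 * vecH1Norm (v - z) ^ 2 := mul_pow _ _ 2
      _ ≤ s ^ 2 * ((2 + 2 * C) * vecH1Norm v ^ 2) :=
        mul_le_mul_of_nonneg_left (by linarith) (sq_nonneg s)
      _ = vecH1Norm v ^ 2 := by rw [← mul_assoc, hs2, one_mul]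
      _ ≤ ‖q‖ ^ 2 := e3

end CoarseFromFineStability

/-! ### The finite element spaces in terms of split cells -/

section Spaces

variable {d : ℕ}

theorem exists_eval_iff_exists_sev {Ω : Set (Pt d)} (q : L2 Ω) (m : ℕ) (s : Set (Pt d)) (x : Pt d)
    {h : ℝ} (hh : h ≠ 0) :
    (∃ p : MvPolynomial (Fin d) ℝ, p.totalDegree ≤ m ∧
      ∀ᵐ y ∂(volume.restrict Ω), y ∈ s → q y = MvPolynomial.eval (fun i => y i) p) ↔
    ∃ p : MvPolynomial (Fin d) ℝ, p.totalDegree ≤ m ∧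
      ∀ᵐ y ∂(volume.restrict Ω), y ∈ s → q y = sev x h p y := by
  constructor
  · rintro ⟨p, hp, H⟩
    obtain ⟨p', hp', h'⟩ := exists_sev_eq_pev hp x hh
    exact ⟨p', hp', by filter_upwards [H] with y hy hys using (hy hys).trans (h' y).symm⟩
  · rintro ⟨p, hp, H⟩
    obtain ⟨p', hp', h'⟩ := exists_pev_eq_sev hp x h
    exact ⟨p', hp', by filter_upwards [H] with y hy hys using (hy hys).trans (h' y).symm⟩

/-- Polynomials in the original coordinates are polynomials in the scaled coordinates of the cells,
of the same degree. -/
theorem forall_mem_cells_isPolyOn_iff {Ω : Set (Pt d)} {𝒯 : Geometry.SimplicialComplex ℝ (Pt d)}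
    {Q : cells 𝒯 → SplitCell d} {x : Finset (Pt d) → Pt d}
    {e : ∀ K : cells 𝒯, Fin (d + 1) ≃ (K : Finset (Pt d))}
    (hQ : ∀ K, (Q K).Describes K (x K) (e K)) (m : ℕ) (u : L2 Ω) :
    (∀ K ∈ cells 𝒯, IsPolyOn m K u) ↔ PiecewisePoly Q m u := by
  have h1 : ∀ K : cells 𝒯, IsPolyOn m K u ↔ ∃ p : MvPolynomial (Fin d) ℝ, p.totalDegree ≤ m ∧
      ∀ᵐ y ∂(volume.restrict Ω), y ∈ (Q K).cell → u y = sev (Q K).x (Q K).h p y := by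
    intro K
    rw [← exists_eval_iff_exists_sev u m (Q K).cell (Q K).x (Q K).h_pos.ne', (hQ K).cell_eq]
    rfl
  exact ⟨fun h K => (h1 K).1 (h K K.2), fun h K hK => (h1 ⟨K, hK⟩).2 (h ⟨K, hK⟩)⟩

open Classical in
theorem SplitCell.Describes.mem_refinedCells {𝒯 : Geometry.SimplicialComplex ℝ (Pt d)}
    {x : Finset (Pt d) → Pt d} {K : Finset (Pt d)} (hK : K ∈ cells 𝒯) {Q : SplitCell d}
    {e : Fin (d + 1) ≃ K} (hQ : Q.Describes K (x K) e) (a : Fin (d + 1)) :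
    ∃ T ∈ refinedCells 𝒯 x, Q.piece a = hull T :=
  ⟨_, ⟨K, hK, e a, (e a).2, rfl⟩, hQ.piece_eq a⟩

open Classical in
theorem forall_mem_refinedCells_isPolyOn_iff {Ω : Set (Pt d)}
    {𝒯 : Geometry.SimplicialComplex ℝ (Pt d)}
    {Q : cells 𝒯 → SplitCell d} {x : Finset (Pt d) → Pt d}
    {e : ∀ K : cells 𝒯, Fin (d + 1) ≃ (K : Finset (Pt d))}
    (hQ : ∀ K, (Q K).Describes K (x K) (e K)) (m : ℕ) (u : L2 Ω) :
    (∀ T ∈ refinedCells 𝒯 x, IsPolyOn m T u) ↔ RefinedPiecewisePoly Q m u := by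
  have h1 : ∀ (K : cells 𝒯) a, IsPolyOn m (insert (x K) ((K : Finset (Pt d)).erase (e K a))) u ↔
      ∃ p : MvPolynomial (Fin d) ℝ, p.totalDegree ≤ m ∧
      ∀ᵐ y ∂(volume.restrict Ω), y ∈ (Q K).piece a → u y = sev (Q K).x (Q K).h p y := by
    intro K a
    rw [← exists_eval_iff_exists_sev u m ((Q K).piece a) (Q K).x (Q K).h_pos.ne',
      (hQ K).piece_eq a]
    rfl
  constructor
  · exact fun h K a => (h1 K a).1 (h _ ⟨K, K.2, e K a, (e K a).2, rfl⟩)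
  · rintro h T ⟨K, hK, a, ha, rfl⟩
    have h2 := (h1 ⟨K, hK⟩ ((e ⟨K, hK⟩).symm ⟨a, ha⟩)).2 (h _ _)
    rwa [Equiv.apply_symm_apply] at h2

/-- A shape regular family of triangulations with a shape regular family of refinements gives
uniformly regular split meshes. -/
theorem exists_splitMesh (hd : 2 ≤ d) {Ω : Set (Pt d)} (hΩ : IsPolytopeDomain Ω)
    {ι : Type*} (𝒯 : ι → Geometry.SimplicialComplex ℝ (Pt d)) (h𝒯 : ∀ h, IsTriangulation (𝒯 h) Ω)
    (x : ι → Finset (Pt d) → Pt d) (hx : ∀ h, ∀ K ∈ cells (𝒯 h), x h K ∈ interior (hull K))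
    (hreg : ShapeRegular fun h => cells (𝒯 h))
    (hregr : ShapeRegular fun h => refinedCells (𝒯 h) (x h)) :
    ∃ (σ D : ℝ), 0 < σ ∧ ∀ h, ∃ Q : cells (𝒯 h) → SplitCell d, IsSplitMesh Q Ω ∧
      (∀ K, (Q K).Regular σ) ∧ (∀ K, (Q K).h ≤ D) ∧
      (∀ m (u : L2 Ω), (∀ K ∈ cells (𝒯 h), IsPolyOn m K u) ↔ PiecewisePoly Q m u) ∧
      ∀ m (u : L2 Ω), (∀ T ∈ refinedCells (𝒯 h) (x h), IsPolyOn m T u) ↔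
        RefinedPiecewisePoly Q m u := by
  have hd0 : 0 < d := by omega
  obtain ⟨σ, hσ, H⟩ := exists_forall_regular hd hreg hregr
  refine ⟨σ, Metric.diam (closure Ω), hσ, fun h => ?_⟩
  choose Q e hQ using fun K : cells (𝒯 h) =>
    exists_describes hd0 ((𝒯 h).indep K.2.1) K.2.2 (hx h K K.2)
  refine ⟨Q, (h𝒯 h).isSplitMesh hd0 hΩ hQ, fun K => H h K K.2 (Q K) _ _ (hQ K)
    ((hQ K).mem_refinedCells K.2), fun K => ?_, forall_mem_cells_isPolyOn_iff hQ,
    forall_mem_refinedCells_isPolyOn_iff hQ⟩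
  rw [(hQ K).h_eq]
  refine Metric.diam_mono ?_ hΩ.isBounded.closure
  rw [← (h𝒯 h).space_eq]
  exact Geometry.SimplicialComplex.convexHull_subset_space K.2.1

theorem memH10_zero {Ω : Set (Pt d)} (hΩ : IsPolytopeDomain Ω) : MemH10 Ω (0 : L2 Ω) := by
  have := isFiniteMeasure_restrict_of_isBounded hΩ.isBounded
  have hm : MemLp (fun _ : Pt d => (0 : ℝ)) 2 (volume.restrict Ω) := MemLp.zero
  have h1 : hm.toLp _ = (0 : L2 Ω) := MemLp.toLp_zero hm
  rw [← h1]
  exact memH10_of_lipschitz hΩ.isOpen (LipschitzWith.const (0 : ℝ)) HasCompactSupport.zero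
    (fun _ _ => rfl) hm

theorem IsPolyOn.smul {Ω : Set (Pt d)} {k : ℕ} {K : Finset (Pt d)} {q : L2 Ω}
    (hq : IsPolyOn k K q) (c : ℝ) : IsPolyOn k K (c • q) := by
  obtain ⟨p, hp, H⟩ := hq
  refine ⟨MvPolynomial.C c * p, totalDegree_C_mul_le c hp, ?_⟩
  filter_upwards [H, Lp.coeFn_smul c q] with y hy e hyK
  rw [e, Pi.smul_apply, hy hyK, map_mul, MvPolynomial.eval_C, smul_eq_mul]

theorem isPolyOn_zero {Ω : Set (Pt d)} (k : ℕ) (K : Finset (Pt d)) : IsPolyOn k K (0 : L2 Ω) := by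
  refine ⟨0, by simp, ?_⟩
  filter_upwards [Lp.coeFn_zero ℝ 2 (volume.restrict Ω)] with y hy _
  rw [hy, map_zero, Pi.zero_apply]

theorem velocitySpace_infSupStable_iff {Ω : Set (Pt d)} (hΩ : IsPolytopeDomain Ω) {k : ℕ}
    {ι : Type*} (S : ι → Set (Finset (Pt d))) (M : ι → Set (L2 Ω)) :
    InfSupStable (fun h => velocitySpace Ω k (S h)) M ↔ ∃ β : ℝ, 0 < β ∧ ∀ h, ∀ q ∈ M h,
      ∃ v ∈ velocitySpace Ω k (S h), β * ‖q‖ ^ 2 ≤ inner ℝ q (wdiv v) ∧ vecH1Norm v ≤ ‖q‖ := by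
  have := isFiniteMeasure_restrict_of_isBounded hΩ.isBounded
  refine infSupStable_iff hΩ.isOpen (fun h j => ⟨memH10_zero hΩ, fun K _ => isPolyOn_zero k K⟩)
    (fun h v hv c j => ⟨(hv j).1.smul hΩ.isOpen c, fun K hK => ((hv j).2 K hK).smul c⟩)
    fun h v hv j => (hv j).1.1

end Spaces

end StokesFE

theorem mainTheorem5 {d : ℕ} (hd : 2 ≤ d) (k : ℕ) (hk : 1 ≤ k)
    (Ω : Set (StokesFE.Pt d)) (hΩ : StokesFE.IsPolytopeDomain Ω)
    {ι : Type*} (𝒯 : ι → Geometry.SimplicialComplex ℝ (StokesFE.Pt d))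
    (h𝒯 : ∀ h, StokesFE.IsTriangulation (𝒯 h) Ω)
    (x : ι → Finset (StokesFE.Pt d) → StokesFE.Pt d)
    (hx : ∀ h, ∀ K ∈ StokesFE.cells (𝒯 h), x h K ∈ interior (StokesFE.hull K))
    (hreg : StokesFE.ShapeRegular fun h => StokesFE.cells (𝒯 h))
    (hregr : StokesFE.ShapeRegular fun h => StokesFE.refinedCells (𝒯 h) (x h)) :
    StokesFE.InfSupStable
        (fun h => StokesFE.velocitySpace Ω k (StokesFE.refinedCells (𝒯 h) (x h)))
        (fun h => StokesFE.pressureSpace Ω (k - 1) (StokesFE.refinedCells (𝒯 h) (x h))) ↔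
      StokesFE.InfSupStable
        (fun h => StokesFE.velocitySpace Ω k (StokesFE.cells (𝒯 h)))
        (fun h => StokesFE.pressureSpace Ω 0 (StokesFE.cells (𝒯 h))) := by
  obtain ⟨m, rfl⟩ : ∃ m, k = m + 1 := ⟨k - 1, by omega⟩
  have hd0 : 0 < d := by omega
  obtain ⟨σ, D, hσ, H⟩ := StokesFE.exists_splitMesh hd hΩ 𝒯 h𝒯 x hx hreg hregr
  have hfin : ∀ h, Finite (StokesFE.cells (𝒯 h)) := fun h =>
    ((h𝒯 h).finite.subset fun K hK => hK.1).to_subtype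
  rw [StokesFE.velocitySpace_infSupStable_iff hΩ, StokesFE.velocitySpace_infSupStable_iff hΩ,
    Nat.add_sub_cancel]
  constructor
  · rintro ⟨γ, hγ, hst⟩
    obtain ⟨β, hβ, Hβ⟩ := StokesFE.exists_coarse_stable hd0 hk hσ D hγ
    refine ⟨β, hβ, fun h q hq => ?_⟩
    have := Fintype.ofFinite (StokesFE.cells (𝒯 h))
    obtain ⟨Q, hQ, hQr, hQD, hc, hr⟩ := H h
    have hq' := (hc 0 q).1 hq.2
    obtain ⟨v, hv, hv'⟩ := hst h q ⟨hq.1, (hr m q).2 (hq'.mono (Nat.zero_le m)).refined⟩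
    obtain ⟨w, hw, hw'⟩ := Hβ hQ hQr hQD q hq' ⟨v, fun j => ⟨(hv j).1, (hr _ _).1 (hv j).2⟩, hv'⟩
    exact ⟨w, fun j => ⟨(hw j).1, (hc _ _).2 (hw j).2⟩, hw'⟩
  · rintro ⟨γ, hγ, hst⟩
    obtain ⟨β, hβ, Hβ⟩ := StokesFE.exists_refined_stable hd0 m hσ D hγ
    refine ⟨β, hβ, fun h q hq => ?_⟩
    have := Fintype.ofFinite (StokesFE.cells (𝒯 h))
    obtain ⟨Q, hQ, hQr, hQD, hc, hr⟩ := H h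
    obtain ⟨w, hw, hw'⟩ := Hβ hQ hQr hQD (fun q' hq0 hq' => by
      obtain ⟨v, hv, hv'⟩ := hst h q' ⟨hq0, (hc 0 q').2 hq'⟩
      exact ⟨v, fun j => ⟨(hv j).1, (hc _ _).1 (hv j).2⟩, hv'⟩) q hq.1 ((hr m q).1 hq.2)
    exact ⟨w, fun j => ⟨(hw j).1, (hr _ _).2 (hw j).2⟩, hw'⟩
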